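/- Let $0<\alpha<\beta$ and let $\Omega\subseteq\mathbb R^3$ be a standard domain, that is, $\Omega$ is open, bounded, weak Lipschitz (every boundary point has an open neighbourhood $U$ with a bi-Lipschitz bijection onto $(-1,1)^3$ that maps $U\cap\Omega$, $U\cap\partial\Omega$ and $U\setminus\overline\Omega$ onto the parts of the cube where the third coordinate is negative, zero and positive, respectively), has the segment property (every boundary point has an open neighbourhood $U$ and a vector $y\neq0$ with $z+ty\in\Omega$ for all $z\in\overline\Omega\cap U$, $0<t<1$), and is topologically trivial: the only $u\in H_0(\operatorname{curl})$ with $\operatorname{div}u=0$ and $\operatorname{curl}u=0$, and the only $u\in H_0(\operatorname{div})$ with $\operatorname{div}u=0$ and $\operatorname{curl}u=0$, is $u=0$. All function spaces are complex; $H_0^1(\Omega)$, $H_0(\operatorname{curl})$, $H_0(\operatorname{div})$ are the closures of the smooth compactly supported functions (fields) in $H^1(\Omega)$, $H(\operatorname{curl})$, $H(\operatorname{div})$. Let $g_0=\{\operatorname{grad}u;\,u\in H_0^1(\Omega)\}$ and $c=\{\operatorname{curl}u;\,u\in H(\operatorname{curl})\}$, which are closed subspaces of $L^2(\Omega)^3$,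 with canonical embeddings $\iota_0\colon g_0\to L^2(\Omega)^3$ and $\iota_1\colon c\to L^2(\Omega)^3$. For a bounded linear operator $a$ on $L^2(\Omega)^3$ put $a_{jk}=\iota_j^*a\iota_k$ ($j,k\in\{0,1\}$). For an operator $T$ on a Hilbert space write $\operatorname{Re}T\ge r$ if $\operatorname{Re}\langle\varphi,T\varphi\rangle\ge r\|\varphi\|^2$ for all $\varphi$. Let $\mathcal M(\alpha,\beta,\Omega)$ be the set of invertible bounded linear operators $a$ on $L^2(\Omega)^3$ with $$\operatorname{Re}a_{00}\ge\alpha,\quad \operatorname{Re}a_{00}^{-1}\ge 1/\beta,\quad \operatorname{Re}(a^{-1})_{11}\ge 1/\beta,\quad \operatorname{Re}\big((a^{-1})_{11}\big)^{-1}\ge\alpha .$$ Let $\tau_{\mathrm{nlH}}$ be the initial topology on $\mathcal M(\alpha,\beta,\Omega)$ with respect to the four maps $$a\mapsto a_{00}^{-1},\qquad a\mapsto a_{10}a_{00}^{-1},\qquad a\mapsto a_{00}^{-1}a_{01},\qquad a\mapsto a_{11}-a_{10}a_{00}^{-1}a_{01}$$ into the spaces of bounded linear operators on $g_0$, from $g_0$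 to $c$, from $c$ to $g_0$, and on $c$, respectively, each with the weak operator topology. Let $\mathcal B\subseteq\mathcal M(\alpha,\beta,\Omega)$ be bounded in operator norm. Then the closure of $\mathcal B$ in $(\mathcal M(\alpha,\beta,\Omega),\tau_{\mathrm{nlH}})$, with the topology induced by $\tau_{\mathrm{nlH}}$, is compact and metrisable. -/

import Mathlib

open MeasureTheory Topology
open scoped ContDiff

noncomputable section

namespace NonlocalH

/-- Physical space `ℝ³`. -/
abbrev R3 := EuclideanSpace ℝ (Fin 3)

/-- Values of complex vector fields. -/
abbrev C3 := EuclideanSpace ℂ (Fin 3)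

/-- `L²(Ω)`, complex valued. -/
abbrev L2s (Ω : Set R3) := Lp ℂ 2 (volume.restrict Ω)

/-- `L²(Ω)³`, complex valued. -/
abbrev L2v (Ω : Set R3) := Lp C3 2 (volume.restrict Ω)

/-! ### Differential operators -/

/-- The partial derivative `∂ᵢ f`. -/
def pderiv (i : Fin 3) (f : R3 → ℂ) (x : R3) : ℂ :=
  fderiv ℝ f x (EuclideanSpace.single i 1)

/-- The classical gradient. -/
def grad (φ : R3 → ℂ) (x : R3) : C3 :=
  !₂[pderiv 0 φ x, pderiv 1 φ x, pderiv 2 φ x]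

/-- The classical divergence. -/
def dive (ψ : R3 → C3) (x : R3) : ℂ :=
  ∑ i, pderiv i (fun y => ψ y i) x

/-- The classical curl. -/
def curl (ψ : R3 → C3) (x : R3) : C3 :=
  !₂[pderiv 1 (fun y => ψ y 2) x - pderiv 2 (fun y => ψ y 1) x,
     pderiv 2 (fun y => ψ y 0) x - pderiv 0 (fun y => ψ y 2) x,
     pderiv 0 (fun y => ψ y 1) x - pderiv 1 (fun y => ψ y 0) x]

/-- Test functions: `φ ∈ C_c^∞(Ω)` (extended by zero to `ℝ³`). -/
def IsTest {F : Type*} [NormedAddCommGroup F] [NormedSpace ℝ F] (Ω : Set R3) (φ : R3 → F) :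
    Prop :=
  ContDiff ℝ ∞ φ ∧ HasCompactSupport φ ∧ tsupport φ ⊆ Ω

section Graphs

variable {F G : Type*} [NormedAddCommGroup F] [InnerProductSpace ℂ F]
  [NormedAddCommGroup G] [InnerProductSpace ℂ G]

/-- The pairs `(φ, D φ)`, `φ ∈ C_c^∞(Ω; F)`, as elements of `L²(Ω; F) × L²(Ω; G)`, for a
differential operator `D`. -/
def testPairs (Ω : Set R3) (D : (R3 → F) → (R3 → G)) :
    Set (Lp F 2 (volume.restrict Ω) × Lp G 2 (volume.restrict Ω)) :=
  {p | ∃ φ : R3 → F, IsTest Ω φ ∧ p.1 =ᵐ[volume.restrict Ω] φ ∧ p.2 =ᵐ[volume.restrict Ω] D φ}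

/-- The graph of the closure in `L²` of `D` on `C_c^∞(Ω; F)` (homogeneous boundary conditions).
For a linear differential operator `D` the set `testPairs Ω D` is already a linear subspace. -/
def minGraph (Ω : Set R3) (D : (R3 → F) → (R3 → G)) :
    Submodule ℂ (Lp F 2 (volume.restrict Ω) × Lp G 2 (volume.restrict Ω)) :=
  (Submodule.span ℂ (testPairs Ω D)).topologicalClosure

/-- The graph of a distributional differential operator in `L²`, where `D` is its formal adjoint:
`(v, w)` belongs to it iff `⟨D φ, v⟩ = ⟨φ, w⟩` in `L²(Ω)` for all test functions `φ`. -/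
def weakGraph (Ω : Set R3) (D : (R3 → F) → (R3 → G)) :
    Submodule ℂ (Lp G 2 (volume.restrict Ω) × Lp F 2 (volume.restrict Ω)) where
  carrier := {p | ∀ q ∈ testPairs Ω D, inner ℂ q.2 p.1 = inner ℂ q.1 p.2}
  add_mem' := by
    intro a b ha hb q hq
    simp only [Prod.fst_add, Prod.snd_add, inner_add_right, ha q hq, hb q hq]
  zero_mem' := by
    intro q _
    simp only [Prod.fst_zero, Prod.snd_zero, inner_zero_right]
  smul_mem' := by
    intro c a ha q hq
    simp only [Prod.smul_fst, Prod.smul_snd, inner_smul_right, ha q hq]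

end Graphs

/-- The graph of the distributional curl, with domain `H(curl)`. -/
def curlGraph (Ω : Set R3) : Submodule ℂ (L2v Ω × L2v Ω) := weakGraph Ω curl

/-- The graph of the distributional divergence, with domain `H(div)`; the formal adjoint of the
divergence is `-grad`. -/
def diveGraph (Ω : Set R3) : Submodule ℂ (L2v Ω × L2s Ω) := weakGraph Ω (fun φ => -grad φ)

/-- The graph of `grad` on `H_0^1(Ω)`, the closure of the test functions in `H^1(Ω)`. -/
def gradZeroGraph (Ω : Set R3) : Submodule ℂ (L2s Ω × L2v Ω) := minGraph Ω grad

/-- The graph of `curl` on `H_0(curl)`, the closure of the test fields in `H(curl)`. -/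
def curlZeroGraph (Ω : Set R3) : Submodule ℂ (L2v Ω × L2v Ω) := minGraph Ω curl

/-- The graph of `div` on `H_0(div)`, the closure of the test fields in `H(div)`. -/
def diveZeroGraph (Ω : Set R3) : Submodule ℂ (L2v Ω × L2s Ω) := minGraph Ω dive

/-- `g_0(Ω) = {grad u ; u ∈ H_0^1(Ω)}`. -/
def gZero (Ω : Set R3) : Submodule ℂ (L2v Ω) :=
  (gradZeroGraph Ω).map (LinearMap.snd ℂ (L2s Ω) (L2v Ω))

/-- `c(Ω) = {curl u ; u ∈ H(curl)}`. -/
def cRange (Ω : Set R3) : Submodule ℂ (L2v Ω) :=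
  (curlGraph Ω).map (LinearMap.snd ℂ (L2v Ω) (L2v Ω))

/-- The space `H_0(curl)`. -/
def HZeroCurl (Ω : Set R3) : Submodule ℂ (L2v Ω) :=
  (curlZeroGraph Ω).map (LinearMap.fst ℂ (L2v Ω) (L2v Ω))

/-- The space `H_0(div)`. -/
def HZeroDive (Ω : Set R3) : Submodule ℂ (L2v Ω) :=
  (diveZeroGraph Ω).map (LinearMap.fst ℂ (L2v Ω) (L2s Ω))

/-- The fields `u ∈ L²(Ω)³` with `curl u = 0`. -/
def kerCurl (Ω : Set R3) : Submodule ℂ (L2v Ω) :=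
  (curlGraph Ω).comap (LinearMap.inl ℂ (L2v Ω) (L2v Ω))

/-- The fields `u ∈ L²(Ω)³` with `div u = 0`. -/
def kerDive (Ω : Set R3) : Submodule ℂ (L2v Ω) :=
  (diveGraph Ω).comap (LinearMap.inl ℂ (L2v Ω) (L2s Ω))

/-- The harmonic Dirichlet fields. -/
def harmonicD (Ω : Set R3) : Submodule ℂ (L2v Ω) := HZeroCurl Ω ⊓ kerDive Ω ⊓ kerCurl Ω

/-- The harmonic Neumann fields. -/
def harmonicN (Ω : Set R3) : Submodule ℂ (L2v Ω) := HZeroDive Ω ⊓ kerDive Ω ⊓ kerCurl Ω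

/-! ### Standard domains -/

/-- The open cube `(-1,1)³`. -/
def cube : Set R3 := {y | ∀ i, |y i| < 1}

/-- Weak Lipschitz: near each boundary point `Ω` is mapped onto the lower half of the cube by a
bi-Lipschitz bijection that takes the boundary onto the middle slice. -/
def IsWeakLipschitz (Ω : Set R3) : Prop :=
  ∀ x ∈ frontier Ω, ∃ (U : Set R3) (χ : R3 → R3) (K L : NNReal),
    IsOpen U ∧ x ∈ U ∧ Set.BijOn χ U cube ∧ LipschitzOnWith K χ U ∧
    (∀ y ∈ U, ∀ z ∈ U, dist y z ≤ L * dist (χ y) (χ z)) ∧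
    χ '' (U ∩ Ω) = {y ∈ cube | y 2 < 0} ∧
    χ '' (U ∩ frontier Ω) = {y ∈ cube | y 2 = 0} ∧
    χ '' (U \ closure Ω) = {y ∈ cube | 0 < y 2}

/-- The segment property. -/
def HasSegmentProperty (Ω : Set R3) : Prop :=
  ∀ x ∈ frontier Ω, ∃ (U : Set R3) (y : R3), IsOpen U ∧ x ∈ U ∧ y ≠ 0 ∧
    ∀ z ∈ closure Ω ∩ U, ∀ t : ℝ, 0 < t → t < 1 → z + t • y ∈ Ω

/-- Topologically trivial: there are no nonzero harmonic Dirichlet or Neumann fields. -/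
def IsTopologicallyTrivial (Ω : Set R3) : Prop :=
  Module.rank ℂ (harmonicD Ω) = 0 ∧ Module.rank ℂ (harmonicN Ω) = 0

/-- Standard domains. -/
structure IsStandardDomain (Ω : Set R3) : Prop where
  isOpen : IsOpen Ω
  isBounded : Bornology.IsBounded Ω
  weakLipschitz : IsWeakLipschitz Ω
  topologicallyTrivial : IsTopologicallyTrivial Ω
  segmentProperty : HasSegmentProperty Ω

/-! ### Block operators -/

section Blocks

variable {H : Type*} [NormedAddCommGroup H] [InnerProductSpace ℂ H]

open Classical in
/-- The adjoint `ι_K^* : H → K` of the embedding `ι_K : K → H` of a closed subspace `K` of a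
Hilbert space `H`, that is, the orthogonal projection onto `K`, regarded as a map to `K`.
(For standard domains `g_0(Ω)` and `c(Ω)` are closed; the value `0` for other
subspaces is a convention.) -/
def embAdj (K : Submodule ℂ H) : H →L[ℂ] K :=
  if _h : K.HasOrthogonalProjection then K.orthogonalProjectionOnto else 0

/-- The block `ι_K^* a ι_L : L → K` of the operator `a`. -/
def block (a : H →L[ℂ] H) (K L : Submodule ℂ H) : L →L[ℂ] K :=
  embAdj K ∘L a ∘L L.subtypeL

/-- `Re T ≥ r`. -/
def ReGE (T : H →L[ℂ] H) (r : ℝ) : Prop :=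
  ∀ φ : H, r * ‖φ‖ ^ 2 ≤ (inner ℂ φ (T φ)).re

end Blocks

section Coefficients

variable {Ω : Set R3}

/-- `a₀₀`. -/
def a00 (a : L2v Ω →L[ℂ] L2v Ω) : gZero Ω →L[ℂ] gZero Ω := block a (gZero Ω) (gZero Ω)

/-- `a₀₁`. -/
def a01 (a : L2v Ω →L[ℂ] L2v Ω) : cRange Ω →L[ℂ] gZero Ω := block a (gZero Ω) (cRange Ω)

/-- `a₁₀`. -/
def a10 (a : L2v Ω →L[ℂ] L2v Ω) : gZero Ω →L[ℂ] cRange Ω := block a (cRange Ω) (gZero Ω)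

/-- `a₁₁`. -/
def a11 (a : L2v Ω →L[ℂ] L2v Ω) : cRange Ω →L[ℂ] cRange Ω := block a (cRange Ω) (cRange Ω)

end Coefficients

/-- The admissible nonlocal coefficients `𝓜(α, β, Ω)`. Inverses of operators are `Ring.inverse`;
the operators inverted besides `a` are invertible because their real parts are bounded below by a
positive constant. -/
def admissible (α β : ℝ) (Ω : Set R3) : Set (L2v Ω →L[ℂ] L2v Ω) :=
  {a | IsUnit a ∧
    ReGE (a00 a) α ∧
    ReGE (Ring.inverse (a00 a)) (1 / β) ∧
    ReGE (a11 (Ring.inverse a)) (1 / β) ∧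
    ReGE (Ring.inverse (a11 (Ring.inverse a))) α}

/-- The set `𝓜(α, β, Ω)` as a type of its own, to carry the topology `τ_nlH` (and not the norm
topology). -/
structure Coeff (α β : ℝ) (Ω : Set R3) where
  toCLM : L2v Ω →L[ℂ] L2v Ω
  mem : toCLM ∈ admissible α β Ω

/-- The topology `τ_nlH` of nonlocal `H`-convergence with respect to `(g_0(Ω), c(Ω))`: the initial
topology of four maps into spaces of operators with the weak operator topology. -/
instance tauNlH (α β : ℝ) (Ω : Set R3) : TopologicalSpace (Coeff α β Ω) :=
  TopologicalSpace.induced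
      (fun a => (.ofCLM (Ring.inverse (a00 a.toCLM)) : gZero Ω →WOT[ℂ] gZero Ω)) inferInstance ⊓
  TopologicalSpace.induced
      (fun a => (.ofCLM (a10 a.toCLM ∘L Ring.inverse (a00 a.toCLM)) :
        gZero Ω →WOT[ℂ] cRange Ω)) inferInstance ⊓
  TopologicalSpace.induced
      (fun a => (.ofCLM (Ring.inverse (a00 a.toCLM) ∘L a01 a.toCLM) :
        cRange Ω →WOT[ℂ] gZero Ω)) inferInstance ⊓
  TopologicalSpace.induced
      (fun a => (.ofCLM (a11 a.toCLM -
          a10 a.toCLM ∘L Ring.inverse (a00 a.toCLM) ∘L a01 a.toCLM) :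
        cRange Ω →WOT[ℂ] cRange Ω)) inferInstance

end NonlocalH

end

/-!
Compactness is abstract. If `H = G ⊕ C` is an orthogonal sum, the block `LDU` factorisation with
respect to it turns an admissible operator into the quadruple of its four components, and every
quadruple whose two diagonal components are sectorial (`Re T ≥ r` and `Re T⁻¹ ≥ s`) comes from
exactly one admissible operator. Sectoriality in this sense is closed in the weak operator topology,
although inversion is not continuous: `Re T⁻¹ ≥ s` amounts to `Re ⟨φ, T φ⟩ ≥ s ‖T φ‖²`, and the norm
is weakly lower semicontinuous. Hence the components of a norm bounded set lie in a closed subset of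
a product of operator balls, which is compact, and metrisable since `H` is separable.

It remains to see that `c` is the orthogonal complement of `g₀`. Poincaré's inequality makes `g₀`
closed. For `c`, triviality of the harmonic Dirichlet fields reduces the claim to the closedness of
the range of the curl, and this follows from the estimate
`dist(u, g₀ + V) ≤ const · ‖curl u‖` for test fields `u`, with `V` of finite dimension. To prove the
estimate, choose a potential `p` near `Ω` with `‖u - grad p‖ ≤ const · ‖curl u‖`. Outside `Ω`, where
`u = 0`, the gradient of `p` is therefore small. Reflect `p`, up to a constant in each chart, from
outside into `Ω` and subtract the reflections: the resulting function vanishes on the boundary, so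
that its gradient lies in `g₀`, and the error consists of small terms and of multiples of the
gradients of the cutoff functions.
-/

open scoped Ring

noncomputable section

namespace NonlocalH

/-! ### Sectorial operators and block factorisation -/

section WeakOperatorTopology

variable {𝕜 K L : Type*} [RCLike 𝕜] [NormedAddCommGroup K] [NormedSpace 𝕜 K]
  [NormedAddCommGroup L] [InnerProductSpace 𝕜 L]

open Filter in
theorem exists_tendsto_of_eventually_norm_le {ι E : Type*} [SeminormedAddCommGroup E]
    [ProperSpace E] {U : Ultrafilter ι} {f : ι → E} {c : ℝ} (h : ∀ᶠ i in U, ‖f i‖ ≤ c) :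
    ∃ z, ‖z‖ ≤ c ∧ Tendsto f U (𝓝 z) := by
  obtain ⟨z, hz, hlim⟩ := (isCompact_closedBall (0 : E) c).ultrafilter_le_nhds (U.map f)
    (le_principal_iff.2 (h.mono fun i hi => mem_closedBall_zero_iff.2 hi))
  exact ⟨z, mem_closedBall_zero_iff.1 hz, hlim⟩

open Filter in
/-- A limit along an ultrafilter of the sesquilinear forms `⟪T x, y⟫` is again a form with the same
bound, hence is represented by an operator. -/
theorem isCompact_setOf_norm_toCLM_le [CompleteSpace L] (r : ℝ) :
    IsCompact {T : K →WOT[𝕜] L | ‖T.toCLM‖ ≤ r} := by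
  rw [isCompact_iff_ultrafilter_le_nhds]
  intro U hU
  have hr : 0 ≤ r := by
    obtain ⟨T, hT⟩ := U.nonempty_of_mem (le_principal_iff.1 hU)
    exact (norm_nonneg _).trans hT
  have hbound (x : K) (y : L) :
      ∀ᶠ T : K →WOT[𝕜] L in U, ‖inner 𝕜 (T x) y‖ ≤ r * ‖x‖ * ‖y‖ := by
    filter_upwards [le_principal_iff.1 hU] with T hT
    exact (norm_inner_le_norm _ _).trans (by gcongr; exact T.toCLM.le_of_opNorm_le hT x)
  choose b hb hlim using fun x y => exists_tendsto_of_eventually_norm_le (hbound x y)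
  let form : K →ₗ⋆[𝕜] L →ₗ[𝕜] 𝕜 := LinearMap.mk₂'ₛₗ (starRingEnd 𝕜) (RingHom.id 𝕜) b
    (fun x x' y => tendsto_nhds_unique (hlim (x + x') y)
      (((hlim x y).add (hlim x' y)).congr fun T => by rw [map_add, inner_add_left]))
    (fun c x y => tendsto_nhds_unique (hlim (c • x) y)
      (((hlim x y).const_mul _).congr fun T => by rw [map_smul, inner_smul_left]))
    (fun x y y' => tendsto_nhds_unique (hlim x (y + y'))
      (((hlim x y).add (hlim x y')).congr fun T => by rw [inner_add_right]))
    (fun c x y => tendsto_nhds_unique (hlim x (c • y))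
      (((hlim x y).const_mul _).congr fun T => by rw [inner_smul_right, RingHom.id_apply]))
  let T : K →L[𝕜] L :=
    (InnerProductSpace.toDual 𝕜 L).symm.toContinuousLinearEquiv.toContinuousLinearMap.comp
      (form.mkContinuous₂ r hb)
  have hT (x : K) (y : L) : inner 𝕜 (T x) y = b x y :=
    InnerProductSpace.toDual_symm_apply
  refine ⟨.ofCLM T, T.opNorm_le_bound hr fun x => ?_, ?_⟩
  · calc ‖T x‖ = ‖form.mkContinuous₂ r hb x‖ := (InnerProductSpace.toDual 𝕜 L).symm.norm_map _
      _ ≤ r * ‖x‖ := (form.mkContinuous₂ r hb).le_of_opNorm_le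
          (form.mkContinuous₂_norm_le hr hb) x
  · rw [ContinuousLinearMapWOT.le_nhds_iff_forall_inner_apply_le_nhds]
    intro x y
    have hconj := (RCLike.continuous_conj.tendsto _).comp (hlim x y)
    simp only [Function.comp_def, inner_conj_symm, ← hT] at hconj
    exact hconj

/-- The matrix coefficients of an operator with respect to two sequences of vectors. -/
def matrixCoeff (x : ℕ → K) (y : ℕ → L) (T : K →WOT[𝕜] L) : ℕ × ℕ → 𝕜 :=
  fun n => inner 𝕜 (y n.2) (T (x n.1))

theorem continuous_matrixCoeff [CompleteSpace L] (x : ℕ → K) (y : ℕ → L) :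
    Continuous (matrixCoeff (𝕜 := 𝕜) x y) :=
  continuous_pi fun _ => ContinuousLinearMapWOT.continuous_inner_apply continuous_id _ _

theorem injective_matrixCoeff {x : ℕ → K} {y : ℕ → L} (hx : DenseRange x) (hy : DenseRange y) :
    Function.Injective (matrixCoeff (𝕜 := 𝕜) x y) := by
  intro S T h
  have hseq : S.toCLM ∘ x = T.toCLM ∘ x := funext fun m => ext_inner_left 𝕜 <| congrFun <|
    hy.equalizer (continuous_id.inner continuous_const) (continuous_id.inner continuous_const)
      (funext fun n => congrFun h (m, n))
  exact ContinuousLinearMapWOT.ext <|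
    congrFun (hx.equalizer S.toCLM.continuous T.toCLM.continuous hseq)

end WeakOperatorTopology

section Sectorial

variable {L : Type*} [NormedAddCommGroup L] [InnerProductSpace ℂ L]

theorem norm_sq_le_iff_forall_re_inner (c : ℝ) (y : L) :
    ‖y‖ ^ 2 ≤ c ↔ ∀ z : L, 2 * (inner ℂ z y).re - ‖z‖ ^ 2 ≤ c := by
  refine ⟨fun h z => ?_, fun h => ?_⟩
  · have hsq := norm_sub_sq (𝕜 := ℂ) z y
    rw [RCLike.re_eq_complex_re] at hsq
    linarith [sq_nonneg ‖z - y‖]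
  · have hself : (inner ℂ y y).re = ‖y‖ ^ 2 := inner_self_eq_norm_sq (𝕜 := ℂ) y
    linarith [h y]

/-- The operators with `Re T ≥ r` and `Re T⁻¹ ≥ s`, the second condition being written without the
inverse so that it passes to limits in the weak operator topology. -/
def IsSectorial (r s : ℝ) (T : L →L[ℂ] L) : Prop :=
  ∀ ψ, r * ‖ψ‖ ^ 2 ≤ (inner ℂ ψ (T ψ)).re ∧ s * ‖T ψ‖ ^ 2 ≤ (inner ℂ ψ (T ψ)).re

variable {r s : ℝ} {T : L →L[ℂ] L}

theorem isClosed_setOf_isSectorial [CompleteSpace L] (r : ℝ) (hs : 0 < s) :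
    IsClosed {T : L →WOT[ℂ] L | IsSectorial r s T.toCLM} := by
  have hcont (x y : L) : Continuous fun T : L →WOT[ℂ] L => (inner ℂ y (T.toCLM x)).re :=
    Complex.continuous_re.comp (ContinuousLinearMapWOT.continuous_inner_apply continuous_id x y)
  simp only [IsSectorial, ← le_div_iff₀' hs, norm_sq_le_iff_forall_re_inner, Set.ofPred_forall,
    Set.ofPred_and]
  exact isClosed_iInter fun ψ => (isClosed_le continuous_const (hcont ψ ψ)).inter <|
    isClosed_iInter fun z => isClosed_le (((hcont ψ z).const_mul 2).sub continuous_const)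
      ((hcont ψ ψ).div_const s)

theorem IsSectorial.norm_le (hT : IsSectorial r s T) (hs : 0 < s) : ‖T‖ ≤ s⁻¹ := by
  refine T.opNorm_le_bound (inv_nonneg.2 hs.le) fun ψ => ?_
  have hsq : s * ‖T ψ‖ ^ 2 ≤ ‖ψ‖ * ‖T ψ‖ :=
    (hT ψ).2.trans ((Complex.re_le_norm _).trans (norm_inner_le_norm ψ (T ψ)))
  rw [inv_mul_eq_div, le_div_iff₀ hs]
  by_contra! hlt
  nlinarith [norm_nonneg (T ψ), norm_nonneg ψ]

theorem ReGE.isUnit [CompleteSpace L] (hT : ReGE T r) (hr : 0 < r) : IsUnit T := by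
  refine ContinuousLinearMap.isUnit_of_forall_le_norm_inner_map T (c := ⟨r, hr.le⟩) hr fun x => ?_
  calc ‖x‖ ^ 2 * r = r * ‖x‖ ^ 2 := mul_comm _ _
    _ ≤ (inner ℂ x (T x)).re := hT x
    _ ≤ ‖inner ℂ x (T x)‖ := Complex.re_le_norm _
    _ = ‖inner ℂ (T x) x‖ := norm_inner_symm _ _

theorem inverse_apply_self (hT : IsUnit T) (x : L) : Ring.inverse T (T x) = x :=
  DFunLike.congr_fun (Ring.inverse_mul_cancel T hT) x

theorem apply_inverse_self (hT : IsUnit T) (x : L) : T (Ring.inverse T x) = x :=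
  DFunLike.congr_fun (Ring.mul_inverse_cancel T hT) x

theorem isSectorial_iff_reGE_inverse (hT : IsUnit T) :
    IsSectorial r s T ↔ ReGE T r ∧ ReGE (Ring.inverse T) s := by
  have hsymm (x y : L) : (inner ℂ x y).re = (inner ℂ y x).re := inner_re_symm (𝕜 := ℂ) x y
  refine ⟨fun h => ⟨fun ψ => (h ψ).1, fun ψ => ?_⟩, fun h ψ => ⟨h.1 ψ, ?_⟩⟩
  · simpa only [apply_inverse_self hT, hsymm _ ψ] using (h (Ring.inverse T ψ)).2
  · simpa only [inverse_apply_self hT, hsymm (T ψ)] using h.2 (T ψ)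

theorem isSectorial_inverse_iff (hT : IsUnit T) :
    IsSectorial r s (Ring.inverse T) ↔ IsSectorial s r T := by
  rw [isSectorial_iff_reGE_inverse hT.ringInverse, isSectorial_iff_reGE_inverse hT,
    Ring.inverse_inverse hT, and_comm]

end Sectorial

section BlockDecomposition

variable {H : Type*} [NormedAddCommGroup H] [InnerProductSpace ℂ H] {G C : Submodule ℂ H}

theorem embAdj_eq_orthogonalProjectionOnto (K : Submodule ℂ H) [hK : K.HasOrthogonalProjection] :
    embAdj K = K.orthogonalProjectionOnto :=
  dif_pos hK

theorem embAdj_coe (K : Submodule ℂ H) [K.HasOrthogonalProjection] (x : K) :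
    embAdj K (x : H) = x := by
  rw [embAdj_eq_orthogonalProjectionOnto, Submodule.orthogonalProjectionOnto_mem_subspace_eq_self]

theorem norm_embAdj_le_one (K : Submodule ℂ H) [K.HasOrthogonalProjection] : ‖embAdj K‖ ≤ 1 :=
  embAdj_eq_orthogonalProjectionOnto K ▸ K.orthogonalProjectionOnto_norm_le

theorem norm_block_le (a : H →L[ℂ] H) (K L : Submodule ℂ H) [K.HasOrthogonalProjection] :
    ‖block a K L‖ ≤ ‖a‖ :=
  calc ‖block a K L‖ ≤ ‖embAdj K‖ * (‖a‖ * ‖L.subtypeL‖) := by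
        grw [block, ContinuousLinearMap.opNorm_comp_le, ContinuousLinearMap.opNorm_comp_le]
    _ ≤ 1 * (‖a‖ * 1) := by
        gcongr
        exacts [norm_embAdj_le_one K, L.norm_subtypeL_le]
    _ = ‖a‖ := by ring

variable [G.HasOrthogonalProjection] (hC : C = Gᗮ)
include hC

theorem embAdj_coe_orthogonal (c : C) : embAdj G (c : H) = 0 := by
  rw [embAdj_eq_orthogonalProjectionOnto,
    Submodule.orthogonalProjectionOnto_apply_of_mem_orthogonal (hC ▸ c.2)]

theorem embAdj_orthogonal_coe (g : G) : embAdj C (g : H) = 0 := by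
  subst hC
  rw [embAdj_eq_orthogonalProjectionOnto,
    Submodule.orthogonalProjectionOnto_apply_of_mem_orthogonal (G.le_orthogonal_orthogonal g.2)]

theorem embAdj_orthogonal_coe_self (c : C) : embAdj C (c : H) = c := by
  subst hC
  exact embAdj_coe Gᗮ c

theorem embAdj_add_embAdj (x : H) : (embAdj G x : H) + (embAdj C x : H) = x := by
  subst hC
  rw [embAdj_eq_orthogonalProjectionOnto, embAdj_eq_orthogonalProjectionOnto,
    Submodule.orthogonalProjectionOnto_orthogonal]
  exact add_sub_cancel _ _

theorem block_mul (a b : H →L[ℂ] H) (K L : Submodule ℂ H) :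
    block (a * b) K L = block a K G ∘L block b G L + block a K C ∘L block b C L := by
  ext1 x
  change embAdj K (a (b x)) = embAdj K (a (embAdj G (b x))) + embAdj K (a (embAdj C (b x)))
  rw [← map_add, ← map_add, embAdj_add_embAdj hC]

theorem block_one_orthogonal_right : block (1 : H →L[ℂ] H) G C = 0 :=
  ContinuousLinearMap.ext (embAdj_coe_orthogonal hC)

theorem block_one_orthogonal_left : block (1 : H →L[ℂ] H) C G = 0 :=
  ContinuousLinearMap.ext (embAdj_orthogonal_coe hC)

theorem block_one_orthogonal : block (1 : H →L[ℂ] H) C C = 1 :=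
  ContinuousLinearMap.ext (embAdj_orthogonal_coe_self hC)

theorem ext_of_block_eq {a b : H →L[ℂ] H} (hGG : block a G G = block b G G)
    (hGC : block a G C = block b G C) (hCG : block a C G = block b C G)
    (hCC : block a C C = block b C C) : a = b := by
  have apply_eq (L : Submodule ℂ H) (hG : block a G L = block b G L)
      (hC' : block a C L = block b C L) (x : L) : a x = b x := by
    rw [← embAdj_add_embAdj hC (a x), ← embAdj_add_embAdj hC (b x)]
    exact congr(($hG x : H) + ($hC' x : H))
  ext1 x
  rw [← embAdj_add_embAdj hC x, map_add, map_add, apply_eq G hGG hCG, apply_eq C hGC hCC]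

omit [G.HasOrthogonalProjection] hC in
/-- The Schur complement of the block `a₀₀`, the fourth component of nonlocal `H`-convergence. -/
def schurComplement (G C : Submodule ℂ H) (a : H →L[ℂ] H) : C →L[ℂ] C :=
  block a C C - block a C G ∘L (block a G G)⁻¹ʳ ∘L block a G C

theorem schurComplement_mul_block_inverse {a : H →L[ℂ] H} (ha : IsUnit a)
    (h00 : IsUnit (block a G G)) : schurComplement G C a * block a⁻¹ʳ C C = 1 := by
  have hGC := block_mul hC a a⁻¹ʳ G C
  have hCC := block_mul hC a a⁻¹ʳ C C
  rw [Ring.mul_inverse_cancel a ha, block_one_orthogonal_right hC] at hGC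
  rw [Ring.mul_inverse_cancel a ha, block_one_orthogonal hC] at hCC
  have hsolve (c : C) :
      (block a G G)⁻¹ʳ (block a G C (block a⁻¹ʳ C C c)) = -block a⁻¹ʳ G C c := by
    rw [← inverse_apply_self h00 (block a⁻¹ʳ G C c), ← map_neg]
    exact congrArg _ (eq_neg_of_add_eq_zero_right congr($hGC.symm c))
  ext1 c
  change block a C C (block a⁻¹ʳ C C c) -
    block a C G ((block a G G)⁻¹ʳ (block a G C (block a⁻¹ʳ C C c))) = c
  rw [hsolve, map_neg, sub_neg_eq_add, add_comm]
  exact congr($hCC.symm c)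

theorem block_inverse_mul_schurComplement {a : H →L[ℂ] H} (ha : IsUnit a)
    (h00 : IsUnit (block a G G)) : block a⁻¹ʳ C C * schurComplement G C a = 1 := by
  have hCG := block_mul hC a⁻¹ʳ a C G
  have hCC := block_mul hC a⁻¹ʳ a C C
  rw [Ring.inverse_mul_cancel a ha, block_one_orthogonal_left hC] at hCG
  rw [Ring.inverse_mul_cancel a ha, block_one_orthogonal hC] at hCC
  have hsolve (g : G) :
      block a⁻¹ʳ C C (block a C G ((block a G G)⁻¹ʳ g)) = -block a⁻¹ʳ C G g := by
    conv_rhs => rw [← apply_inverse_self h00 g]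
    exact eq_neg_of_add_eq_zero_right congr($hCG.symm ((block a G G)⁻¹ʳ g))
  ext1 c
  change block a⁻¹ʳ C C (block a C C c - block a C G ((block a G G)⁻¹ʳ _)) = c
  rw [map_sub, hsolve, sub_neg_eq_add, add_comm]
  exact congr($hCC.symm c)

theorem isUnit_schurComplement {a : H →L[ℂ] H} (ha : IsUnit a) (h00 : IsUnit (block a G G)) :
    IsUnit (schurComplement G C a) :=
  ⟨⟨_, _, schurComplement_mul_block_inverse hC ha h00,
    block_inverse_mul_schurComplement hC ha h00⟩, rfl⟩

theorem inverse_schurComplement {a : H →L[ℂ] H} (ha : IsUnit a) (h00 : IsUnit (block a G G)) :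
    (schurComplement G C a)⁻¹ʳ = block a⁻¹ʳ C C :=
  Ring.inverse_unit ⟨_, _, schurComplement_mul_block_inverse hC ha h00,
    block_inverse_mul_schurComplement hC ha h00⟩

omit [G.HasOrthogonalProjection] hC in
/-- The operator with prescribed blocks with respect to the decomposition into `G` and `C`. -/
def ofBlocks (A : G →L[ℂ] G) (B : C →L[ℂ] G) (D : G →L[ℂ] C) (E : C →L[ℂ] C) : H →L[ℂ] H :=
  G.subtypeL ∘L (A ∘L embAdj G + B ∘L embAdj C) + C.subtypeL ∘L (D ∘L embAdj G + E ∘L embAdj C)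

section ofBlocks

variable (A : G →L[ℂ] G) (B : C →L[ℂ] G) (D : G →L[ℂ] C) (E : C →L[ℂ] C)

omit [G.HasOrthogonalProjection] hC in
theorem ofBlocks_apply (x : H) : ofBlocks A B D E x =
    ((A (embAdj G x) + B (embAdj C x) : G) : H) + ((D (embAdj G x) + E (embAdj C x) : C) : H) :=
  rfl

theorem block_ofBlocks₀₀ : block (ofBlocks A B D E) G G = A := by
  ext1 g
  simp only [block, ContinuousLinearMap.comp_apply, Submodule.subtypeL_apply, ofBlocks_apply,
    embAdj_coe, embAdj_orthogonal_coe hC, embAdj_coe_orthogonal hC, map_add, map_zero, add_zero]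

theorem block_ofBlocks₀₁ : block (ofBlocks A B D E) G C = B := by
  ext1 c
  simp only [block, ContinuousLinearMap.comp_apply, Submodule.subtypeL_apply, ofBlocks_apply,
    embAdj_coe, embAdj_coe_orthogonal hC, embAdj_orthogonal_coe_self hC, map_add, map_zero,
    zero_add, add_zero]

theorem block_ofBlocks₁₀ : block (ofBlocks A B D E) C G = D := by
  ext1 g
  simp only [block, ContinuousLinearMap.comp_apply, Submodule.subtypeL_apply, ofBlocks_apply,
    embAdj_coe, embAdj_orthogonal_coe hC, embAdj_orthogonal_coe_self hC, map_add, map_zero,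
    zero_add, add_zero]

theorem block_ofBlocks₁₁ : block (ofBlocks A B D E) C C = E := by
  ext1 c
  simp only [block, ContinuousLinearMap.comp_apply, Submodule.subtypeL_apply, ofBlocks_apply,
    embAdj_coe_orthogonal hC, embAdj_orthogonal_coe hC, embAdj_orthogonal_coe_self hC, map_add,
    map_zero, zero_add]

theorem ofBlocks_mul_ofBlocks (A' : G →L[ℂ] G) (B' : C →L[ℂ] G) (D' : G →L[ℂ] C)
    (E' : C →L[ℂ] C) : ofBlocks A B D E * ofBlocks A' B' D' E' =
      ofBlocks (A ∘L A' + B ∘L D') (A ∘L B' + B ∘L E') (D ∘L A' + E ∘L D')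
        (D ∘L B' + E ∘L E') := by
  apply ext_of_block_eq hC <;>
    simp only [block_mul hC, block_ofBlocks₀₀ hC, block_ofBlocks₀₁ hC, block_ofBlocks₁₀ hC,
      block_ofBlocks₁₁ hC]

theorem ofBlocks_id : ofBlocks (.id ℂ G) 0 0 (.id ℂ C) = 1 :=
  ContinuousLinearMap.ext fun x => by
    simpa [ofBlocks_apply] using embAdj_add_embAdj hC x

theorem isUnit_ofBlocks_lower : IsUnit (ofBlocks (.id ℂ G) 0 D (.id ℂ C)) :=
  isUnit_iff_exists.2 ⟨ofBlocks (.id ℂ G) 0 (-D) (.id ℂ C), by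
    simp [ofBlocks_mul_ofBlocks hC, ofBlocks_id hC]⟩

theorem isUnit_ofBlocks_upper : IsUnit (ofBlocks (.id ℂ G) B 0 (.id ℂ C)) :=
  isUnit_iff_exists.2 ⟨ofBlocks (.id ℂ G) (-B) 0 (.id ℂ C), by
    simp [ofBlocks_mul_ofBlocks hC, ofBlocks_id hC]⟩

variable {A E}

theorem isUnit_ofBlocks_diag (hA : IsUnit A) (hE : IsUnit E) : IsUnit (ofBlocks A 0 0 E) :=
  isUnit_iff_exists.2 ⟨ofBlocks A⁻¹ʳ 0 0 E⁻¹ʳ, by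
    simp [ofBlocks_mul_ofBlocks hC, ← ContinuousLinearMap.mul_def, Ring.mul_inverse_cancel,
      Ring.inverse_mul_cancel, ContinuousLinearMap.one_def, hA, hE, ofBlocks_id hC]⟩

/-- The factorisation into a lower triangular, a diagonal and an upper triangular operator. -/
theorem isUnit_ofBlocks (hA : IsUnit A) (hE : IsUnit E) :
    IsUnit (ofBlocks A (A ∘L B) (D ∘L A) (E + D ∘L A ∘L B)) := by
  have hprod := ((isUnit_ofBlocks_lower hC D).mul (isUnit_ofBlocks_diag hC hA hE)).mul
    (isUnit_ofBlocks_upper hC B)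
  simpa [ofBlocks_mul_ofBlocks hC, ContinuousLinearMap.comp_assoc, add_comm] using hprod

end ofBlocks

end BlockDecomposition

section NonlocalHCompactness

variable {H : Type*} [NormedAddCommGroup H] [InnerProductSpace ℂ H] {G C : Submodule ℂ H}
  {α β : ℝ}

/-- The space of quadruples of operators in which nonlocal `H`-convergence is tested. -/
abbrev Components (G C : Submodule ℂ H) : Type _ :=
  (G →WOT[ℂ] G) × (G →WOT[ℂ] C) × (C →WOT[ℂ] G) × (C →WOT[ℂ] C)

/-- The quadruple `(a₀₀⁻¹, a₁₀ a₀₀⁻¹, a₀₀⁻¹ a₀₁, a₁₁ - a₁₀ a₀₀⁻¹ a₀₁)` of an operator `a`. -/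
def components (G C : Submodule ℂ H) (a : H →L[ℂ] H) : Components G C :=
  (.ofCLM (block a G G)⁻¹ʳ, .ofCLM (block a C G ∘L (block a G G)⁻¹ʳ),
    .ofCLM ((block a G G)⁻¹ʳ ∘L block a G C), .ofCLM (schurComplement G C a))

/-- The operator with prescribed components, the inverse of `components`. -/
def ofComponents (T : Components G C) : H →L[ℂ] H :=
  ofBlocks T.1.toCLM⁻¹ʳ (T.1.toCLM⁻¹ʳ ∘L T.2.2.1.toCLM) (T.2.1.toCLM ∘L T.1.toCLM⁻¹ʳ)
    (T.2.2.2.toCLM + T.2.1.toCLM ∘L T.1.toCLM⁻¹ʳ ∘L T.2.2.1.toCLM)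

theorem components_ofComponents [G.HasOrthogonalProjection] (hC : C = Gᗮ) {T : Components G C}
    (hT : IsUnit T.1.toCLM) : components G C (ofComponents T) = T := by
  obtain ⟨⟨T₁⟩, ⟨T₂⟩, ⟨T₃⟩, ⟨T₄⟩⟩ := T
  have hcancel (x : G) : T₁ (T₁⁻¹ʳ x) = x := apply_inverse_self hT x
  have hcancel' (x : G) : T₁⁻¹ʳ (T₁ x) = x := inverse_apply_self hT x
  simp only [components, ofComponents, schurComplement, block_ofBlocks₀₀ hC, block_ofBlocks₀₁ hC,
    block_ofBlocks₁₀ hC, block_ofBlocks₁₁ hC, Ring.inverse_inverse hT]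
  congr <;> ext x <;> simp [hcancel, hcancel']

theorem ofComponents_components [G.HasOrthogonalProjection] (hC : C = Gᗮ) {a : H →L[ℂ] H}
    (h00 : IsUnit (block a G G)) : ofComponents (components G C a) = a := by
  apply ext_of_block_eq hC <;>
    simp only [components, ofComponents, schurComplement, block_ofBlocks₀₀ hC,
      block_ofBlocks₀₁ hC, block_ofBlocks₁₀ hC, block_ofBlocks₁₁ hC, Ring.inverse_inverse h00] <;>
    ext x <;> simp [inverse_apply_self h00, apply_inverse_self h00]

/-- The operators `a` that satisfy the conditions defining `𝓜(α, β, Ω)` with respect to an arbitrary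
pair of subspaces. -/
def admissibleFor (α β : ℝ) (G C : Submodule ℂ H) : Set (H →L[ℂ] H) :=
  {a | IsUnit a ∧ ReGE (block a G G) α ∧ ReGE (block a G G)⁻¹ʳ (1 / β) ∧
    ReGE (block a⁻¹ʳ C C) (1 / β) ∧ ReGE (block a⁻¹ʳ C C)⁻¹ʳ α}

theorem mem_admissibleFor_iff [G.HasOrthogonalProjection] (hC : C = Gᗮ) {a : H →L[ℂ] H}
    (ha : IsUnit a) (h00 : IsUnit (block a G G)) :
    a ∈ admissibleFor α β G C ↔
      IsSectorial α (1 / β) (block a G G) ∧ IsSectorial α (1 / β) (schurComplement G C a) := by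
  have hS := isUnit_schurComplement hC ha h00
  rw [isSectorial_iff_reGE_inverse h00, isSectorial_iff_reGE_inverse hS,
    inverse_schurComplement hC ha h00, admissibleFor, Set.mem_ofPred_eq,
    ← inverse_schurComplement hC ha h00, Ring.inverse_inverse hS]
  tauto

/-- The quadruples with sectorial diagonal components. -/
def sectorialComponents (α β : ℝ) (G C : Submodule ℂ H) : Set (Components G C) :=
  {T | IsSectorial (1 / β) α T.1.toCLM ∧ IsSectorial α (1 / β) T.2.2.2.toCLM}

theorem isUnit_block_of_mem_admissibleFor [CompleteSpace G] (hα : 0 < α) {a : H →L[ℂ] H}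
    (ha : a ∈ admissibleFor α β G C) : IsUnit (block a G G) :=
  ha.2.1.isUnit hα

theorem image_components_admissibleFor [CompleteSpace G] [CompleteSpace C] (hα : 0 < α)
    (hβ : 0 < β) (hC : C = Gᗮ) :
    components G C '' admissibleFor α β G C = sectorialComponents α β G C := by
  refine subset_antisymm ?_ fun T hT => ?_
  · rintro _ ⟨a, ha, rfl⟩
    have h00 := isUnit_block_of_mem_admissibleFor hα ha
    obtain ⟨hA, hS⟩ := (mem_admissibleFor_iff hC ha.1 h00).1 ha
    exact ⟨(isSectorial_inverse_iff h00).2 hA, hS⟩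
  · have hT₁ : IsUnit T.1.toCLM := ReGE.isUnit (fun ψ => (hT.1 ψ).1) (by positivity : 0 < 1 / β)
    have hT₄ : IsUnit T.2.2.2.toCLM := ReGE.isUnit (fun ψ => (hT.2 ψ).1) hα
    have hcomp := components_ofComponents hC hT₁
    have h00 : block (ofComponents T) G G = T.1.toCLM⁻¹ʳ := block_ofBlocks₀₀ hC _ _ _ _
    have hS : schurComplement G C (ofComponents T) = T.2.2.2.toCLM :=
      congrArg (fun T' : Components G C => T'.2.2.2.toCLM) hcomp
    have hunit : IsUnit (ofComponents T) := isUnit_ofBlocks hC _ _ hT₁.ringInverse hT₄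
    refine ⟨ofComponents T, (mem_admissibleFor_iff hC hunit ?_).2 ⟨?_, ?_⟩, hcomp⟩
    · rw [h00]
      exact hT₁.ringInverse
    · rw [h00, isSectorial_inverse_iff hT₁]
      exact hT.1
    · rw [hS]
      exact hT.2

theorem injOn_components [CompleteSpace G] (hα : 0 < α) (hC : C = Gᗮ) :
    Set.InjOn (components G C) (admissibleFor α β G C) :=
  Set.LeftInvOn.injOn (f₁' := ofComponents) fun _ ha =>
    ofComponents_components hC (isUnit_block_of_mem_admissibleFor hα ha)

theorem isClosed_sectorialComponents [CompleteSpace G] [CompleteSpace C] (hα : 0 < α)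
    (hβ : 0 < β) : IsClosed (sectorialComponents α β G C) :=
  ((isClosed_setOf_isSectorial (1 / β) hα).preimage continuous_fst).inter
    ((isClosed_setOf_isSectorial α (one_div_pos.2 hβ)).preimage
      (continuous_snd.comp (continuous_snd.comp continuous_snd)))

/-- The quadruples of operators of norm at most `r`. -/
def componentBox (G C : Submodule ℂ H) (r : ℝ) : Set (Components G C) :=
  {T | ‖T.toCLM‖ ≤ r} ×ˢ {T | ‖T.toCLM‖ ≤ r} ×ˢ {T | ‖T.toCLM‖ ≤ r} ×ˢ {T | ‖T.toCLM‖ ≤ r}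

theorem isCompact_componentBox [CompleteSpace G] [CompleteSpace C] (r : ℝ) :
    IsCompact (componentBox G C r) :=
  (isCompact_setOf_norm_toCLM_le r).prod <| (isCompact_setOf_norm_toCLM_le r).prod <|
    (isCompact_setOf_norm_toCLM_le r).prod (isCompact_setOf_norm_toCLM_le r)

theorem exists_mapsTo_componentBox [CompleteSpace G] [CompleteSpace C] (hα : 0 < α) (hβ : 0 < β)
    (hC : C = Gᗮ) {B : Set (H →L[ℂ] H)} (hB : Bornology.IsBounded B) :
    ∃ r, Set.MapsTo (components G C) (B ∩ admissibleFor α β G C) (componentBox G C r) := by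
  obtain ⟨R, hR, hBR⟩ := hB.exists_pos_norm_le
  refine ⟨max (max α⁻¹ (1 / β)⁻¹) (R * α⁻¹), fun a ⟨haB, ha⟩ => ?_⟩
  have h00 := isUnit_block_of_mem_admissibleFor hα ha
  obtain ⟨hA, hS⟩ := (mem_admissibleFor_iff hC ha.1 h00).1 ha
  have hinv : ‖(block a G G)⁻¹ʳ‖ ≤ α⁻¹ := ((isSectorial_inverse_iff h00).2 hA).norm_le hα
  have hblock (K L : Submodule ℂ H) [K.HasOrthogonalProjection] : ‖block a K L‖ ≤ R :=
    (norm_block_le a K L).trans (hBR a haB)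
  refine ⟨hinv.trans (by simp), ?_, ?_,
    (hS.norm_le (one_div_pos.2 hβ)).trans (by simp)⟩
  · calc ‖block a C G ∘L (block a G G)⁻¹ʳ‖ ≤ R * α⁻¹ := by
          grw [ContinuousLinearMap.opNorm_comp_le, hblock, hinv]
      _ ≤ _ := le_max_right _ _
  · calc ‖(block a G G)⁻¹ʳ ∘L block a G C‖ ≤ α⁻¹ * R := by
          grw [ContinuousLinearMap.opNorm_comp_le, hblock, hinv]
      _ ≤ _ := mul_comm R α⁻¹ ▸ le_max_right _ _

theorem metrizableSpace_of_injective_components [TopologicalSpace.SeparableSpace G]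
    [TopologicalSpace.SeparableSpace C] [CompleteSpace G] [CompleteSpace C] {X : Type*}
    [TopologicalSpace X] [CompactSpace X] {Φ : X → Components G C} (hΦ : Continuous Φ)
    (hinj : Function.Injective Φ) : TopologicalSpace.MetrizableSpace X := by
  obtain ⟨g, hg⟩ := TopologicalSpace.exists_dense_seq G
  obtain ⟨c, hc⟩ := TopologicalSpace.exists_dense_seq C
  let coeff : Components G C → _ := Prod.map (matrixCoeff (𝕜 := ℂ) g g) <|
    Prod.map (matrixCoeff (𝕜 := ℂ) g c) <|
      Prod.map (matrixCoeff (𝕜 := ℂ) c g) (matrixCoeff (𝕜 := ℂ) c c)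
  have hcont : Continuous coeff := (continuous_matrixCoeff g g).prodMap <|
    (continuous_matrixCoeff g c).prodMap <|
      (continuous_matrixCoeff c g).prodMap (continuous_matrixCoeff c c)
  have hcoeff : Function.Injective coeff := (injective_matrixCoeff hg hg).prodMap <|
    (injective_matrixCoeff hg hc).prodMap <|
      (injective_matrixCoeff hc hg).prodMap (injective_matrixCoeff hc hc)
  exact ((hcont.comp hΦ).isClosedEmbedding (hcoeff.comp hinj)).isEmbedding.metrizableSpace

/-- `A` parametrises the admissible operators by a space that carries the topology of nonlocal
`H`-convergence. -/
theorem isCompact_closure_and_metrizableSpace [TopologicalSpace.SeparableSpace G]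
    [TopologicalSpace.SeparableSpace C] [CompleteSpace G] [CompleteSpace C] (hα : 0 < α)
    (hβ : 0 < β) (hC : C = Gᗮ) {X : Type*} [TopologicalSpace X] {A : X → H →L[ℂ] H}
    (hA : Function.Injective A) (hrange : Set.range A = admissibleFor α β G C)
    (hind : IsInducing (components G C ∘ A)) {B : Set (H →L[ℂ] H)}
    (hB : Bornology.IsBounded B) :
    IsCompact (closure (A ⁻¹' B)) ∧ TopologicalSpace.MetrizableSpace (closure (A ⁻¹' B)) := by
  have hmem (x : X) : A x ∈ admissibleFor α β G C := hrange ▸ Set.mem_range_self x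
  have hinj : Function.Injective (components G C ∘ A) := fun x y h =>
    hA (injOn_components hα hC (hmem x) (hmem y) h)
  have hclosed : IsClosed (Set.range (components G C ∘ A)) := by
    rw [Set.range_comp, hrange, image_components_admissibleFor hα hβ hC]
    exact isClosed_sectorialComponents hα hβ
  obtain ⟨r, hr⟩ := exists_mapsTo_componentBox hα hβ hC hB
  have hbox : closure (A ⁻¹' B) ⊆ components G C ∘ A ⁻¹' componentBox G C r :=
    closure_minimal (fun x hx => hr ⟨hx, hmem x⟩)
      ((isCompact_componentBox r).isClosed.preimage hind.continuous)
  have hcompact : IsCompact (closure (A ⁻¹' B)) :=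
    (hind.isCompact_preimage hclosed (isCompact_componentBox r)).of_isClosed_subset
      isClosed_closure hbox
  have := isCompact_iff_compactSpace.1 hcompact
  exact ⟨hcompact, metrizableSpace_of_injective_components
    (hind.continuous.comp continuous_subtype_val) (hinj.comp Subtype.val_injective)⟩

theorem isInducing_components (α β : ℝ) (Ω : Set R3) :
    IsInducing (components (gZero Ω) (cRange Ω) ∘ Coeff.toCLM (α := α) (β := β)) := by
  refine ⟨?_⟩
  simp only [instTopologicalSpaceProd, induced_inf, induced_compose, ← inf_assoc]
  rfl

end NonlocalHCompactness

/-! ### Closed linear relations -/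

section ClosedGraph

variable {𝕜 : Type*} [RCLike 𝕜]

section Normed

variable {E F : Type*} [NormedAddCommGroup E] [NormedSpace 𝕜 E]
  [NormedAddCommGroup F] [NormedSpace 𝕜 F]

theorem isClosed_map_snd_of_norm_fst_le [CompleteSpace E] [CompleteSpace F]
    {Γ : Submodule 𝕜 (E × F)} (hΓ : IsClosed (Γ : Set (E × F))) {C : NNReal}
    (h : ∀ p ∈ Γ, ‖p.1‖ ≤ C * ‖p.2‖) :
    IsClosed (Γ.map (LinearMap.snd 𝕜 E F) : Set F) := by
  have : CompleteSpace Γ := hΓ.completeSpace_coe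
  let f : Γ →L[𝕜] F := ContinuousLinearMap.snd 𝕜 E F ∘L Γ.subtypeL
  have hf : AntilipschitzWith (max C 1) f := by
    refine f.antilipschitz_of_bound fun p => ?_
    rw [NNReal.coe_max, max_mul_of_nonneg _ _ (norm_nonneg _), NNReal.coe_one, one_mul]
    exact max_le_max_right _ (h p p.2)
  have hrange : (Γ.map (LinearMap.snd 𝕜 E F) : Set F) = Set.range f := by
    rw [Submodule.map_coe, Set.image_eq_range]
    rfl
  exact hrange ▸ hf.isClosed_range f.uniformContinuous

theorem exists_tendsto_subseq_of_tendsto_infDist {V : Submodule 𝕜 E} [FiniteDimensional 𝕜 V]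
    {x : ℕ → E} {r : ℝ} (hx : ∀ n, ‖x n‖ ≤ r)
    (hV : Filter.Tendsto (fun n => Metric.infDist (x n) V) Filter.atTop (𝓝 0)) :
    ∃ v : E, ∃ s : ℕ → ℕ, StrictMono s ∧ Filter.Tendsto (x ∘ s) Filter.atTop (𝓝 v) := by
  have hclose : ∀ n : ℕ, ∃ v : V, dist (x n) v < Metric.infDist (x n) V + 1 / (n + 1) := fun n => by
    obtain ⟨v, hv, hlt⟩ := (Metric.infDist_lt_iff V.nonempty).1
      (lt_add_of_pos_right (Metric.infDist (x n) V) (Nat.one_div_pos_of_nat (n := n)))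
    exact ⟨⟨v, hv⟩, hlt⟩
  choose v hv using hclose
  have hsub : Filter.Tendsto (fun n => x n - v n) Filter.atTop (𝓝 0) := by
    refine squeeze_zero_norm (fun n => ?_)
      (add_zero (0 : ℝ) ▸ hV.add (tendsto_one_div_add_atTop_nhds_zero_nat (𝕜 := ℝ)))
    rw [← dist_eq_norm]
    exact (hv n).le
  obtain ⟨R, hR⟩ := hsub.norm.bddAbove_range
  have hvR : ∀ n, v n ∈ Metric.closedBall (0 : V) (r + R) := fun n => by
    rw [mem_closedBall_zero_iff, ← Submodule.norm_coe, ← sub_sub_cancel (x n) (v n : E)]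
    exact (norm_sub_le _ _).trans (add_le_add (hx n) (hR ⟨n, rfl⟩))
  have : ProperSpace V := FiniteDimensional.proper 𝕜 V
  obtain ⟨w, -, s, hs, hw⟩ := (isCompact_closedBall (0 : V) (r + R)).tendsto_subseq hvR
  have hlim := (hsub.comp hs.tendsto_atTop).add ((continuous_subtype_val.tendsto w).comp hw)
  rw [zero_add] at hlim
  exact ⟨w, s, hs, hlim.congr fun n => sub_add_cancel _ _⟩

theorem exists_norm_fst_eq_one_of_forall_exists_lt {Γ : Submodule 𝕜 (E × F)}
    (h : ∀ C : NNReal, ∃ p ∈ Γ, C * ‖p.2‖ < ‖p.1‖) :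
    ∃ p : ℕ → E × F, (∀ n, p n ∈ Γ) ∧ (∀ n, ‖(p n).1‖ = 1) ∧
      Filter.Tendsto (fun n => (p n).2) Filter.atTop (𝓝 0) := by
  have hnormalized : ∀ n : ℕ, ∃ p ∈ Γ, ‖p.1‖ = 1 ∧ ‖p.2‖ ≤ 1 / ((n : ℝ) + 1) := fun n => by
    obtain ⟨p, hp, hlt⟩ := h (n + 1)
    have hpos : 0 < ‖p.1‖ := lt_of_le_of_lt (by positivity) hlt
    have hinv : ‖((‖p.1‖⁻¹ : ℝ) : 𝕜)‖ = ‖p.1‖⁻¹ := by simp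
    refine ⟨((‖p.1‖⁻¹ : ℝ) : 𝕜) • p, Γ.smul_mem _ hp, ?_, ?_⟩
    · rw [Prod.smul_fst, norm_smul, hinv, inv_mul_cancel₀ hpos.ne']
    · rw [Prod.smul_snd, norm_smul, hinv, inv_mul_eq_div, div_le_div_iff₀ hpos (by positivity),
        one_mul, mul_comm]
      exact_mod_cast hlt.le
  choose p hp hnorm hle using hnormalized
  exact ⟨p, hp, hnorm, squeeze_zero_norm hle tendsto_one_div_add_atTop_nhds_zero_nat⟩

theorem exists_norm_fst_le_of_infDist_fst_le {Γ : Submodule 𝕜 (E × F)}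
    (hΓ : IsClosed (Γ : Set (E × F))) (hinj : ∀ x, (x, (0 : F)) ∈ Γ → x = 0)
    {V : Submodule 𝕜 E} [FiniteDimensional 𝕜 V] {C : ℝ}
    (h : ∀ p ∈ Γ, Metric.infDist p.1 V ≤ C * ‖p.2‖) :
    ∃ C' : NNReal, ∀ p ∈ Γ, ‖p.1‖ ≤ C' * ‖p.2‖ := by
  by_contra! hcon
  obtain ⟨p, hp, hnorm, hlim⟩ := exists_norm_fst_eq_one_of_forall_exists_lt hcon
  have hdist : Filter.Tendsto (fun n => Metric.infDist (p n).1 V) Filter.atTop (𝓝 0) :=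
    squeeze_zero (fun _ => Metric.infDist_nonneg) (fun n => h _ (hp n))
      (by simpa using hlim.norm.const_mul C)
  obtain ⟨v, s, hs, hv⟩ := exists_tendsto_subseq_of_tendsto_infDist (fun n => (hnorm n).le) hdist
  have hmem : (v, (0 : F)) ∈ Γ :=
    hΓ.mem_of_tendsto (hv.prodMk_nhds (hlim.comp hs.tendsto_atTop))
      (Filter.Eventually.of_forall fun n => hp _)
  have hone : ‖v‖ = 1 := tendsto_nhds_unique hv.norm (by simp [hnorm])
  simp [hinj v hmem] at hone

theorem exists_strongDual_apply_eq {M : Type*} [AddCommGroup M] [Module 𝕜 M] (S : M →ₗ[𝕜] F)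
    (ℓ : M →ₗ[𝕜] 𝕜) {C : ℝ} (h : ∀ m, ‖ℓ m‖ ≤ C * ‖S m‖) :
    ∃ L : StrongDual 𝕜 F, ∀ m, L (S m) = ℓ m := by
  have hker : S.ker ≤ ℓ.ker := fun m hm => norm_le_zero_iff.1 <| by
    simpa [LinearMap.mem_ker.1 hm] using h m
  let ℓ' : S.range →ₗ[𝕜] 𝕜 := S.ker.liftQ ℓ hker ∘ₗ S.quotKerEquivRange.symm.toLinearMap
  have hℓ' : ∀ m, ℓ' (S.rangeRestrict m) = ℓ m := fun m => by
    change S.ker.liftQ ℓ hker (S.quotKerEquivRange.symm ⟨S m, _⟩) = ℓ m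
    rw [LinearMap.quotKerEquivRange_symm_apply_image, Submodule.mkQ_apply, Submodule.liftQ_apply]
  obtain ⟨L, hL, -⟩ := exists_extension_norm_eq S.range <| ℓ'.mkContinuous C fun y => by
    obtain ⟨m, rfl⟩ := S.surjective_rangeRestrict y
    rw [hℓ']
    exact h m
  exact ⟨L, fun m => (hL (S.rangeRestrict m)).trans (hℓ' m)⟩

end Normed

section InnerProduct

variable {H H' : Type*} [NormedAddCommGroup H] [InnerProductSpace 𝕜 H]
  [NormedAddCommGroup H'] [InnerProductSpace 𝕜 H']

theorem exists_forall_inner_snd_eq_inner_fst [CompleteSpace H'] {Γ : Submodule 𝕜 (H × H')} {C : ℝ}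
    (h : ∀ p ∈ Γ, ‖p.1‖ ≤ C * ‖p.2‖) (w : H) :
    ∃ z : H', ∀ p ∈ Γ, inner 𝕜 p.2 z = inner 𝕜 p.1 w := by
  obtain ⟨L, hL⟩ := exists_strongDual_apply_eq (LinearMap.snd 𝕜 H H' ∘ₗ Γ.subtype)
    ((innerSL 𝕜 w).toLinearMap ∘ₗ LinearMap.fst 𝕜 H H' ∘ₗ Γ.subtype) (C := ‖w‖ * C) fun p => by
      grw [mul_assoc, LinearMap.comp_apply, LinearMap.comp_apply]
      exact (norm_inner_le_norm _ _).trans (by gcongr; exact h p p.2)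
  refine ⟨(InnerProductSpace.toDual 𝕜 H').symm L, fun p hp => ?_⟩
  have hp' : inner 𝕜 ((InnerProductSpace.toDual 𝕜 H').symm L) p.2 = inner 𝕜 w p.1 := by
    rw [InnerProductSpace.toDual_symm_apply]
    exact hL ⟨p, hp⟩
  rw [← inner_conj_symm, hp', inner_conj_symm]

theorem infDist_map_starProjection_le {K V : Submodule 𝕜 H} [K.HasOrthogonalProjection] {w : H}
    (hw : w ∈ Kᗮ) :
    Metric.infDist w (V.map Kᗮ.starProjection.toLinearMap) ≤
      Metric.infDist w (K ⊔ V : Submodule 𝕜 H) := by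
  refine (Metric.le_infDist (K ⊔ V).nonempty).2 fun y hy => ?_
  obtain ⟨k, hk, v, hv, rfl⟩ := Submodule.mem_sup.1 hy
  have hPk : Kᗮ.starProjection k = 0 :=
    (Submodule.starProjection_apply_eq_zero_iff _).2 (Submodule.le_orthogonal_orthogonal _ hk)
  have hPw : Kᗮ.starProjection w = w := Submodule.starProjection_eq_self_iff.2 hw
  calc Metric.infDist w (V.map Kᗮ.starProjection.toLinearMap)
      ≤ ‖w - Kᗮ.starProjection v‖ :=
        (Metric.infDist_le_dist_of_mem (Submodule.mem_map_of_mem hv)).trans_eq (dist_eq_norm _ _)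
    _ = ‖Kᗮ.starProjection (w - (k + v))‖ := by
        rw [map_sub, map_add, hPk, hPw, zero_add]
    _ ≤ dist w (k + v) := by
        rw [dist_eq_norm]
        exact Kᗮ.norm_starProjection_apply_le _

theorem exists_forall_inner_snd_eq_of_infDist_le [CompleteSpace H'] {Γ : Submodule 𝕜 (H × H')}
    (hΓ : IsClosed (Γ : Set (H × H'))) {K : Submodule 𝕜 H} [K.HasOrthogonalProjection]
    (hK : ∀ g ∈ K, (g, (0 : H')) ∈ Γ) (hinj : ∀ x ∈ Kᗮ, (x, (0 : H')) ∈ Γ → x = 0)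
    {V : Submodule 𝕜 H} [FiniteDimensional 𝕜 V] {C : ℝ}
    (h : ∀ p ∈ Γ, Metric.infDist p.1 (K ⊔ V : Submodule 𝕜 H) ≤ C * ‖p.2‖) {w : H} (hw : w ∈ Kᗮ) :
    ∃ z : H', ∀ p ∈ Γ, inner 𝕜 p.2 z = inner 𝕜 p.1 w := by
  obtain ⟨C', hC'⟩ := exists_norm_fst_le_of_infDist_fst_le
    (Γ := Γ ⊓ Kᗮ.comap (LinearMap.fst 𝕜 H H')) (V := V.map Kᗮ.starProjection.toLinearMap)
    (hΓ.inter (K.isClosed_orthogonal.preimage continuous_fst))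
    (fun x hx => hinj x hx.2 hx.1)
    (fun p hp => (infDist_map_starProjection_le hp.2).trans (h p hp.1))
  obtain ⟨z, hz⟩ := exists_forall_inner_snd_eq_inner_fst hC' w
  refine ⟨z, fun p hp => ?_⟩
  have hproj : (Kᗮ.starProjection p.1, p.2) ∈ Γ := by
    have hsub := Γ.sub_mem hp (hK _ (K.starProjection_apply_mem p.1))
    rwa [Prod.sub_def, sub_zero, ← Submodule.starProjection_orthogonal_val] at hsub
  rw [hz _ ⟨hproj, Kᗮ.starProjection_apply_mem p.1⟩,
    Submodule.inner_starProjection_left_eq_right, Submodule.starProjection_eq_self_iff.2 hw]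

end InnerProduct

end ClosedGraph

/-! ### Calculus of test functions -/

section Calculus

variable {Ω : Set R3}

namespace IsTest

variable {F G : Type*} [NormedAddCommGroup F] [NormedSpace ℝ F]
  [NormedAddCommGroup G] [NormedSpace ℝ G]

theorem differentiable {φ : R3 → F} (h : IsTest Ω φ) : Differentiable ℝ φ :=
  h.1.differentiable (by simp)

theorem continuous {φ : R3 → F} (h : IsTest Ω φ) : Continuous φ := h.1.continuous

theorem memLp {φ : R3 → F} (h : IsTest Ω φ) (μ : Measure R3) [IsFiniteMeasureOnCompacts μ] :
    MemLp φ 2 μ :=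
  h.continuous.memLp_of_hasCompactSupport h.2.1

theorem eq_zero {φ : R3 → F} (h : IsTest Ω φ) {x : R3} (hx : x ∉ Ω) : φ x = 0 :=
  image_eq_zero_of_notMem_tsupport fun hx' => hx (h.2.2 hx')

theorem of_tsupport_subset {φ : R3 → F} {ψ : R3 → G} (h : IsTest Ω φ) (hψ : ContDiff ℝ ∞ ψ)
    (hs : tsupport ψ ⊆ tsupport φ) : IsTest Ω ψ :=
  ⟨hψ, h.2.1.of_isClosed_subset (isClosed_tsupport _) hs, hs.trans h.2.2⟩

theorem zero : IsTest Ω (0 : R3 → F) :=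
  ⟨contDiff_const, HasCompactSupport.zero, by simp [tsupport]⟩

theorem add {φ ψ : R3 → F} (h : IsTest Ω φ) (h' : IsTest Ω ψ) : IsTest Ω (φ + ψ) :=
  ⟨h.1.add h'.1, h.2.1.add h'.2.1, (tsupport_add φ ψ).trans (Set.union_subset h.2.2 h'.2.2)⟩

theorem sub {φ ψ : R3 → F} (h : IsTest Ω φ) (h' : IsTest Ω ψ) : IsTest Ω (φ - ψ) :=
  sub_eq_add_neg φ ψ ▸ h.add (h'.of_tsupport_subset h'.1.neg (closure_mono (by simp)))

theorem smul [NormedSpace ℂ F] [IsScalarTower ℝ ℂ F] {φ : R3 → F} (h : IsTest Ω φ) (c : ℂ) :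
    IsTest Ω (c • φ) :=
  h.of_tsupport_subset (h.1.const_smul c)
    (closure_mono (Function.support_const_smul_subset c φ))

end IsTest

theorem fderiv_apply_eq_sum_pderiv (f : R3 → ℂ) (x v : R3) :
    fderiv ℝ f x v = ∑ i, v i • pderiv i f x := by
  conv_lhs => rw [← (EuclideanSpace.basisFun (Fin 3) ℝ).sum_repr v]
  simp only [map_sum, map_smul, EuclideanSpace.basisFun_apply, EuclideanSpace.basisFun_repr, pderiv]

@[simp] theorem grad_apply (f : R3 → ℂ) (x : R3) (i : Fin 3) : grad f x i = pderiv i f x := by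
  fin_cases i <;> rfl

/-- The indices are read cyclically in `Fin 3`. -/
theorem curl_apply (ψ : R3 → C3) (x : R3) (i : Fin 3) :
    curl ψ x i =
      pderiv (i + 1) (fun y => ψ y (i + 2)) x - pderiv (i + 2) (fun y => ψ y (i + 1)) x := by
  fin_cases i <;> rfl

theorem norm_fderiv_le_norm_grad (f : R3 → ℂ) (x : R3) : ‖fderiv ℝ f x‖ ≤ ‖grad f x‖ := by
  refine ContinuousLinearMap.opNorm_le_bound _ (norm_nonneg _) fun v => ?_
  simp only [fderiv_apply_eq_sum_pderiv, EuclideanSpace.norm_eq, grad_apply]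
  refine (norm_sum_le _ _).trans ?_
  simp only [norm_smul]
  rw [mul_comm]
  exact Real.sum_mul_le_sqrt_mul_sqrt _ _ _

theorem norm_grad_le_two_mul_norm_fderiv (f : R3 → ℂ) (x : R3) :
    ‖grad f x‖ ≤ 2 * ‖fderiv ℝ f x‖ := by
  have h : ∀ i, ‖pderiv i f x‖ ^ 2 ≤ ‖fderiv ℝ f x‖ ^ 2 := fun i => by
    gcongr
    exact (ContinuousLinearMap.le_opNorm _ _).trans (by simp)
  simp only [EuclideanSpace.norm_eq, grad_apply, Fin.sum_univ_three]
  refine Real.sqrt_le_iff.2 ⟨by positivity, ?_⟩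
  linarith [h 0, h 1, h 2, sq_nonneg ‖fderiv ℝ f x‖]

theorem contDiff_pderiv {f : R3 → ℂ} (hf : ContDiff ℝ ∞ f) (i : Fin 3) :
    ContDiff ℝ ∞ (pderiv i f) :=
  (hf.fderiv_right (m := ∞) le_rfl).clm_apply contDiff_const

theorem tsupport_pderiv_subset (f : R3 → ℂ) (i : Fin 3) : tsupport (pderiv i f) ⊆ tsupport f :=
  (closure_mono (Function.support_subset_iff'.2 fun x hx => by
    rw [pderiv, Function.notMem_support.1 hx, zero_apply])).trans
    (tsupport_fderiv_subset ℝ (f := f))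

namespace IsTest

theorem pderiv {f : R3 → ℂ} (hf : IsTest Ω f) (i : Fin 3) : IsTest Ω (pderiv i f) :=
  hf.of_tsupport_subset (contDiff_pderiv hf.1 i) (tsupport_pderiv_subset f i)

theorem apply {ψ : R3 → C3} (h : IsTest Ω ψ) (i : Fin 3) : IsTest Ω fun x => ψ x i :=
  h.of_tsupport_subset ((contDiff_piLp 2).1 h.1 i)
    (closure_mono fun x hx h0 => hx (by simp [h0]))

theorem of_apply {ψ : R3 → C3} (h : ∀ i, IsTest Ω fun x => ψ x i) : IsTest Ω ψ := by
  have hs : tsupport ψ ⊆ ⋃ i, tsupport fun x => ψ x i := by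
    refine closure_minimal (fun x hx => ?_) (isClosed_iUnion_of_finite fun i => isClosed_tsupport _)
    obtain ⟨i, hi⟩ : ∃ i, ψ x i ≠ 0 := by
      by_contra! hc
      exact hx (PiLp.ext hc)
    exact Set.mem_iUnion.2 ⟨i, subset_tsupport _ hi⟩
  exact ⟨(contDiff_piLp 2).2 fun i => (h i).1,
    (isCompact_iUnion fun i => (h i).2.1).of_isClosed_subset (isClosed_tsupport _) hs,
    hs.trans (Set.iUnion_subset fun i => (h i).2.2)⟩

theorem grad {f : R3 → ℂ} (hf : IsTest Ω f) : IsTest Ω (grad f) :=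
  of_apply fun i => by simpa only [grad_apply] using hf.pderiv i

theorem curl {ψ : R3 → C3} (h : IsTest Ω ψ) : IsTest Ω (curl ψ) :=
  of_apply fun i => by
    simp only [curl_apply]
    exact ((h.apply _).pderiv _).sub ((h.apply _).pderiv _)

end IsTest

theorem pderiv_add {f g : R3 → ℂ} {x : R3} (hf : DifferentiableAt ℝ f x)
    (hg : DifferentiableAt ℝ g x) (i : Fin 3) :
    pderiv i (fun y => f y + g y) x = pderiv i f x + pderiv i g x := by
  simp [pderiv, fderiv_fun_add hf hg]

theorem pderiv_const_mul {f : R3 → ℂ} {x : R3} (hf : DifferentiableAt ℝ f x) (c : ℂ) (i : Fin 3) :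
    pderiv i (fun y => c * f y) x = c * pderiv i f x := by
  simp [pderiv, fderiv_const_mul hf]

theorem grad_add {f g : R3 → ℂ} (hf : Differentiable ℝ f) (hg : Differentiable ℝ g) :
    grad (f + g) = grad f + grad g := by
  ext x i
  simp only [Pi.add_apply, PiLp.add_apply, grad_apply]
  exact pderiv_add (hf x) (hg x) i

theorem grad_smul {f : R3 → ℂ} (hf : Differentiable ℝ f) (c : ℂ) :
    grad (c • f) = c • grad f := by
  ext x i
  simp only [Pi.smul_apply, PiLp.smul_apply, grad_apply]
  exact pderiv_const_mul (hf x) c i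

theorem curl_add {φ ψ : R3 → C3} (hφ : ∀ i, Differentiable ℝ fun x => φ x i)
    (hψ : ∀ i, Differentiable ℝ fun x => ψ x i) : curl (φ + ψ) = curl φ + curl ψ := by
  ext x i
  simp only [curl_apply, Pi.add_apply, PiLp.add_apply, pderiv_add (hφ _ x) (hψ _ x)]
  ring

theorem curl_smul {φ : R3 → C3} (hφ : ∀ i, Differentiable ℝ fun x => φ x i) (c : ℂ) :
    curl (c • φ) = c • curl φ := by
  ext x i
  simp only [curl_apply, Pi.smul_apply, PiLp.smul_apply, smul_eq_mul, pderiv_const_mul (hφ _ x)]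
  ring

theorem pderiv_comm {f : R3 → ℂ} (hf : ContDiff ℝ ∞ f) (i j : Fin 3) (x : R3) :
    pderiv i (pderiv j f) x = pderiv j (pderiv i f) x := by
  have hsymm : IsSymmSndFDerivAt ℝ f x := hf.contDiffAt.isSymmSndFDerivAt (by
    rw [minSmoothness_of_isRCLikeNormedField]
    exact WithTop.coe_le_coe.2 le_top)
  have hd : DifferentiableAt ℝ (fderiv ℝ f) x :=
    (hf.fderiv_right (m := ∞) le_rfl).differentiable (by simp) x
  have hsecond : ∀ i j, pderiv i (pderiv j f) x =
      fderiv ℝ (fderiv ℝ f) x (EuclideanSpace.single i 1) (EuclideanSpace.single j 1) := by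
    intro i j
    change fderiv ℝ (fun y => fderiv ℝ f y (EuclideanSpace.single j 1)) x _ = _
    simp [fderiv_clm_apply hd (differentiableAt_const _)]
  rw [hsecond, hsecond, hsymm.eq]

theorem curl_grad {f : R3 → ℂ} (hf : ContDiff ℝ ∞ f) : curl (grad f) = 0 := by
  ext x i
  simp only [curl_apply, grad_apply]
  exact sub_eq_zero.2 (pderiv_comm hf _ _ x)

theorem pderiv_conj (f : R3 → ℂ) (i : Fin 3) (x : R3) :
    pderiv i (fun y => (starRingEnd ℂ) (f y)) x = (starRingEnd ℂ) (pderiv i f x) :=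
  congr($(Complex.conjCLE.comp_fderiv (f := f) (x := x)) (EuclideanSpace.single i 1))

theorem IsTest.integrable_conj_mul {f g : R3 → ℂ} (hf : IsTest Ω f) (hg : IsTest Ω g) :
    Integrable fun x => (starRingEnd ℂ) (f x) * g x :=
  ((Complex.continuous_conj.comp hf.continuous).mul hg.continuous).integrable_of_hasCompactSupport
    hg.2.1.mul_left

theorem integral_pderiv_mul {f g : R3 → ℂ} (hf : IsTest Ω f) (hg : IsTest Ω g) (i : Fin 3) :
    ∫ x, (starRingEnd ℂ) (pderiv i f x) * g x = - ∫ x, (starRingEnd ℂ) (f x) * pderiv i g x := by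
  have hleft : Integrable fun x => pderiv i (fun y => (starRingEnd ℂ) (f y)) x * g x := by
    simpa only [pderiv_conj] using (hf.pderiv i).integrable_conj_mul hg
  have hparts := integral_mul_fderiv_eq_neg_fderiv_mul_of_integrable (μ := (volume : Measure R3))
    (f := fun x => (starRingEnd ℂ) (f x)) (g := g) (v := EuclideanSpace.single i 1) hleft
    (hf.integrable_conj_mul (hg.pderiv i)) (hf.integrable_conj_mul hg)
    (fun x _ => Complex.conjCLE.differentiable.comp hf.differentiable x)
    (fun x _ => hg.differentiable x)
  change _ = -∫ x, pderiv i (fun y => (starRingEnd ℂ) (f y)) x * g x at hparts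
  simp only [pderiv_conj] at hparts
  exact neg_eq_iff_eq_neg.1 hparts.symm

theorem integral_inner_curl {φ ψ : R3 → C3} (hφ : IsTest Ω φ) (hψ : IsTest Ω ψ) :
    ∫ x, inner ℂ (curl φ x) (ψ x) = ∫ x, inner ℂ (φ x) (curl ψ x) := by
  have hL : ∀ i j k, Integrable fun x =>
      (starRingEnd ℂ) (pderiv j (fun y => φ y i) x) * ψ x k := fun i j k =>
    ((hφ.apply i).pderiv j).integrable_conj_mul (hψ.apply k)
  have hR : ∀ i j k, Integrable fun x =>
      (starRingEnd ℂ) (φ x i) * pderiv j (fun y => ψ y k) x := fun i j k =>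
    (hφ.apply i).integrable_conj_mul ((hψ.apply k).pderiv j)
  have hleft : ∀ x, inner ℂ (curl φ x) (ψ x) =
      ∑ i, ((starRingEnd ℂ) (pderiv (i + 1) (fun y => φ y (i + 2)) x) * ψ x i -
        (starRingEnd ℂ) (pderiv (i + 2) (fun y => φ y (i + 1)) x) * ψ x i) := fun x => by
    simp only [PiLp.inner_apply, curl_apply, RCLike.inner_apply', map_sub, sub_mul]
  have hright : ∀ x, inner ℂ (φ x) (curl ψ x) =
      ∑ i, ((starRingEnd ℂ) (φ x i) * pderiv (i + 1) (fun y => ψ y (i + 2)) x -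
        (starRingEnd ℂ) (φ x i) * pderiv (i + 2) (fun y => ψ y (i + 1)) x) := fun x => by
    simp only [PiLp.inner_apply, curl_apply, RCLike.inner_apply', mul_sub]
  have hsum : ∀ {a b : Fin 3 → R3 → ℂ}, (∀ i, Integrable (a i)) → (∀ i, Integrable (b i)) →
      ∫ x, ∑ i, (a i x - b i x) = ∑ i, ((∫ x, a i x) - ∫ x, b i x) := fun ha hb =>
    (integral_finsetSum _ fun i _ => (ha i).sub (hb i)).trans
      (Finset.sum_congr rfl fun i _ => integral_sub (ha i) (hb i))
  simp only [hleft, hright]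
  rw [hsum (fun i => hL (i + 2) (i + 1) i) (fun i => hL (i + 1) (i + 2) i),
    hsum (fun i => hR i (i + 1) (i + 2)) (fun i => hR i (i + 2) (i + 1))]
  simp only [integral_pderiv_mul (hφ.apply _) (hψ.apply _), Fin.sum_univ_three]
  simp only [Fin.isValue, zero_add, Fin.reduceAdd]
  ring

end Calculus

/-! ### The Helmholtz decomposition from a curl estimate -/

section GraphTheory

variable {Ω : Set R3}

section MinGraph

variable {F G : Type*} [NormedAddCommGroup F] [InnerProductSpace ℂ F]
  [NormedAddCommGroup G] [InnerProductSpace ℂ G] {D : (R3 → F) → (R3 → G)}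

theorem span_testPairs_subset (hadd : ∀ φ ψ, IsTest Ω φ → IsTest Ω ψ → D (φ + ψ) = D φ + D ψ)
    (hsmul : ∀ (c : ℂ) φ, IsTest Ω φ → D (c • φ) = c • D φ) :
    (Submodule.span ℂ (testPairs Ω D) : Set _) ⊆ testPairs Ω D := by
  intro p hp
  induction hp using Submodule.span_induction with
  | mem _ hp => exact hp
  | zero =>
    have hD : D 0 = 0 := by simpa only [zero_smul] using hsmul 0 0 .zero
    exact ⟨0, .zero, Lp.coeFn_zero _ _ _, hD ▸ Lp.coeFn_zero _ _ _⟩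
  | add p q _ _ hp hq =>
    obtain ⟨φ, hφ, hp1, hp2⟩ := hp
    obtain ⟨ψ, hψ, hq1, hq2⟩ := hq
    exact ⟨φ + ψ, hφ.add hψ, (Lp.coeFn_add _ _).trans (hp1.add hq1),
      hadd φ ψ hφ hψ ▸ (Lp.coeFn_add _ _).trans (hp2.add hq2)⟩
  | smul c p _ hp =>
    obtain ⟨φ, hφ, hp1, hp2⟩ := hp
    exact ⟨c • φ, hφ.smul c, (Lp.coeFn_smul _ _).trans (hp1.const_smul c),
      hsmul c φ hφ ▸ (Lp.coeFn_smul _ _).trans (hp2.const_smul c)⟩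

theorem minGraph_induction (hadd : ∀ φ ψ, IsTest Ω φ → IsTest Ω ψ → D (φ + ψ) = D φ + D ψ)
    (hsmul : ∀ (c : ℂ) φ, IsTest Ω φ → D (c • φ) = c • D φ)
    {P : Lp F 2 (volume.restrict Ω) × Lp G 2 (volume.restrict Ω) → Prop}
    (hP : IsClosed {p | P p}) (h : ∀ p ∈ testPairs Ω D, P p) {p} (hp : p ∈ minGraph Ω D) : P p :=
  closure_minimal (fun q hq => h q (span_testPairs_subset hadd hsmul hq)) hP hp

theorem testPairs_subset_minGraph (D : (R3 → F) → (R3 → G)) :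
    testPairs Ω D ⊆ minGraph Ω D :=
  Submodule.subset_span.trans (Submodule.le_topologicalClosure _)

end MinGraph

theorem gradZeroGraph_induction {P : L2s Ω × L2v Ω → Prop} (hP : IsClosed {p | P p})
    (h : ∀ p ∈ testPairs Ω grad, P p) {p} (hp : p ∈ gradZeroGraph Ω) : P p :=
  minGraph_induction (fun _ _ hφ hψ => grad_add hφ.differentiable hψ.differentiable)
    (fun c _ hφ => grad_smul hφ.differentiable c) hP h hp

theorem curlZeroGraph_induction {P : L2v Ω × L2v Ω → Prop} (hP : IsClosed {p | P p})
    (h : ∀ p ∈ testPairs Ω curl, P p) {p} (hp : p ∈ curlZeroGraph Ω) : P p :=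
  minGraph_induction (fun _ _ hφ hψ => curl_add (fun i => (hφ.apply i).differentiable)
      fun i => (hψ.apply i).differentiable)
    (fun c _ hφ => curl_smul (fun i => (hφ.apply i).differentiable) c) hP h hp

theorem isClosed_gradZeroGraph : IsClosed (gradZeroGraph Ω : Set (L2s Ω × L2v Ω)) :=
  Submodule.isClosed_topologicalClosure _

theorem isClosed_curlZeroGraph : IsClosed (curlZeroGraph Ω : Set (L2v Ω × L2v Ω)) :=
  Submodule.isClosed_topologicalClosure _

theorem snd_mem_gZero {q : L2s Ω × L2v Ω} (hq : q ∈ testPairs Ω grad) : q.2 ∈ gZero Ω :=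
  ⟨q, testPairs_subset_minGraph _ hq, rfl⟩

theorem gZero_induction {P : L2v Ω → Prop} (hP : IsClosed {w | P w})
    (h : ∀ p ∈ testPairs Ω grad, P p.2) {w} (hw : w ∈ gZero Ω) : P w := by
  obtain ⟨p, hp, rfl⟩ := hw
  exact gradZeroGraph_induction (P := fun p => P p.2) (hP.preimage continuous_snd) h hp

theorem snd_zero_mem_testPairs_curl {q : L2s Ω × L2v Ω} (hq : q ∈ testPairs Ω grad) :
    (q.2, (0 : L2v Ω)) ∈ testPairs Ω curl := by
  obtain ⟨φ, hφ, -, hgrad⟩ := hq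
  exact ⟨grad φ, hφ.grad, hgrad, (curl_grad hφ.1).symm ▸ Lp.coeFn_zero _ _ _⟩

theorem prodMk_zero_mem_curlZeroGraph {w : L2v Ω} (hw : w ∈ gZero Ω) :
    (w, (0 : L2v Ω)) ∈ curlZeroGraph Ω :=
  gZero_induction (P := fun w => (w, (0 : L2v Ω)) ∈ curlZeroGraph Ω)
    (isClosed_curlZeroGraph.preimage (continuous_id.prodMk continuous_const))
    (fun _ hp => testPairs_subset_minGraph _ (snd_zero_mem_testPairs_curl hp)) hw

theorem cRange_le_orthogonal_gZero : cRange Ω ≤ (gZero Ω)ᗮ := by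
  rintro _ ⟨p, hp, rfl⟩
  refine (Submodule.mem_orthogonal _ _).2 fun w hw => ?_
  refine gZero_induction (P := fun w => inner ℂ w p.2 = 0)
    (isClosed_eq (continuous_id.inner continuous_const) continuous_const) (fun q hq => ?_) hw
  simpa only [inner_zero_left] using (hp _ (snd_zero_mem_testPairs_curl hq)).symm

theorem orthogonal_gZero_le_kerDive : (gZero Ω)ᗮ ≤ kerDive Ω := by
  rintro w hw q ⟨φ, hφ, hq1, hq2⟩
  have hneg : -q.2 =ᵐ[volume.restrict Ω] grad φ := by
    simpa only [neg_neg] using (Lp.coeFn_neg _).trans hq2.neg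
  have hgrad : -q.2 ∈ gZero Ω := snd_mem_gZero (q := (q.1, -q.2)) ⟨φ, hφ, hq1, hneg⟩
  simpa using (Submodule.mem_orthogonal _ _).1 hw _ hgrad

theorem inner_eq_of_mem_testPairs_curl {p q : L2v Ω × L2v Ω} (hp : p ∈ testPairs Ω curl)
    (hq : q ∈ testPairs Ω curl) : inner ℂ q.2 p.1 = inner ℂ q.1 p.2 := by
  obtain ⟨φ, hφ, hp1, hp2⟩ := hp
  obtain ⟨ψ, hψ, hq1, hq2⟩ := hq
  calc inner ℂ q.2 p.1 = ∫ x in Ω, inner ℂ (curl ψ x) (φ x) :=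
        integral_congr_ae (Filter.EventuallyEq.comp₂ hq2 (inner ℂ) hp1)
    _ = ∫ x, inner ℂ (curl ψ x) (φ x) :=
        setIntegral_eq_integral_of_forall_compl_eq_zero fun x hx => by
          rw [hφ.eq_zero hx, inner_zero_right]
    _ = ∫ x, inner ℂ (ψ x) (curl φ x) := integral_inner_curl hψ hφ
    _ = ∫ x in Ω, inner ℂ (ψ x) (curl φ x) :=
        (setIntegral_eq_integral_of_forall_compl_eq_zero fun x hx => by
          rw [hψ.eq_zero hx, inner_zero_left]).symm
    _ = inner ℂ q.1 p.2 := (integral_congr_ae (Filter.EventuallyEq.comp₂ hq1 (inner ℂ) hp2)).symm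

theorem curlZeroGraph_le_curlGraph : curlZeroGraph Ω ≤ curlGraph Ω := fun _ hp q hq =>
  curlZeroGraph_induction (P := fun p => inner ℂ q.2 p.1 = inner ℂ q.1 p.2)
    (isClosed_eq (continuous_const.inner continuous_fst) (continuous_const.inner continuous_snd))
    (fun _ hp => inner_eq_of_mem_testPairs_curl hp hq) hp

theorem mem_harmonicD {w : L2v Ω} (hw : w ∈ (gZero Ω)ᗮ)
    (hcurl : (w, (0 : L2v Ω)) ∈ curlZeroGraph Ω) : w ∈ harmonicD Ω :=
  ⟨⟨⟨_, hcurl, rfl⟩, orthogonal_gZero_le_kerDive hw⟩, curlZeroGraph_le_curlGraph hcurl⟩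

theorem exists_norm_fst_le_of_mem_testPairs_grad (hΩ : IsOpen Ω) (hb : Bornology.IsBounded Ω) :
    ∃ C : NNReal, ∀ p ∈ testPairs Ω grad, ‖p.1‖ ≤ C * ‖p.2‖ := by
  set C := eLpNormLESNormFDerivOfLeConst ℂ (volume : Measure R3) Ω 2 2
  refine ⟨C, ?_⟩
  rintro p ⟨φ, hφ, hp1, hp2⟩
  have hsupp : Function.support (grad φ) ⊆ Ω := fun x hx => by
    by_contra hx'
    exact hx (hφ.grad.eq_zero hx')
  have hle : eLpNorm p.1 2 (volume.restrict Ω) ≤ C * eLpNorm p.2 2 (volume.restrict Ω) :=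
    calc eLpNorm p.1 2 (volume.restrict Ω) = eLpNorm φ 2 (volume.restrict Ω) :=
          eLpNorm_congr_ae hp1
      _ ≤ eLpNorm φ 2 volume := eLpNorm_mono_measure _ Measure.restrict_le_self
      _ ≤ C * eLpNorm (fderiv ℝ φ) 2 volume :=
          eLpNorm_le_eLpNorm_fderiv (F := ℂ) volume (hφ.1.of_le (by exact_mod_cast le_top))
            ((subset_tsupport φ).trans hφ.2.2) (p := 2) (by norm_num)
            (by rw [finrank_euclideanSpace_fin]; norm_num) hb
      _ ≤ C * eLpNorm (grad φ) 2 volume := by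
          gcongr
          exact eLpNorm_mono (norm_fderiv_le_norm_grad φ)
      _ = C * eLpNorm p.2 2 (volume.restrict Ω) := by
          rw [eLpNorm_congr_ae hp2, ← eLpNorm_indicator_eq_eLpNorm_restrict hΩ.measurableSet,
            Set.indicator_eq_self.2 hsupp]
  have hreal :=
    ENNReal.toReal_mono (ENNReal.mul_ne_top ENNReal.coe_ne_top (Lp.eLpNorm_ne_top _)) hle
  rwa [ENNReal.toReal_mul, ENNReal.coe_toReal] at hreal

theorem isClosed_gZero (hΩ : IsOpen Ω) (hb : Bornology.IsBounded Ω) :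
    IsClosed (gZero Ω : Set (L2v Ω)) := by
  obtain ⟨C, hC⟩ := exists_norm_fst_le_of_mem_testPairs_grad hΩ hb
  exact isClosed_map_snd_of_norm_fst_le isClosed_gradZeroGraph fun p hp =>
    gradZeroGraph_induction (P := fun p => ‖p.1‖ ≤ C * ‖p.2‖)
      (isClosed_le (by fun_prop) (by fun_prop)) hC hp

/-- Modulo `g_0` and a finite-dimensional space, test fields are controlled in `L²` by their
curl. -/
def HasCurlEstimate (Ω : Set R3) : Prop :=
  ∃ (C : ℝ) (V : Submodule ℂ (L2v Ω)), FiniteDimensional ℂ V ∧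
    ∀ q ∈ testPairs Ω curl, Metric.infDist q.1 (gZero Ω ⊔ V : Submodule ℂ (L2v Ω)) ≤ C * ‖q.2‖

theorem infDist_fst_le_of_mem_curlZeroGraph {C : ℝ} {M : Submodule ℂ (L2v Ω)}
    (hM : ∀ q ∈ testPairs Ω curl, Metric.infDist q.1 M ≤ C * ‖q.2‖) {p : L2v Ω × L2v Ω}
    (hp : p ∈ curlZeroGraph Ω) : Metric.infDist p.1 M ≤ C * ‖p.2‖ := by
  have hclosed : IsClosed {p : L2v Ω × L2v Ω | Metric.infDist p.1 M ≤ C * ‖p.2‖} :=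
    isClosed_le ((Metric.continuous_infDist_pt _).comp continuous_fst)
      (continuous_const.mul continuous_snd.norm)
  exact curlZeroGraph_induction hclosed hM hp

theorem cRange_eq_orthogonal_gZero (hD : harmonicD Ω = ⊥) [(gZero Ω).HasOrthogonalProjection]
    (hest : HasCurlEstimate Ω) : cRange Ω = (gZero Ω)ᗮ := by
  refine le_antisymm cRange_le_orthogonal_gZero fun w hw => ?_
  obtain ⟨C, V, hV, hest⟩ := hest
  have hinj : ∀ x ∈ (gZero Ω)ᗮ, (x, (0 : L2v Ω)) ∈ curlZeroGraph Ω → x = 0 := fun x hx hcurl => by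
    have h := mem_harmonicD hx hcurl
    rwa [hD, Submodule.mem_bot] at h
  obtain ⟨z, hz⟩ := exists_forall_inner_snd_eq_of_infDist_le isClosed_curlZeroGraph
    (fun _ hg => prodMk_zero_mem_curlZeroGraph hg) hinj
    (fun p hp => infDist_fst_le_of_mem_curlZeroGraph hest hp) hw
  exact ⟨(z, w), fun q hq => hz q (testPairs_subset_minGraph _ hq), rfl⟩

end GraphTheory

/-! ### Bi-Lipschitz changes of variables and the Poincaré inequality -/

section Poincare

section ChangeOfVariables

variable {E : Type*} [NormedAddCommGroup E] [NormedSpace ℝ E] [FiniteDimensional ℝ E]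
  [MeasurableSpace E] [BorelSpace E] {μ : Measure E} [μ.IsAddHaarMeasure]

theorem addHaar_image_le_of_lipschitzOnWith {g : E → E} {S : Set E} {K : NNReal}
    (hg : LipschitzOnWith K g S) : μ (g '' S) ≤ (K : ENNReal) ^ Module.finrank ℝ E * μ S := by
  have hμ : μ = μ.addHaarScalarFactor μH[Module.finrank ℝ E] • μH[Module.finrank ℝ E] :=
    Measure.isAddLeftInvariant_eq_smul _ _
  have himage := hg.hausdorffMeasure_image_le (d := (Module.finrank ℝ E : ℝ)) (by positivity)
  rw [ENNReal.rpow_natCast] at himage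
  rw [hμ, Measure.smul_apply, Measure.smul_apply, ENNReal.smul_def, ENNReal.smul_def, smul_eq_mul,
    smul_eq_mul, mul_left_comm]
  gcongr

theorem addHaar_le_addHaar_image_of_dist_le {ψ : E → E} {S : Set E} {K : NNReal}
    (hK : ∀ x ∈ S, ∀ y ∈ S, dist x y ≤ K * dist (ψ x) (ψ y)) :
    μ S ≤ (K : ENNReal) ^ Module.finrank ℝ E * μ (ψ '' S) := by
  have hinj : Set.InjOn ψ S := fun x hx y hy hxy =>
    dist_le_zero.1 ((hK x hx y hy).trans_eq (by rw [hxy, dist_self, mul_zero]))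
  have hinv := hinj.leftInvOn_invFunOn
  have hlip : LipschitzOnWith K (Function.invFunOn ψ S) (ψ '' S) := by
    refine LipschitzOnWith.of_dist_le_mul ?_
    rintro _ ⟨x, hx, rfl⟩ _ ⟨y, hy, rfl⟩
    rw [hinv hx, hinv hy]
    exact hK x hx y hy
  calc μ S = μ (Function.invFunOn ψ S '' (ψ '' S)) := by rw [hinv.image_image]
    _ ≤ (K : ENNReal) ^ Module.finrank ℝ E * μ (ψ '' S) :=
      addHaar_image_le_of_lipschitzOnWith hlip

theorem setLIntegral_comp_le_of_dist_le {A B : Set E} (hA : MeasurableSet A) {ψ : E → E}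
    (hψ : ContinuousOn ψ A) (hm : Set.MapsTo ψ A B) {K : NNReal}
    (hK : ∀ x ∈ A, ∀ y ∈ A, dist x y ≤ K * dist (ψ x) (ψ y)) {h : E → ENNReal}
    (hh : Measurable h) :
    ∫⁻ x in A, h (ψ x) ∂μ ≤ (K : ENNReal) ^ Module.finrank ℝ E * ∫⁻ y in B, h y ∂μ := by
  have hae : AEMeasurable ψ (μ.restrict A) := hψ.aemeasurable hA
  rw [← lintegral_map' hh.aemeasurable hae, ← smul_eq_mul, ← lintegral_smul_measure]
  refine lintegral_mono' (Measure.le_iff.2 fun S hS => ?_) le_rfl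
  rw [Measure.map_apply_of_aemeasurable hae hS, Measure.restrict_apply' hA, Measure.smul_apply,
    Measure.restrict_apply hS, smul_eq_mul]
  calc μ (ψ ⁻¹' S ∩ A)
      ≤ (K : ENNReal) ^ Module.finrank ℝ E * μ (ψ '' (ψ ⁻¹' S ∩ A)) :=
        addHaar_le_addHaar_image_of_dist_le fun x hx y hy => hK x hx.2 y hy.2
    _ ≤ (K : ENNReal) ^ Module.finrank ℝ E * μ (S ∩ B) := by
        gcongr
        rintro _ ⟨x, hx, rfl⟩
        exact ⟨hx.1, hm hx.2⟩

end ChangeOfVariables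

theorem sq_lintegral_le {X : Type*} [MeasurableSpace X] {μ : Measure X} [IsProbabilityMeasure μ]
    {f : X → ENNReal} (hf : AEMeasurable f μ) : (∫⁻ x, f x ∂μ) ^ 2 ≤ ∫⁻ x, f x ^ 2 ∂μ := by
  have h := ENNReal.lintegral_mul_le_Lp_mul_Lq μ Real.HolderConjugate.two_two hf
    (aemeasurable_const (b := (1 : ENNReal)))
  simp only [Pi.mul_apply, mul_one, ENNReal.one_rpow, lintegral_const, measure_univ] at h
  calc (∫⁻ x, f x ∂μ) ^ 2 ≤ ((∫⁻ x, f x ^ (2 : ℝ) ∂μ) ^ (1 / 2 : ℝ)) ^ 2 := by gcongr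
    _ = ∫⁻ x, f x ^ 2 ∂μ := by
      rw [← ENNReal.rpow_natCast, ← ENNReal.rpow_mul]
      norm_num

theorem isProbabilityMeasure_unitInterval :
    IsProbabilityMeasure (volume.restrict (Set.Icc (0 : ℝ) 1)) :=
  ⟨by simp⟩

section LipschitzPath

variable {E F : Type*} [NormedAddCommGroup E] [NormedSpace ℝ E] [NormedAddCommGroup F]
  [NormedSpace ℝ F] {p : E → F} {γ : ℝ → E} {M : NNReal}

theorem eventually_norm_comp_sub_lt (hγ : LipschitzWith M γ) {s r : ℝ}
    (hp : DifferentiableAt ℝ p (γ s)) (hr : M * ‖fderiv ℝ p (γ s)‖ < r) :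
    ∀ᶠ t in 𝓝[>] s, ‖p (γ t) - p (γ s)‖ < r * (t - s) := by
  obtain ⟨ε, hεr, hε⟩ : ∃ ε, M * (‖fderiv ℝ p (γ s)‖ + ε) < r ∧ 0 < ε := by
    have hcont : Continuous fun ε : ℝ => M * (‖fderiv ℝ p (γ s)‖ + ε) := by fun_prop
    have hlim : ∀ᶠ ε in 𝓝[>] (0 : ℝ), M * (‖fderiv ℝ p (γ s)‖ + ε) < r :=
      nhdsWithin_le_nhds (hcont.continuousAt.eventually_lt_const (by simpa using hr))
    exact (hlim.and self_mem_nhdsWithin).exists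
  have hlittle := (hγ.continuous.tendsto s).eventually (hp.hasFDerivAt.isLittleO.def hε)
  filter_upwards [nhdsWithin_le_nhds hlittle, self_mem_nhdsWithin] with t ht hst
  have hst : 0 < t - s := sub_pos.2 hst
  have hdist : ‖γ t - γ s‖ ≤ M * (t - s) := by
    simpa only [dist_eq_norm, Real.norm_of_nonneg hst.le] using hγ.dist_le_mul t s
  calc ‖p (γ t) - p (γ s)‖
      ≤ ‖p (γ t) - p (γ s) - fderiv ℝ p (γ s) (γ t - γ s)‖ + ‖fderiv ℝ p (γ s) (γ t - γ s)‖ :=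
        norm_le_norm_sub_add _ _
    _ ≤ ε * ‖γ t - γ s‖ + ‖fderiv ℝ p (γ s)‖ * ‖γ t - γ s‖ :=
        add_le_add ht (ContinuousLinearMap.le_opNorm _ _)
    _ = (‖fderiv ℝ p (γ s)‖ + ε) * ‖γ t - γ s‖ := by ring
    _ ≤ (‖fderiv ℝ p (γ s)‖ + ε) * (M * (t - s)) := by gcongr
    _ = M * (‖fderiv ℝ p (γ s)‖ + ε) * (t - s) := by ring
    _ < r * (t - s) := by gcongr

theorem norm_comp_sub_le_integral (hp : ContDiff ℝ 1 p) (hγ : LipschitzWith M γ) {a b : ℝ}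
    (hab : a ≤ b) :
    ‖p (γ b) - p (γ a)‖ ≤ ∫ t in a..b, M * ‖fderiv ℝ p (γ t)‖ := by
  have hcont : Continuous fun t => M * ‖fderiv ℝ p (γ t)‖ :=
    continuous_const.mul ((hp.continuous_fderiv one_ne_zero).comp hγ.continuous).norm
  refine image_le_of_liminf_slope_right_le_deriv_boundary (f := fun t => ‖p (γ t) - p (γ a)‖)
    (((hp.continuous.comp hγ.continuous).sub continuous_const).norm).continuousOn (by simp)
    (intervalIntegral.continuous_primitive (fun _ _ => hcont.intervalIntegrable _ _)
      a).continuousOn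
    (fun t _ => (hcont.integral_hasStrictDerivAt a t).hasDerivAt.hasDerivWithinAt)
    (fun t _ r hr => Filter.Eventually.frequently ?_) (Set.right_mem_Icc.2 hab)
  filter_upwards [eventually_norm_comp_sub_lt hγ (hp.differentiable one_ne_zero _) hr,
    self_mem_nhdsWithin] with z hz hzt
  rw [slope_def_field, div_lt_iff₀ (sub_pos.2 hzt)]
  refine lt_of_le_of_lt ?_ hz
  simpa using norm_sub_norm_le (p (γ z) - p (γ a)) (p (γ t) - p (γ a))

theorem enorm_comp_sub_le_lintegral (hp : ContDiff ℝ 1 p) (hγ : LipschitzWith M γ) {a b : ℝ}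
    (hab : a ≤ b) :
    ‖p (γ b) - p (γ a)‖ₑ ≤ ∫⁻ t in Set.Icc a b, M * ‖fderiv ℝ p (γ t)‖ₑ := by
  have hcont : Continuous fun t => M * ‖fderiv ℝ p (γ t)‖ :=
    continuous_const.mul ((hp.continuous_fderiv one_ne_zero).comp hγ.continuous).norm
  calc ‖p (γ b) - p (γ a)‖ₑ
      ≤ ENNReal.ofReal (∫ t in Set.Icc a b, M * ‖fderiv ℝ p (γ t)‖) := by
        rw [← ofReal_norm, integral_Icc_eq_integral_Ioc,
          ← intervalIntegral.integral_of_le hab]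
        exact ENNReal.ofReal_le_ofReal (norm_comp_sub_le_integral hp hγ hab)
    _ = ∫⁻ t in Set.Icc a b, ENNReal.ofReal (M * ‖fderiv ℝ p (γ t)‖) :=
        ofReal_integral_eq_lintegral_ofReal hcont.continuousOn.integrableOn_Icc
          (Filter.Eventually.of_forall fun t => by positivity)
    _ = ∫⁻ t in Set.Icc a b, M * ‖fderiv ℝ p (γ t)‖ₑ := by
        simp only [ENNReal.ofReal_mul M.coe_nonneg, ofReal_norm, ENNReal.ofReal_coe_nnreal]

end LipschitzPath

/-- A bi-Lipschitz parametrisation `χ' : Q → W`, with inverse `χ`, of an open set `W` of finite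
volume by a convex set `Q` of diameter at most `d`. -/
structure IsConvexChart {E : Type*} [NormedAddCommGroup E] [NormedSpace ℝ E] [MeasureSpace E]
    (W Q : Set E) (χ χ' : E → E) (K L d : NNReal) : Prop where
  isOpen : IsOpen W
  nonempty : W.Nonempty
  volume_ne_top : volume W ≠ ⊤
  convex : Convex ℝ Q
  dist_le : ∀ a ∈ Q, ∀ b ∈ Q, dist a b ≤ d
  mapsTo : Set.MapsTo χ W Q
  mapsTo' : Set.MapsTo χ' Q W
  left_inv : ∀ x ∈ W, χ' (χ x) = x
  right_inv : ∀ a ∈ Q, χ (χ' a) = a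
  lip : LipschitzOnWith K χ W
  lip' : LipschitzOnWith L χ' Q

/-- The path from `x` to `y` which the chart `χ`, with inverse `χ'`, straightens to the segment
from `χ x` to `χ y`. -/
def curvedSegment {E : Type*} [AddCommGroup E] [Module ℝ E] (χ χ' : E → E) (x y : E) (t : ℝ) : E :=
  χ' ((1 - t) • χ x + t • χ y)

theorem curvedSegment_symm {E : Type*} [AddCommGroup E] [Module ℝ E] (χ χ' : E → E) (x y : E)
    (t : ℝ) : curvedSegment χ χ' x y t = curvedSegment χ χ' y x (1 - t) := by
  simp [curvedSegment, add_comm]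

namespace IsConvexChart

section Normed

variable {E : Type*} [NormedAddCommGroup E] [NormedSpace ℝ E] [MeasureSpace E] {W Q : Set E}
  {χ χ' : E → E} {K L d : NNReal} (h : IsConvexChart W Q χ χ' K L d) {x x' y : E} {t : ℝ}
include h

theorem comb_mem (hx : x ∈ W) (hy : y ∈ W) (ht : t ∈ Set.Icc (0 : ℝ) 1) :
    (1 - t) • χ x + t • χ y ∈ Q :=
  h.convex (h.mapsTo hx) (h.mapsTo hy) (sub_nonneg.2 ht.2) ht.1 (by ring)

theorem curvedSegment_zero (hx : x ∈ W) : curvedSegment χ χ' x y 0 = x := by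
  simp [curvedSegment, h.left_inv x hx]

theorem curvedSegment_one (hy : y ∈ W) : curvedSegment χ χ' x y 1 = y := by
  simp [curvedSegment, h.left_inv y hy]

theorem continuousOn_curvedSegment :
    ContinuousOn (fun z : (E × E) × ℝ => curvedSegment χ χ' z.1.1 z.1.2 z.2)
      ((W ×ˢ W) ×ˢ Set.Icc (0 : ℝ) 1) := by
  refine h.lip'.continuousOn.comp ?_ fun z hz => h.comb_mem hz.1.1 hz.1.2 hz.2
  have hfst : ContinuousOn (fun z : (E × E) × ℝ => χ z.1.1) ((W ×ˢ W) ×ˢ Set.Icc (0 : ℝ) 1) :=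
    h.lip.continuousOn.comp (by fun_prop) fun z hz => hz.1.1
  have hsnd : ContinuousOn (fun z : (E × E) × ℝ => χ z.1.2) ((W ×ˢ W) ×ˢ Set.Icc (0 : ℝ) 1) :=
    h.lip.continuousOn.comp (by fun_prop) fun z hz => hz.1.2
  exact ((continuousOn_const.sub continuousOn_snd).smul hfst).add (continuousOn_snd.smul hsnd)

theorem lipschitzOnWith_curvedSegment (hx : x ∈ W) (hy : y ∈ W) :
    LipschitzOnWith (L * d) (curvedSegment χ χ' x y) (Set.Icc 0 1) := by
  refine LipschitzOnWith.of_dist_le_mul fun s hs t ht => ?_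
  have hcomb : dist ((1 - s) • χ x + s • χ y) ((1 - t) • χ x + t • χ y) =
      dist s t * dist (χ x) (χ y) := by
    rw [dist_eq_norm, dist_eq_norm, dist_eq_norm, ← norm_neg (χ x - χ y), ← norm_smul]
    congr 1
    module
  calc dist (curvedSegment χ χ' x y s) (curvedSegment χ χ' x y t)
      ≤ L * dist ((1 - s) • χ x + s • χ y) ((1 - t) • χ x + t • χ y) :=
        h.lip'.dist_le_mul _ (h.comb_mem hx hy hs) _ (h.comb_mem hx hy ht)
    _ = L * (dist s t * dist (χ x) (χ y)) := by rw [hcomb]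
    _ ≤ L * (dist s t * d) := by
        gcongr
        exact h.dist_le _ (h.mapsTo hx) _ (h.mapsTo hy)
    _ = (L * d : NNReal) * dist s t := by push_cast; ring

theorem dist_le_curvedSegment (hy : y ∈ W) (ht : t ∈ Set.Icc (0 : ℝ) (1 / 2)) (hx : x ∈ W)
    (hx' : x' ∈ W) :
    dist x x' ≤ (2 * K * L : NNReal) * dist (curvedSegment χ χ' x y t)
      (curvedSegment χ χ' x' y t) := by
  have ht' : t ∈ Set.Icc (0 : ℝ) 1 := ⟨ht.1, ht.2.trans (by norm_num)⟩
  have hq := h.comb_mem hx hy ht'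
  have hq' := h.comb_mem hx' hy ht'
  have hcomb : (1 - t) * dist (χ x) (χ x') ≤
      K * dist (curvedSegment χ χ' x y t) (curvedSegment χ χ' x' y t) := by
    have hlip := h.lip.dist_le_mul _ (h.mapsTo' hq) _ (h.mapsTo' hq')
    rwa [h.right_inv _ hq, h.right_inv _ hq', dist_add_right, dist_smul₀,
      Real.norm_of_nonneg (sub_nonneg.2 ht'.2)] at hlip
  calc dist x x' = dist (χ' (χ x)) (χ' (χ x')) := by rw [h.left_inv x hx, h.left_inv x' hx']
    _ ≤ L * dist (χ x) (χ x') := h.lip'.dist_le_mul _ (h.mapsTo hx) _ (h.mapsTo hx')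
    _ ≤ L * (2 * ((1 - t) * dist (χ x) (χ x'))) := by
        rw [← mul_assoc 2]
        gcongr
        exact le_mul_of_one_le_left dist_nonneg (by linarith [ht.2])
    _ ≤ L * (2 * (K * dist (curvedSegment χ χ' x y t) (curvedSegment χ χ' x' y t))) := by gcongr
    _ = (2 * K * L : NNReal) * dist (curvedSegment χ χ' x y t) (curvedSegment χ χ' x' y t) := by
        push_cast; ring

theorem enorm_sub_sq_le {F : Type*} [NormedAddCommGroup F] [NormedSpace ℝ F] {p : E → F}
    (hp : ContDiff ℝ 1 p) (hx : x ∈ W) (hy : y ∈ W) :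
    ‖p x - p y‖ₑ ^ 2 ≤ ((L * d : NNReal) : ENNReal) ^ 2 *
      ∫⁻ t in Set.Icc (0 : ℝ) 1, ‖fderiv ℝ p (curvedSegment χ χ' x y t)‖ₑ ^ 2 := by
  have := isProbabilityMeasure_unitInterval
  let γ : ℝ → E := fun t => curvedSegment χ χ' x y (Set.projIcc (0 : ℝ) 1 zero_le_one t)
  have hγ : LipschitzWith (L * d) γ := by
    simpa [γ, Function.comp_def] using (h.lipschitzOnWith_curvedSegment hx hy).to_restrict.comp
      (LipschitzWith.projIcc zero_le_one)
  have hγt : ∀ t ∈ Set.Icc (0 : ℝ) 1, γ t = curvedSegment χ χ' x y t := fun t ht => by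
    simp only [γ, Set.projIcc_of_mem zero_le_one ht]
  have hm : Measurable fun t => ‖fderiv ℝ p (γ t)‖ₑ :=
    ((hp.continuous_fderiv one_ne_zero).comp hγ.continuous).enorm.measurable
  calc ‖p x - p y‖ₑ ^ 2 = ‖p (γ 1) - p (γ 0)‖ₑ ^ 2 := by
        rw [hγt 0 (by simp), hγt 1 (by simp), h.curvedSegment_zero hx, h.curvedSegment_one hy,
          ← enorm_neg, neg_sub]
    _ ≤ (∫⁻ t in Set.Icc (0 : ℝ) 1, ((L * d : NNReal) : ENNReal) * ‖fderiv ℝ p (γ t)‖ₑ) ^ 2 := by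
        gcongr
        exact enorm_comp_sub_le_lintegral hp hγ zero_le_one
    _ = ((L * d : NNReal) : ENNReal) ^ 2 *
          (∫⁻ t in Set.Icc (0 : ℝ) 1, ‖fderiv ℝ p (γ t)‖ₑ) ^ 2 := by
        rw [lintegral_const_mul _ hm, mul_pow]
    _ ≤ ((L * d : NNReal) : ENNReal) ^ 2 *
          ∫⁻ t in Set.Icc (0 : ℝ) 1, ‖fderiv ℝ p (γ t)‖ₑ ^ 2 := by
        gcongr
        exact sq_lintegral_le hm.aemeasurable
    _ = ((L * d : NNReal) : ENNReal) ^ 2 *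
          ∫⁻ t in Set.Icc (0 : ℝ) 1, ‖fderiv ℝ p (curvedSegment χ χ' x y t)‖ₑ ^ 2 := by
        congr 1
        exact setLIntegral_congr_fun measurableSet_Icc fun t ht => by simp only [hγt t ht]

end Normed

section HaarMeasure

variable {E : Type*} [NormedAddCommGroup E] [NormedSpace ℝ E] [FiniteDimensional ℝ E]
  [MeasureSpace E] [BorelSpace E] [(volume : Measure E).IsAddHaarMeasure] {W Q : Set E}
  {χ χ' : E → E} {K L d : NNReal} (h : IsConvexChart W Q χ χ' K L d) {t : ℝ}
include h

theorem aemeasurable_comp_curvedSegment {g : E → ENNReal} (hg : Measurable g)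
    (ht : t ∈ Set.Icc (0 : ℝ) 1) :
    AEMeasurable (fun z : E × E => g (curvedSegment χ χ' z.1 z.2 t))
      ((volume.restrict W).prod (volume.restrict W)) := by
  rw [Measure.prod_restrict]
  exact hg.comp_aemeasurable ((h.continuousOn_curvedSegment.comp (f := fun z => (z, t))
    (by fun_prop) fun z hz => ⟨hz, ht⟩).aemeasurable
      (h.isOpen.measurableSet.prod h.isOpen.measurableSet))

theorem aemeasurable_uncurry_comp_curvedSegment {g : E → ENNReal} (hg : Measurable g) :
    AEMeasurable (Function.uncurry fun (z : E × E) t => g (curvedSegment χ χ' z.1 z.2 t))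
      (((volume.restrict W).prod (volume.restrict W)).prod
        (volume.restrict (Set.Icc (0 : ℝ) 1))) := by
  rw [Measure.prod_restrict, Measure.prod_restrict]
  exact hg.comp_aemeasurable (h.continuousOn_curvedSegment.aemeasurable
    ((h.isOpen.measurableSet.prod h.isOpen.measurableSet).prod measurableSet_Icc))

theorem setLIntegral_curvedSegment_le {y : E} (hy : y ∈ W) (ht : t ∈ Set.Icc (0 : ℝ) (1 / 2))
    {g : E → ENNReal} (hg : Measurable g) :
    ∫⁻ x in W, g (curvedSegment χ χ' x y t) ≤
      ((2 * K * L : NNReal) : ENNReal) ^ Module.finrank ℝ E * ∫⁻ x in W, g x := by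
  have ht' : t ∈ Set.Icc (0 : ℝ) 1 := ⟨ht.1, ht.2.trans (by norm_num)⟩
  refine setLIntegral_comp_le_of_dist_le h.isOpen.measurableSet ?_
    (fun x hx => h.mapsTo' (h.comb_mem hx hy ht'))
    (fun x hx x' hx' => h.dist_le_curvedSegment hy ht hx hx') hg
  exact h.continuousOn_curvedSegment.comp (f := fun x => ((x, y), t)) (by fun_prop)
    fun x hx => ⟨⟨hx, hy⟩, ht'⟩

theorem lintegral_prod_curvedSegment_le (ht : t ∈ Set.Icc (0 : ℝ) 1) {g : E → ENNReal}
    (hg : Measurable g) :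
    ∫⁻ z, g (curvedSegment χ χ' z.1 z.2 t) ∂(volume.restrict W).prod (volume.restrict W) ≤
      ((2 * K * L : NNReal) : ENNReal) ^ Module.finrank ℝ E * (∫⁻ x in W, g x) * volume W := by
  have hm := h.aemeasurable_comp_curvedSegment hg ht
  -- The end point with the larger weight is integrated first: the path moves it expansively.
  rcases le_total t (1 / 2) with ht2 | ht2
  · rw [lintegral_prod_symm _ hm, ← setLIntegral_const]
    exact setLIntegral_mono measurable_const fun y hy =>
      h.setLIntegral_curvedSegment_le hy ⟨ht.1, ht2⟩ hg
  · rw [lintegral_prod _ hm, ← setLIntegral_const]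
    refine setLIntegral_mono measurable_const fun x hx => ?_
    simp only [curvedSegment_symm χ χ' x]
    exact h.setLIntegral_curvedSegment_le hx ⟨by linarith [ht.2], by linarith⟩ hg

variable {F : Type*} [NormedAddCommGroup F] [NormedSpace ℝ F] {p : E → F}

theorem lintegral_prod_enorm_sub_sq_le (hp : ContDiff ℝ 1 p) :
    ∫⁻ z, ‖p z.1 - p z.2‖ₑ ^ 2 ∂(volume.restrict W).prod (volume.restrict W) ≤
      ((L * d : NNReal) : ENNReal) ^ 2 *
        (((2 * K * L : NNReal) : ENNReal) ^ Module.finrank ℝ E *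
          (∫⁻ x in W, ‖fderiv ℝ p x‖ₑ ^ 2) * volume W) := by
  have hg : Measurable fun x => ‖fderiv ℝ p x‖ₑ ^ 2 :=
    (hp.continuous_fderiv one_ne_zero).enorm.measurable.pow_const 2
  have hWW := h.isOpen.measurableSet.prod h.isOpen.measurableSet
  calc ∫⁻ z, ‖p z.1 - p z.2‖ₑ ^ 2 ∂(volume.restrict W).prod (volume.restrict W)
      ≤ ∫⁻ z, ((L * d : NNReal) : ENNReal) ^ 2 *
          (∫⁻ t in Set.Icc (0 : ℝ) 1, ‖fderiv ℝ p (curvedSegment χ χ' z.1 z.2 t)‖ₑ ^ 2)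
            ∂(volume.restrict W).prod (volume.restrict W) := by
        rw [Measure.prod_restrict]
        exact setLIntegral_mono' hWW fun z hz => h.enorm_sub_sq_le hp hz.1 hz.2
    _ = ((L * d : NNReal) : ENNReal) ^ 2 *
          ∫⁻ t in Set.Icc (0 : ℝ) 1, ∫⁻ z, ‖fderiv ℝ p (curvedSegment χ χ' z.1 z.2 t)‖ₑ ^ 2
            ∂(volume.restrict W).prod (volume.restrict W) := by
        rw [lintegral_const_mul' _ _ (by finiteness),
          lintegral_lintegral_swap (h.aemeasurable_uncurry_comp_curvedSegment hg)]
    _ ≤ ((L * d : NNReal) : ENNReal) ^ 2 * ∫⁻ _ in Set.Icc (0 : ℝ) 1,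
          ((2 * K * L : NNReal) : ENNReal) ^ Module.finrank ℝ E *
            (∫⁻ x in W, ‖fderiv ℝ p x‖ₑ ^ 2) * volume W := by
        gcongr _ * ?_
        exact setLIntegral_mono measurable_const fun t ht =>
          h.lintegral_prod_curvedSegment_le ht hg
    _ = _ := by simp

theorem exists_lintegral_enorm_sub_const_sq_le :
    ∃ C : NNReal, ∀ p : E → F, ContDiff ℝ 1 p → ∃ c : F,
      ∫⁻ x in W, ‖p x - c‖ₑ ^ 2 ≤ C * ∫⁻ x in W, ‖fderiv ℝ p x‖ₑ ^ 2 := by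
  refine ⟨(L * d) ^ 2 * (2 * K * L) ^ Module.finrank ℝ E, fun p hp => ?_⟩
  have hcont : Continuous fun z : E × E => ‖p z.1 - p z.2‖ₑ ^ 2 := by
    have := hp.continuous
    fun_prop
  have hm : Measurable fun y => ∫⁻ x in W, ‖p x - p y‖ₑ ^ 2 :=
    Measurable.lintegral_prod_left' (f := fun z : E × E => ‖p z.1 - p z.2‖ₑ ^ 2) hcont.measurable
  obtain ⟨y, -, hy⟩ := exists_le_setLAverage
    (h.isOpen.measure_pos volume h.nonempty).ne' h.volume_ne_top hm.aemeasurable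
  refine ⟨p y, hy.trans ?_⟩
  rw [setLAverage_eq]
  refine ENNReal.div_le_of_le_mul ?_
  rw [← lintegral_prod_symm (fun z : E × E => ‖p z.1 - p z.2‖ₑ ^ 2) hcont.measurable.aemeasurable]
  refine (h.lintegral_prod_enorm_sub_sq_le hp).trans_eq ?_
  push_cast
  ring

end HaarMeasure

end IsConvexChart

end Poincare

/-! ### Gradients of Lipschitz functions that vanish outside `Ω` -/

section BoundedConvergence

variable {X E : Type*} [MeasurableSpace X] {μ : Measure X}
  [NormedAddCommGroup E] {p : ENNReal} [Fact (1 ≤ p)]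

theorem unifIntegrable_of_ae_norm_le {ι : Type*} (hp : p ≠ ⊤) {u : ι → X → E}
    (hu : ∀ i, AEStronglyMeasurable (u i) μ) {M : NNReal} (hM : ∀ i, ∀ᵐ x ∂μ, ‖u i x‖ ≤ M) :
    UnifIntegrable u p μ := by
  refine unifIntegrable_of Fact.out hp hu fun ε _ => ⟨M + 1, fun i => ?_⟩
  have hzero : {x | M + 1 ≤ ‖u i x‖₊}.indicator (u i) =ᵐ[μ] 0 := by
    filter_upwards [hM i] with x hx
    refine Set.indicator_of_notMem (fun hlt => ?_) _
    exact (lt_add_one M).not_ge (hlt.trans (by exact_mod_cast hx))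
  rw [eLpNorm_congr_ae hzero, eLpNorm_zero]
  positivity

theorem tendsto_Lp_of_ae_tendsto_of_ae_norm_le [IsFiniteMeasure μ] (hp : p ≠ ⊤)
    {u : ℕ → Lp E p μ} {w : Lp E p μ} {M : NNReal} (hM : ∀ n, ∀ᵐ x ∂μ, ‖u n x‖ ≤ M)
    (hlim : ∀ᵐ x ∂μ, Filter.Tendsto (fun n => u n x) Filter.atTop (𝓝 (w x))) :
    Filter.Tendsto u Filter.atTop (𝓝 w) :=
  (Lp.tendsto_Lp_iff_tendsto_eLpNorm' u w).2 (tendsto_Lp_finite_of_tendsto_ae Fact.out hp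
    (fun n => Lp.aestronglyMeasurable (u n)) (Lp.memLp w)
    (unifIntegrable_of_ae_norm_le hp (fun n => Lp.aestronglyMeasurable (u n)) hM) hlim)

end BoundedConvergence

section LipschitzGradient

variable {Ω : Set R3}

theorem grad_eq_toLp (f : R3 → ℂ) (x : R3) : grad f x = WithLp.toLp 2 fun i => pderiv i f x := by
  ext i
  simp

theorem measurable_grad (f : R3 → ℂ) : Measurable (grad f) := by
  rw [funext (grad_eq_toLp f)]
  exact (PiLp.continuous_toLp 2 _).measurable.comp
    (measurable_pi_lambda _ fun i => measurable_fderiv_apply_const ℝ f _)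

theorem tendsto_grad_of_tendsto_fderiv {ι : Type*} {l : Filter ι} {f : ι → R3 → ℂ} {g : R3 → ℂ}
    {x : R3} (h : Filter.Tendsto (fun n => fderiv ℝ (f n) x) l (𝓝 (fderiv ℝ g x))) :
    Filter.Tendsto (fun n => grad (f n) x) l (𝓝 (grad g x)) := by
  simp only [grad_eq_toLp]
  exact ((PiLp.continuous_toLp 2 _).tendsto _).comp (tendsto_pi_nhds.2 fun i =>
    ((ContinuousLinearMap.apply ℝ ℂ (EuclideanSpace.single i 1 : R3)).continuous.tendsto _).comp h)

theorem norm_grad_le_of_lipschitz {f : R3 → ℂ} {C : NNReal} (hf : LipschitzWith C f) (x : R3) :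
    ‖grad f x‖ ≤ 2 * C :=
  (norm_grad_le_two_mul_norm_fderiv f x).trans (by gcongr; exact norm_fderiv_le_of_lipschitz ℝ hf)

theorem isFiniteMeasure_restrict (hb : Bornology.IsBounded Ω) :
    IsFiniteMeasure (volume.restrict Ω : Measure R3) :=
  ⟨by simpa using hb.measure_lt_top⟩

theorem memLp_grad_of_lipschitz (hb : Bornology.IsBounded Ω) {f : R3 → ℂ} {C : NNReal}
    (hf : LipschitzWith C f) : MemLp (grad f) 2 (volume.restrict Ω) := by
  have := isFiniteMeasure_restrict hb
  exact MemLp.of_bound (measurable_grad f).aestronglyMeasurable (2 * C)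
    (Filter.Eventually.of_forall (norm_grad_le_of_lipschitz hf))

theorem mem_of_ae_tendsto_grad (hb : Bornology.IsBounded Ω) {V : Submodule ℂ (L2v Ω)}
    (hV : IsClosed (V : Set (L2v Ω))) {f : ℕ → R3 → ℂ} {C : NNReal}
    (hf : ∀ n, LipschitzWith C (f n))
    (hfV : ∀ n, ∀ v : L2v Ω, v =ᵐ[volume.restrict Ω] grad (f n) → v ∈ V) {g : R3 → ℂ}
    (hlim : ∀ᵐ x ∂volume.restrict Ω,
      Filter.Tendsto (fun n => grad (f n) x) Filter.atTop (𝓝 (grad g x)))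
    {w : L2v Ω} (hw : w =ᵐ[volume.restrict Ω] grad g) : w ∈ V := by
  have := isFiniteMeasure_restrict hb
  have hmem : ∀ n, MemLp (grad (f n)) 2 (volume.restrict Ω) := fun n =>
    memLp_grad_of_lipschitz hb (hf n)
  have hcoe : ∀ᵐ x ∂volume.restrict Ω, ∀ n, (hmem n).toLp _ x = grad (f n) x :=
    ae_all_iff.2 fun n => (hmem n).coeFn_toLp
  refine hV.mem_of_tendsto (tendsto_Lp_of_ae_tendsto_of_ae_norm_le (M := 2 * C) (by norm_num)
    (fun n => ?_) ?_) (Filter.Eventually.of_forall fun n => hfV n _ (hmem n).coeFn_toLp)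
  · filter_upwards [hcoe] with x hx
    rw [hx n]
    exact norm_grad_le_of_lipschitz (hf n) x
  · filter_upwards [hcoe, hw, hlim] with x hx hwx hlimx
    simpa only [hx, hwx] using hlimx

end LipschitzGradient

section Mollification

open scoped Convolution

section General

variable {E F : Type*} [NormedAddCommGroup E] [NormedSpace ℝ E] [HasContDiffBump E]
  [NormedAddCommGroup F] [NormedSpace ℝ F] [FiniteDimensional ℝ E]
  [MeasurableSpace E] [BorelSpace E] {μ : Measure E} [μ.IsAddHaarMeasure] (φ : ContDiffBump (0 : E))

theorem norm_convolution_bump_le {g : E → F} {M : ℝ} (hg : ∀ x, ‖g x‖ ≤ M) (x : E) :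
    ‖(φ.normed μ ⋆[ContinuousLinearMap.lsmul ℝ ℝ, μ] g) x‖ ≤ M := by
  have h := norm_integral_le_of_norm_le (μ := μ) (f := fun t => φ.normed μ t • g (x - t))
    (φ.integrable_normed.mul_const M) (Filter.Eventually.of_forall fun t => by
      rw [norm_smul, Real.norm_of_nonneg (φ.nonneg_normed t)]
      exact mul_le_mul_of_nonneg_left (hg _) (φ.nonneg_normed t))
  rwa [integral_mul_const, φ.integral_normed, one_mul] at h

theorem tsupport_convolution_bump_subset (g : E → F) :
    tsupport (φ.normed μ ⋆[ContinuousLinearMap.lsmul ℝ ℝ, μ] g) ⊆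
      Metric.cthickening φ.rOut (tsupport g) := by
  refine closure_minimal ((support_convolution_subset _).trans ?_) Metric.isClosed_cthickening
  rintro _ ⟨a, ha, b, hb, rfl⟩
  rw [φ.support_normed_eq] at ha
  refine Metric.mem_cthickening_of_dist_le _ b _ _ (subset_tsupport g hb) ?_
  simpa using (mem_ball_zero_iff.1 ha).le

variable [FiniteDimensional ℝ F] {f : E → F} {C : NNReal}

theorem hasFDerivAt_convolution_bump (hf : LipschitzWith C f) (x : E) :
    HasFDerivAt (φ.normed μ ⋆[ContinuousLinearMap.lsmul ℝ ℝ, μ] f)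
      ((φ.normed μ ⋆[ContinuousLinearMap.lsmul ℝ ℝ, μ] fderiv ℝ f) x) x := by
  have hcont : ∀ y, Continuous fun t => φ.normed μ t • f (y - t) := fun y =>
    φ.continuous_normed.smul (hf.continuous.comp (continuous_const.sub continuous_id))
  have hderiv : ∀ᵐ t ∂μ, DifferentiableAt ℝ f (x - t) :=
    (Measure.measurePreserving_sub_left μ x).quasiMeasurePreserving.ae hf.ae_differentiableAt
  refine (hasFDerivAt_integral_of_dominated_loc_of_lip
    (F := fun y t => φ.normed μ t • f (y - t)) (F' := fun t => φ.normed μ t • fderiv ℝ f (x - t))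
    (bound := fun t => φ.normed μ t * C) Filter.univ_mem
    (Filter.Eventually.of_forall fun y => (hcont y).aestronglyMeasurable)
    ((hcont x).integrable_of_hasCompactSupport φ.hasCompactSupport_normed.smul_right)
    (φ.continuous_normed.aestronglyMeasurable.smul
      ((measurable_fderiv ℝ f).comp (measurable_const.sub measurable_id)).aestronglyMeasurable)
    (Filter.Eventually.of_forall fun t => LipschitzOnWith.of_dist_le_mul fun y _ z _ => ?_)
    (φ.integrable_normed.mul_const _) ?_).2
  · rw [dist_smul₀, Real.norm_eq_abs, Real.coe_nnabs, abs_mul, NNReal.abs_eq, mul_assoc]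
    refine mul_le_mul_of_nonneg_left ?_ (abs_nonneg _)
    simpa using hf.dist_le_mul (y - t) (z - t)
  · filter_upwards [hderiv] with t ht
    exact ((ht.hasFDerivAt.comp x ((hasFDerivAt_id x).sub_const t)).congr_fderiv
      (ContinuousLinearMap.comp_id _)).const_smul (φ.normed μ t)

theorem lipschitzWith_convolution_bump (hf : LipschitzWith C f) :
    LipschitzWith C (φ.normed μ ⋆[ContinuousLinearMap.lsmul ℝ ℝ, μ] f) :=
  lipschitzWith_of_nnnorm_fderiv_le
    (fun x => (hasFDerivAt_convolution_bump φ hf x).differentiableAt) fun x => by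
      rw [(hasFDerivAt_convolution_bump φ hf x).fderiv]
      exact norm_convolution_bump_le φ (fun y => norm_fderiv_le_of_lipschitz ℝ hf) x

theorem ae_tendsto_fderiv_convolution_bump (hf : LipschitzWith C f) {φ : ℕ → ContDiffBump (0 : E)}
    (hφ : Filter.Tendsto (fun n => (φ n).rOut) Filter.atTop (𝓝 0)) {K : ℝ}
    (hK : ∀ n, (φ n).rOut ≤ K * (φ n).rIn) :
    ∀ᵐ x ∂μ, Filter.Tendsto
      (fun n => fderiv ℝ ((φ n).normed μ ⋆[ContinuousLinearMap.lsmul ℝ ℝ, μ] f) x)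
      Filter.atTop (𝓝 (fderiv ℝ f x)) := by
  have hloc : LocallyIntegrable (fderiv ℝ f) μ :=
    (memLp_top_of_bound (measurable_fderiv ℝ f).aestronglyMeasurable C
      (Filter.Eventually.of_forall fun x => norm_fderiv_le_of_lipschitz ℝ hf)).locallyIntegrable
        le_top
  filter_upwards [ContDiffBump.ae_convolution_tendsto_right_of_locallyIntegrable hφ
    (Filter.Eventually.of_forall hK) hloc] with x hx
  exact hx.congr fun n => (hasFDerivAt_convolution_bump (φ n) hf x).fderiv.symm

end General

variable {Ω : Set R3} {f : R3 → ℂ} {C : NNReal}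

theorem isTest_convolution_bump (hf : Continuous f) (hc : HasCompactSupport f)
    {φ : ContDiffBump (0 : R3)} (hφ : Metric.cthickening φ.rOut (tsupport f) ⊆ Ω) :
    IsTest Ω (φ.normed volume ⋆[ContinuousLinearMap.lsmul ℝ ℝ, volume] f) :=
  ⟨φ.hasCompactSupport_normed.contDiff_convolution_left _ φ.contDiff_normed hf.locallyIntegrable,
    φ.hasCompactSupport_normed.convolution _ hc,
    (tsupport_convolution_bump_subset φ f).trans hφ⟩

theorem mem_gZero_of_isTest (hf : IsTest Ω f) {w : L2v Ω}
    (hw : w =ᵐ[volume.restrict Ω] grad f) : w ∈ gZero Ω :=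
  snd_mem_gZero (q := ((hf.memLp _).toLp _, w)) ⟨f, hf, (hf.memLp _).coeFn_toLp, hw⟩

theorem mem_gZero_of_lipschitz_of_tsupport_subset (hΩ : IsOpen Ω) (hb : Bornology.IsBounded Ω)
    (hf : LipschitzWith C f) (hs : tsupport f ⊆ Ω) {w : L2v Ω}
    (hw : w =ᵐ[volume.restrict Ω] grad f) : w ∈ gZero Ω := by
  have hc : HasCompactSupport f :=
    Metric.isCompact_of_isClosed_isBounded (isClosed_tsupport _) (hb.subset hs)
  obtain ⟨δ, hδ, hδΩ⟩ := hc.isCompact.exists_cthickening_subset_open hΩ hs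
  let φ : ℕ → ContDiffBump (0 : R3) := fun n =>
    ⟨δ / 2 / (n + 1), δ / (n + 1), by positivity, by gcongr; linarith⟩
  have hφ : Filter.Tendsto (fun n => (φ n).rOut) Filter.atTop (𝓝 0) := by
    simpa [φ, div_eq_mul_inv] using
      (tendsto_one_div_add_atTop_nhds_zero_nat (𝕜 := ℝ)).const_mul δ
  have htest : ∀ n, IsTest Ω ((φ n).normed volume ⋆[ContinuousLinearMap.lsmul ℝ ℝ, volume] f) :=
    fun n => isTest_convolution_bump hf.continuous hc ((Metric.cthickening_mono
      (div_le_self hδ.le (by linarith [n.cast_nonneg (α := ℝ)])) _).trans hδΩ)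
  refine mem_of_ae_tendsto_grad hb (isClosed_gZero hΩ hb)
    (fun n => lipschitzWith_convolution_bump (μ := volume) (φ n) hf)
    (fun n v hv => mem_gZero_of_isTest (htest n) hv) ?_ hw
  filter_upwards [ae_restrict_of_ae (ae_tendsto_fderiv_convolution_bump (K := 2) hf hφ fun n =>
    le_of_eq (by simp only [φ]; ring))] with x hx
  exact tendsto_grad_of_tendsto_fderiv hx

end Mollification

section Cutoff

section Weight

variable {X : Type*} [PseudoMetricSpace X] {s : Set X} {N : ℝ} {x : X}

/-- The Lipschitz function of the distance to `s` which vanishes at distances up to `1 / N` and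
equals `1` at distances from `2 / N` on. -/
def cutoffWeight (s : Set X) (N : ℝ) (x : X) : ℝ :=
  (Set.projIcc (0 : ℝ) 1 zero_le_one (N * Metric.infDist x s - 1)).1

theorem cutoffWeight_nonneg : 0 ≤ cutoffWeight s N x := (Set.projIcc _ _ _ _).2.1

theorem cutoffWeight_le_one : cutoffWeight s N x ≤ 1 := (Set.projIcc _ _ _ _).2.2

theorem cutoffWeight_eq_zero (h : N * Metric.infDist x s ≤ 1) : cutoffWeight s N x = 0 := by
  rw [cutoffWeight, Set.projIcc_of_le_left _ (by linarith)]

theorem cutoffWeight_eq_one (h : 2 ≤ N * Metric.infDist x s) : cutoffWeight s N x = 1 := by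
  rw [cutoffWeight, Set.projIcc_of_right_le _ (by linarith)]

theorem abs_cutoffWeight_sub_le (hN : 0 ≤ N) (x y : X) :
    |cutoffWeight s N x - cutoffWeight s N y| ≤ N * dist x y := by
  have hproj := (LipschitzWith.projIcc (zero_le_one (α := ℝ))).dist_le_mul
    (N * Metric.infDist x s - 1) (N * Metric.infDist y s - 1)
  have hdist : |Metric.infDist x s - Metric.infDist y s| ≤ dist x y := by
    simpa [Real.dist_eq] using (Metric.lipschitz_infDist_pt s).dist_le_mul x y
  calc |cutoffWeight s N x - cutoffWeight s N y|
      ≤ |N * Metric.infDist x s - 1 - (N * Metric.infDist y s - 1)| := by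
        simpa [cutoffWeight, Subtype.dist_eq, Real.dist_eq] using hproj
    _ = N * |Metric.infDist x s - Metric.infDist y s| := by
        rw [sub_sub_sub_cancel_right, ← mul_sub, abs_mul, abs_of_nonneg hN]
    _ ≤ N * dist x y := by gcongr

variable {F : Type*} [NormedAddCommGroup F] {q : X → F} {C : NNReal}

theorem norm_le_mul_infDist [ProperSpace X] (hs : IsClosed s) (hne : s.Nonempty)
    (hq : LipschitzWith C q) (h0 : ∀ x ∈ s, q x = 0) (x : X) : ‖q x‖ ≤ C * Metric.infDist x s := by
  obtain ⟨y, hy, hxy⟩ := hs.exists_infDist_eq_dist hne x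
  simpa only [h0 y hy, dist_zero_right, ← hxy] using hq.dist_le_mul x y

variable [NormedSpace ℝ F]

theorem norm_cutoffWeight_smul_sub_le (hN : 0 ≤ N) (hq : LipschitzWith C q) {x y : X}
    (hy : N * Metric.infDist y s ≤ 2) (hqy : ‖q y‖ ≤ C * Metric.infDist y s) :
    ‖cutoffWeight s N x • q x - cutoffWeight s N y • q y‖ ≤ 3 * C * dist x y := by
  have hfst : ‖cutoffWeight s N x • (q x - q y)‖ ≤ C * dist x y := by
    rw [norm_smul, Real.norm_of_nonneg cutoffWeight_nonneg, ← dist_eq_norm]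
    exact (mul_le_of_le_one_left dist_nonneg cutoffWeight_le_one).trans (hq.dist_le_mul x y)
  have hsnd : ‖(cutoffWeight s N x - cutoffWeight s N y) • q y‖ ≤ 2 * (C * dist x y) :=
    calc ‖(cutoffWeight s N x - cutoffWeight s N y) • q y‖
        ≤ N * dist x y * (C * Metric.infDist y s) := by
          rw [norm_smul, Real.norm_eq_abs]
          gcongr
          exact abs_cutoffWeight_sub_le hN x y
      _ = N * Metric.infDist y s * (C * dist x y) := by ring
      _ ≤ 2 * (C * dist x y) := by gcongr
  calc ‖cutoffWeight s N x • q x - cutoffWeight s N y • q y‖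
      = ‖cutoffWeight s N x • (q x - q y) + (cutoffWeight s N x - cutoffWeight s N y) • q y‖ := by
        congr 1
        module
    _ ≤ C * dist x y + 2 * (C * dist x y) := norm_add_le_of_le hfst hsnd
    _ = 3 * C * dist x y := by ring

theorem lipschitzWith_cutoffWeight_smul [ProperSpace X] (hs : IsClosed s) (hne : s.Nonempty)
    (hq : LipschitzWith C q) (h0 : ∀ x ∈ s, q x = 0) (hN : 0 ≤ N) :
    LipschitzWith (3 * C) fun x => cutoffWeight s N x • q x := by
  refine LipschitzWith.of_dist_le_mul fun x y => ?_
  push_cast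
  rcases le_total (N * Metric.infDist y s) 2 with hy | hy
  · rw [dist_eq_norm]
    exact norm_cutoffWeight_smul_sub_le hN hq hy (norm_le_mul_infDist hs hne hq h0 y)
  rcases le_total (N * Metric.infDist x s) 2 with hx | hx
  · rw [dist_comm, dist_eq_norm, dist_comm]
    exact norm_cutoffWeight_smul_sub_le hN hq hx (norm_le_mul_infDist hs hne hq h0 x)
  · rw [cutoffWeight_eq_one hx, cutoffWeight_eq_one hy, one_smul, one_smul]
    refine (hq.dist_le_mul x y).trans ?_
    have : 0 ≤ C * dist x y := by positivity
    linarith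

theorem tsupport_cutoffWeight_smul_subset (s : Set X) (N : ℝ) (q : X → F) :
    tsupport (fun x => cutoffWeight s N x • q x) ⊆ sᶜ := by
  have hsub : tsupport (fun x => cutoffWeight s N x • q x) ⊆ {x | 1 ≤ N * Metric.infDist x s} := by
    refine closure_minimal (fun x hx => ?_) (isClosed_le continuous_const
      (continuous_const.mul (Metric.continuous_infDist_pt s)))
    by_contra hlt
    exact hx (by simp only [cutoffWeight_eq_zero (not_le.1 hlt).le, zero_smul])
  intro x hx hxs
  have := hsub hx
  norm_num [Metric.infDist_zero_of_mem hxs] at this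

theorem eventually_cutoffWeight_smul_eventuallyEq (hs : IsClosed s) (hne : s.Nonempty)
    (hx : x ∉ s) (q : X → F) :
    ∀ᶠ n : ℕ in Filter.atTop, (fun y => cutoffWeight s n y • q y) =ᶠ[𝓝 x] q := by
  have hpos : 0 < Metric.infDist x s := (hs.notMem_iff_infDist_pos hne).1 hx
  have hlim : Filter.Tendsto (fun n : ℕ => n * Metric.infDist x s) Filter.atTop Filter.atTop :=
    tendsto_natCast_atTop_atTop.atTop_mul_const hpos
  filter_upwards [hlim.eventually_gt_atTop 2] with n hn
  have hcont : Continuous fun y => n * Metric.infDist y s :=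
    continuous_const.mul (Metric.continuous_infDist_pt s)
  filter_upwards [hcont.continuousAt.eventually_const_lt hn] with y hy
  rw [cutoffWeight_eq_one hy.le, one_smul]

end Weight

theorem mem_gZero_of_lipschitz {Ω : Set R3} (hΩ : IsOpen Ω) (hb : Bornology.IsBounded Ω)
    {q : R3 → ℂ} {C : NNReal} (hq : LipschitzWith C q) (h0 : ∀ x ∉ Ω, q x = 0) {w : L2v Ω}
    (hw : w =ᵐ[volume.restrict Ω] grad q) : w ∈ gZero Ω := by
  have hne : (Ωᶜ).Nonempty := by
    rw [Set.nonempty_compl]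
    rintro rfl
    exact NormedSpace.unbounded_univ ℝ R3 hb
  have hlip : ∀ n : ℕ, LipschitzWith (3 * C) fun x => cutoffWeight Ωᶜ n x • q x := fun n =>
    lipschitzWith_cutoffWeight_smul hΩ.isClosed_compl hne hq h0 n.cast_nonneg
  refine mem_of_ae_tendsto_grad hb (isClosed_gZero hΩ hb) hlip (fun n v hv =>
    mem_gZero_of_lipschitz_of_tsupport_subset hΩ hb (hlip n)
      ((tsupport_cutoffWeight_smul_subset _ _ q).trans_eq (compl_compl Ω)) hv) ?_ hw
  filter_upwards [ae_restrict_mem hΩ.measurableSet] with x hx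
  refine tendsto_grad_of_tendsto_fderiv (tendsto_const_nhds.congr' ?_)
  filter_upwards [eventually_cutoffWeight_smul_eventuallyEq hΩ.isClosed_compl hne
    (Set.notMem_compl_iff.2 hx) q] with n hn
  exact hn.fderiv_eq.symm

end Cutoff

section Indicator

theorem inter_frontier_nonempty_of_isPreconnected {X : Type*} [TopologicalSpace X] {s t : Set X}
    (hs : IsPreconnected s) (ht : (s ∩ t).Nonempty) (ht' : (s ∩ tᶜ).Nonempty) :
    (s ∩ frontier t).Nonempty := by
  by_contra hempty
  have hcover : s ⊆ interior t ∪ interior tᶜ := fun z hz => by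
    rw [interior_compl, Set.mem_union, Set.mem_compl_iff]
    by_contra! hz'
    exact hempty ⟨z, hz, hz'.2, hz'.1⟩
  have hsub : ∀ {u v : Set X}, s ⊆ interior u ∪ interior v → Disjoint u (interior v) →
      (s ∩ u).Nonempty → (s ∩ interior u).Nonempty := fun h hd ⟨z, hz, hzu⟩ =>
    ⟨z, hz, (h hz).resolve_right (hd.notMem_of_mem_left hzu)⟩
  obtain ⟨z, -, hz, hz'⟩ := hs _ _ isOpen_interior isOpen_interior hcover
    (hsub hcover (disjoint_compl_right.mono_right interior_subset) ht)
    (hsub (hcover.trans_eq (Set.union_comm _ _)) (disjoint_compl_left.mono_right interior_subset)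
      ht')
  exact interior_subset hz' (interior_subset hz)

theorem lipschitzWith_indicator {E F : Type*} [NormedAddCommGroup E] [NormedSpace ℝ E]
    [NormedAddCommGroup F] {Ω : Set E} {q : E → F} {C : NNReal} (hq : LipschitzWith C q)
    (h0 : ∀ x ∈ frontier Ω, q x = 0) : LipschitzWith C (Ω.indicator q) := by
  have hcross : ∀ x ∈ Ω, ∀ y ∉ Ω, ‖q x‖ ≤ C * dist x y := by
    intro x hx y hy
    obtain ⟨z, hz, hzf⟩ := inter_frontier_nonempty_of_isPreconnected
      (convex_segment x y).isPreconnected ⟨x, left_mem_segment ℝ x y, hx⟩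
      ⟨y, right_mem_segment ℝ x y, hy⟩
    calc ‖q x‖ = dist (q x) (q z) := by rw [h0 z hzf, dist_zero_right]
      _ ≤ C * dist x z := hq.dist_le_mul x z
      _ ≤ C * dist x y := by
        gcongr
        linarith [dist_add_dist_of_mem_segment hz, dist_nonneg (x := z) (y := y)]
  refine LipschitzWith.of_dist_le_mul fun x y => ?_
  by_cases hx : x ∈ Ω <;> by_cases hy : y ∈ Ω
  · simpa [hx, hy] using hq.dist_le_mul x y
  · simpa [hx, hy] using hcross x hx y hy
  · simpa [hx, hy, dist_comm x y] using hcross y hy x hx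
  · simpa [hx, hy] using by positivity

end Indicator

/-! ### Reflection across the boundary -/

section CubeChart

/-- The reflection in the plane `y 2 = 0`. -/
def planeReflection (y : R3) : R3 := !₂[y 0, y 1, -y 2]

theorem planeReflection_planeReflection (y : R3) : planeReflection (planeReflection y) = y := by
  ext i
  fin_cases i <;> simp [planeReflection]

theorem dist_planeReflection (x y : R3) :
    dist (planeReflection x) (planeReflection y) = dist x y := by
  rw [EuclideanSpace.dist_eq, EuclideanSpace.dist_eq, Fin.sum_univ_three, Fin.sum_univ_three]
  simp [planeReflection, dist_neg_neg]

theorem planeReflection_mem_cube {y : R3} (hy : y ∈ cube) : planeReflection y ∈ cube := by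
  intro i
  have h0 := hy 0
  have h1 := hy 1
  have h2 := hy 2
  fin_cases i <;> simpa [planeReflection]

theorem planeReflection_eq_self {y : R3} (hy : y 2 = 0) : planeReflection y = y := by
  ext i
  fin_cases i <;> simp [planeReflection, hy]

theorem convex_cube : Convex ℝ cube := by
  intro x hx y hy a b ha hb hab i
  have hmem := convex_Ioo (-1 : ℝ) 1 (abs_lt.1 (hx i)) (abs_lt.1 (hy i)) ha hb hab
  rw [abs_lt]
  simpa using hmem

theorem convex_upper_cube : Convex ℝ {y : R3 | y ∈ cube ∧ 0 < y 2} :=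
  convex_cube.inter (convex_halfSpace_gt (f := fun y : R3 => y 2)
    ⟨fun _ _ => rfl, fun _ _ => rfl⟩ 0)

theorem dist_le_of_mem_cube {x y : R3} (hx : x ∈ cube) (hy : y ∈ cube) : dist x y ≤ 4 := by
  rw [EuclideanSpace.dist_eq]
  refine Real.sqrt_le_iff.2 ⟨by norm_num, ?_⟩
  have hcoord : ∀ i, dist (x i) (y i) ^ 2 ≤ 4 := fun i => by
    have h1 := abs_lt.1 (hx i)
    have h2 := abs_lt.1 (hy i)
    rw [Real.dist_eq, sq_abs]
    nlinarith
  rw [Fin.sum_univ_three]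
  linarith [hcoord 0, hcoord 1, hcoord 2]

/-- A chart `χ` of a weak Lipschitz domain on an open set `U`, with its inverse `χ'`. The three
equivalences say that `χ` takes the parts of `U` inside `Ω`, on its boundary and outside its closure
to the parts of the cube below, on and above the middle slice. -/
structure IsCubeChart (Ω U : Set R3) (χ χ' : R3 → R3) (K L : NNReal) : Prop where
  isOpen : IsOpen U
  mapsTo : Set.MapsTo χ U cube
  mapsTo' : Set.MapsTo χ' cube U
  left_inv : ∀ x ∈ U, χ' (χ x) = x
  right_inv : ∀ y ∈ cube, χ (χ' y) = y
  lip : LipschitzOnWith K χ U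
  lip' : LipschitzOnWith L χ' cube
  mem_iff : ∀ x ∈ U, x ∈ Ω ↔ χ x 2 < 0
  mem_frontier_iff : ∀ x ∈ U, x ∈ frontier Ω ↔ χ x 2 = 0
  notMem_closure_iff : ∀ x ∈ U, x ∉ closure Ω ↔ 0 < χ x 2

theorem mem_iff_of_image_inter_eq {X Y : Type*} {χ : X → Y} {U S : Set X} {Q : Set Y} {P : Y → Prop}
    (hχ : Set.BijOn χ U Q) (himage : χ '' (U ∩ S) = {y ∈ Q | P y}) {x : X} (hx : x ∈ U) :
    x ∈ S ↔ P (χ x) := by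
  have himage_iff : χ x ∈ χ '' (U ∩ S) ↔ x ∈ S := by
    rw [hχ.injOn.mem_image_iff Set.inter_subset_left hx, Set.mem_inter_iff, and_iff_right hx]
  rw [← himage_iff, himage]
  exact and_iff_right (hχ.mapsTo hx)

theorem IsWeakLipschitz.exists_isCubeChart {Ω : Set R3} (hΩ : IsWeakLipschitz Ω) {x₀ : R3}
    (hx₀ : x₀ ∈ frontier Ω) :
    ∃ (U : Set R3) (χ χ' : R3 → R3) (K L : NNReal), x₀ ∈ U ∧ IsCubeChart Ω U χ χ' K L := by
  obtain ⟨U, χ, K, L, hU, hx₀U, hbij, hlip, hexp, hinside, hbd, hext⟩ := hΩ x₀ hx₀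
  have hmaps' : Set.MapsTo (Function.invFunOn χ U) cube U := hbij.surjOn.mapsTo_invFunOn
  have hright : ∀ y ∈ cube, χ (Function.invFunOn χ U y) = y := fun y hy =>
    hbij.surjOn.rightInvOn_invFunOn hy
  refine ⟨U, χ, Function.invFunOn χ U, K, L, hx₀U,
    { isOpen := hU
      mapsTo := hbij.mapsTo
      mapsTo' := hmaps'
      left_inv := fun x hx => hbij.injOn.leftInvOn_invFunOn hx
      right_inv := hright
      lip := hlip
      lip' := LipschitzOnWith.of_dist_le_mul fun a ha b hb => ?_
      mem_iff := fun x => mem_iff_of_image_inter_eq hbij hinside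
      mem_frontier_iff := fun x => mem_iff_of_image_inter_eq hbij hbd
      notMem_closure_iff := fun x => mem_iff_of_image_inter_eq (S := (closure Ω)ᶜ) hbij hext }⟩
  simpa only [hright a ha, hright b hb] using hexp _ (hmaps' ha) _ (hmaps' hb)

/-- The reflection in the middle slice of the cube, in the coordinates of the chart `χ` with inverse
`χ'`. -/
def chartReflection (χ χ' : R3 → R3) (x : R3) : R3 := χ' (planeReflection (χ x))

namespace IsCubeChart

variable {Ω U : Set R3} {χ χ' : R3 → R3} {K L : NNReal} (h : IsCubeChart Ω U χ χ' K L)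
include h

theorem isBounded : Bornology.IsBounded U := by
  rw [Metric.isBounded_iff]
  refine ⟨L * 4, fun x hx y hy => ?_⟩
  calc dist x y = dist (χ' (χ x)) (χ' (χ y)) := by rw [h.left_inv x hx, h.left_inv y hy]
    _ ≤ L * dist (χ x) (χ y) := h.lip'.dist_le_mul _ (h.mapsTo hx) _ (h.mapsTo hy)
    _ ≤ L * 4 := by
      gcongr
      exact dist_le_of_mem_cube (h.mapsTo hx) (h.mapsTo hy)

theorem isConvexChart :
    IsConvexChart (U \ closure Ω) {y : R3 | y ∈ cube ∧ 0 < y 2} χ χ' K L 4 where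
  isOpen := h.isOpen.sdiff isClosed_closure
  nonempty := by
    have hy : (!₂[0, 0, 1 / 2] : R3) ∈ cube := fun i => by
      fin_cases i <;> norm_num [abs_of_pos]
    exact ⟨χ' !₂[0, 0, 1 / 2], h.mapsTo' hy, (h.notMem_closure_iff _ (h.mapsTo' hy)).2 (by
      rw [h.right_inv _ hy]
      simp)⟩
  volume_ne_top := (h.isBounded.subset Set.sdiff_subset).measure_lt_top.ne
  convex := convex_upper_cube
  dist_le := fun a ha b hb => dist_le_of_mem_cube ha.1 hb.1
  mapsTo := fun x hx => ⟨h.mapsTo hx.1, (h.notMem_closure_iff x hx.1).1 hx.2⟩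
  mapsTo' := fun y hy => ⟨h.mapsTo' hy.1, (h.notMem_closure_iff _ (h.mapsTo' hy.1)).2 (by
    simpa only [h.right_inv y hy.1] using hy.2)⟩
  left_inv := fun x hx => h.left_inv x hx.1
  right_inv := fun y hy => h.right_inv y hy.1
  lip := h.lip.mono Set.sdiff_subset
  lip' := h.lip'.mono fun y hy => hy.1

theorem planeReflection_mem_cube {x : R3} (hx : x ∈ U) : planeReflection (χ x) ∈ cube :=
  NonlocalH.planeReflection_mem_cube (h.mapsTo hx)

theorem mapsTo_chartReflection : Set.MapsTo (chartReflection χ χ') U U := fun _ hx =>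
  h.mapsTo' (h.planeReflection_mem_cube hx)

theorem apply_chartReflection {x : R3} (hx : x ∈ U) :
    χ (chartReflection χ χ' x) = planeReflection (χ x) :=
  h.right_inv _ (h.planeReflection_mem_cube hx)

theorem chartReflection_chartReflection {x : R3} (hx : x ∈ U) :
    chartReflection χ χ' (chartReflection χ χ' x) = x := by
  rw [chartReflection, h.apply_chartReflection hx, planeReflection_planeReflection,
    h.left_inv x hx]

theorem lipschitzOnWith_chartReflection : LipschitzOnWith (L * K) (chartReflection χ χ') U :=
  LipschitzOnWith.of_dist_le_mul fun x hx y hy =>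
    calc dist (chartReflection χ χ' x) (chartReflection χ χ' y)
        ≤ L * dist (planeReflection (χ x)) (planeReflection (χ y)) :=
          h.lip'.dist_le_mul _ (h.planeReflection_mem_cube hx) _ (h.planeReflection_mem_cube hy)
      _ = L * dist (χ x) (χ y) := by rw [dist_planeReflection]
      _ ≤ L * (K * dist x y) := by gcongr; exact h.lip.dist_le_mul _ hx _ hy
      _ = (L * K : NNReal) * dist x y := by push_cast; ring

theorem mapsTo_exterior_chartReflection :
    Set.MapsTo (chartReflection χ χ') (U ∩ Ω) (U \ closure Ω) := by
  intro x hx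
  have hmem := h.mapsTo_chartReflection hx.1
  refine ⟨hmem, (h.notMem_closure_iff _ hmem).2 ?_⟩
  rw [h.apply_chartReflection hx.1]
  simpa [planeReflection] using (h.mem_iff x hx.1).1 hx.2

theorem chartReflection_eq_self {x : R3} (hx : x ∈ U ∩ frontier Ω) :
    chartReflection χ χ' x = x := by
  rw [chartReflection, planeReflection_eq_self ((h.mem_frontier_iff x hx.1).1 hx.2),
    h.left_inv x hx.1]

end IsCubeChart

end CubeChart

/-- A neighbourhood `U` of a boundary point with a bi-Lipschitz reflection `ρ` that maps the part
of `U` inside `Ω` to the part outside, where the Poincaré inequality holds. -/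
structure IsReflectionChart (Ω U : Set R3) (ρ : R3 → R3) (K C : NNReal) : Prop where
  isOpen : IsOpen U
  isBounded : Bornology.IsBounded U
  mapsTo : Set.MapsTo ρ U U
  lip : LipschitzOnWith K ρ U
  dist_le : ∀ x ∈ U, ∀ y ∈ U, dist x y ≤ K * dist (ρ x) (ρ y)
  mapsTo_exterior : Set.MapsTo ρ (U ∩ Ω) (U \ closure Ω)
  eq_self : ∀ x ∈ U ∩ frontier Ω, ρ x = x
  poincare : ∀ p : R3 → ℂ, ContDiff ℝ 1 p → ∃ c : ℂ,
    ∫⁻ x in U \ closure Ω, ‖p x - c‖ₑ ^ 2 ≤ C * ∫⁻ x in U \ closure Ω, ‖fderiv ℝ p x‖ₑ ^ 2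

theorem IsCubeChart.exists_isReflectionChart {Ω U : Set R3} {χ χ' : R3 → R3} {K L : NNReal}
    (h : IsCubeChart Ω U χ χ' K L) :
    ∃ C : NNReal, IsReflectionChart Ω U (chartReflection χ χ') (L * K) C := by
  obtain ⟨C, hC⟩ := h.isConvexChart.exists_lintegral_enorm_sub_const_sq_le (F := ℂ)
  refine ⟨C,
    { isOpen := h.isOpen
      isBounded := h.isBounded
      mapsTo := h.mapsTo_chartReflection
      lip := h.lipschitzOnWith_chartReflection
      dist_le := fun x hx y hy => ?_
      mapsTo_exterior := h.mapsTo_exterior_chartReflection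
      eq_self := fun x hx => h.chartReflection_eq_self hx
      poincare := hC }⟩
  simpa only [h.chartReflection_chartReflection hx, h.chartReflection_chartReflection hy] using
    h.lipschitzOnWith_chartReflection.dist_le_mul _ (h.mapsTo_chartReflection hx) _
      (h.mapsTo_chartReflection hy)

section SMul

variable {F : Type*} [NormedAddCommGroup F] [NormedSpace ℝ F]

theorem lipschitzWith_smul_of_lipschitzOnWith {X : Type*} [PseudoMetricSpace X] {U : Set X}
    {θ : X → ℝ} {f : X → F} {T L P M : NNReal} (hT : ∀ x, ‖θ x‖ ≤ T) (hL : LipschitzWith L θ)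
    (hU : ∀ x ∉ U, θ x = 0) (hf : LipschitzOnWith P f U) (hM : ∀ x ∈ U, ‖f x‖ ≤ M) :
    LipschitzWith (T * P + L * M) fun x => θ x • f x := by
  have hdist : ∀ x, ∀ y ∈ U, dist (θ x • f x) (θ y • f y) ≤ (T * P + L * M) * dist x y := by
    intro x y hy
    have hfst : ‖θ x • (f x - f y)‖ ≤ T * (P * dist x y) := by
      by_cases hx : x ∈ U
      · rw [norm_smul, ← dist_eq_norm]
        gcongr
        exacts [hT x, hf.dist_le_mul x hx y hy]
      · rw [hU x hx, zero_smul, norm_zero]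
        positivity
    have hsnd : ‖(θ x - θ y) • f y‖ ≤ L * dist x y * M := by
      rw [norm_smul, ← dist_eq_norm]
      gcongr
      exacts [hL.dist_le_mul x y, hM y hy]
    calc dist (θ x • f x) (θ y • f y) = ‖θ x • (f x - f y) + (θ x - θ y) • f y‖ := by
          rw [dist_eq_norm]
          congr 1
          module
      _ ≤ T * (P * dist x y) + L * dist x y * M := norm_add_le_of_le hfst hsnd
      _ = (T * P + L * M) * dist x y := by ring
  refine LipschitzWith.of_dist_le_mul fun x y => ?_
  push_cast
  by_cases hy : y ∈ U
  · exact hdist x y hy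
  by_cases hx : x ∈ U
  · rw [dist_comm, dist_comm x]
    exact hdist y x hx
  · rw [hU x hx, hU y hy, zero_smul, zero_smul, dist_self]
    positivity

variable {E : Type*} [NormedAddCommGroup E] [NormedSpace ℝ E]

theorem norm_fderiv_smul_le {θ : E → ℝ} {f : E → F} {T L P : NNReal} (hT : ∀ x, ‖θ x‖ ≤ T)
    (hL : LipschitzWith L θ) {x : E} {s : Set E} (hs : s ∈ 𝓝 x) (hf : LipschitzOnWith P f s) :
    ‖fderiv ℝ (fun z => θ z • f z) x‖ ≤ L * ‖f x‖ + T * P := by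
  refine norm_fderiv_le_of_lip' ℝ (by positivity) ?_
  filter_upwards [hs] with z hz
  calc ‖θ z • f z - θ x • f x‖ = ‖(θ z - θ x) • f x + θ z • (f z - f x)‖ := by
        congr 1
        module
    _ ≤ L * ‖z - x‖ * ‖f x‖ + T * (P * ‖z - x‖) := by
        refine norm_add_le_of_le ?_ ?_ <;> rw [norm_smul]
        · gcongr
          simpa only [dist_eq_norm] using hL.dist_le_mul z x
        · gcongr
          · exact hT z
          · simpa only [dist_eq_norm] using hf.dist_le_mul z hz x (mem_of_mem_nhds hs)
    _ = (L * ‖f x‖ + T * P) * ‖z - x‖ := by ring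

theorem norm_fderiv_smul_comp_le {θ : E → ℝ} {ρ : E → E} {p : E → F} {T L K : NNReal} {U : Set E}
    (hT : ∀ x, ‖θ x‖ ≤ T) (hL : LipschitzWith L θ) (hρ : LipschitzOnWith K ρ U) {x : E}
    (hU : U ∈ 𝓝 x) (hp : ContDiff ℝ 1 p) (c : F) :
    ‖fderiv ℝ (fun z => θ z • (p (ρ z) - c)) x‖ ≤
      L * ‖p (ρ x) - c‖ + T * K * ‖fderiv ℝ p (ρ x)‖ := by
  have hle : ∀ P : NNReal, ‖fderiv ℝ p (ρ x)‖₊ < P →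
      ‖fderiv ℝ (fun z => θ z • (p (ρ z) - c)) x‖ ≤ L * ‖p (ρ x) - c‖ + T * K * P := by
    intro P hP
    obtain ⟨t, ht, hpt⟩ := (hp.hasStrictFDerivAt (x := ρ x)
      one_ne_zero).exists_lipschitzOnWith_of_nnnorm_lt P hP
    have hpre : U ∩ ρ ⁻¹' t ∈ 𝓝 x := Filter.inter_mem hU ((hρ.continuousOn.continuousAt hU) ht)
    have hcomp : LipschitzOnWith (P * K) (fun z => p (ρ z) - c) (U ∩ ρ ⁻¹' t) := by
      have hpρ : LipschitzOnWith (P * K) (fun z => p (ρ z)) (U ∩ ρ ⁻¹' t) :=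
        hpt.comp (hρ.mono Set.inter_subset_left) fun z hz => hz.2
      simpa only [add_zero] using hpρ.sub (LipschitzWith.const c).lipschitzOnWith
    refine (norm_fderiv_smul_le hT hL hpre hcomp).trans_eq ?_
    push_cast
    ring
  have hcont : Continuous fun P : NNReal => L * ‖p (ρ x) - c‖ + T * K * (P : ℝ) := by fun_prop
  have hlim : Filter.Tendsto (fun P : NNReal => L * ‖p (ρ x) - c‖ + T * K * (P : ℝ))
      (𝓝[>] ‖fderiv ℝ p (ρ x)‖₊) (𝓝 (L * ‖p (ρ x) - c‖ + T * K * ‖fderiv ℝ p (ρ x)‖)) :=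
    hcont.continuousWithinAt
  exact ge_of_tendsto hlim (Filter.eventually_of_mem self_mem_nhdsWithin hle)

end SMul

section Reflected

variable {Ω : Set R3}

/-- The function `p - c` reflected by `ρ` and localised by the cutoff function `θ`. -/
def reflected (θ : R3 → ℝ) (ρ : R3 → R3) (p : R3 → ℂ) (c : ℂ) (x : R3) : ℂ :=
  θ x • (p (ρ x) - c)

namespace IsReflectionChart

variable {U : Set R3} {ρ : R3 → R3} {K C : NNReal} (h : IsReflectionChart Ω U ρ K C)
  {θ : R3 → ℝ} (hθU : tsupport θ ⊆ U) {T L : NNReal} (hT : ∀ x, ‖θ x‖ ≤ T)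
  (hL : LipschitzWith L θ) {p : R3 → ℂ}
include h hθU

theorem reflected_eq_of_mem_frontier (c : ℂ) {x : R3} (hx : x ∈ frontier Ω) :
    reflected θ ρ p c x = θ x • (p x - c) := by
  by_cases hxU : x ∈ U
  · rw [reflected, h.eq_self x ⟨hxU, hx⟩]
  · simp [reflected, image_eq_zero_of_notMem_tsupport fun hx' => hxU (hθU hx')]

include hT hL

theorem exists_lipschitzWith_reflected {P : NNReal} (hp : LipschitzWith P p) (c : ℂ) :
    ∃ D : NNReal, LipschitzWith D (reflected θ ρ p c) := by
  obtain ⟨M, hM, hbound⟩ := (hp.isBounded_image h.isBounded).exists_pos_norm_le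
  have hcomp : LipschitzOnWith (P * K) (fun x => p (ρ x) - c) U := by
    simpa using (hp.comp_lipschitzOnWith h.lip).sub (LipschitzWith.const c).lipschitzOnWith
  exact ⟨_, lipschitzWith_smul_of_lipschitzOnWith (M := ⟨M + ‖c‖, by positivity⟩) hT hL
    (fun x hx => image_eq_zero_of_notMem_tsupport fun hx' => hx (hθU hx')) hcomp fun x hx =>
      norm_sub_le_of_le (hbound _ ⟨ρ x, h.mapsTo hx, rfl⟩) le_rfl⟩

omit hθU in
theorem enorm_fderiv_reflected_sq_le (hp : ContDiff ℝ 1 p) (c : ℂ) {x : R3} (hx : x ∈ U) :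
    ‖fderiv ℝ (reflected θ ρ p c) x‖ₑ ^ 2 ≤ ((2 * L ^ 2 : NNReal) : ENNReal) *
      ‖p (ρ x) - c‖ₑ ^ 2 + ((2 * (T * K) ^ 2 : NNReal) : ENNReal) * ‖fderiv ℝ p (ρ x)‖ₑ ^ 2 := by
  have hle : ‖fderiv ℝ (reflected θ ρ p c) x‖₊ ≤
      L * ‖p (ρ x) - c‖₊ + T * K * ‖fderiv ℝ p (ρ x)‖₊ :=
    norm_fderiv_smul_comp_le hT hL h.lip (h.isOpen.mem_nhds hx) hp c
  have hsq : ‖fderiv ℝ (reflected θ ρ p c) x‖₊ ^ 2 ≤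
      2 * L ^ 2 * ‖p (ρ x) - c‖₊ ^ 2 + 2 * (T * K) ^ 2 * ‖fderiv ℝ p (ρ x)‖₊ ^ 2 :=
    calc ‖fderiv ℝ (reflected θ ρ p c) x‖₊ ^ 2
        ≤ (L * ‖p (ρ x) - c‖₊ + T * K * ‖fderiv ℝ p (ρ x)‖₊) ^ 2 := by gcongr
      _ ≤ 2 * ((L * ‖p (ρ x) - c‖₊) ^ 2 + (T * K * ‖fderiv ℝ p (ρ x)‖₊) ^ 2) := add_sq_le
      _ = _ := by ring
  simp only [enorm_eq_nnnorm]
  exact_mod_cast hsq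

theorem lintegral_fderiv_reflected_le (hΩ : IsOpen Ω) (hp : ContDiff ℝ 1 p) (c : ℂ) :
    ∫⁻ x in Ω, ‖fderiv ℝ (reflected θ ρ p c) x‖ₑ ^ 2 ≤
      ((2 * L ^ 2 : NNReal) : ENNReal) * (∫⁻ x in U ∩ Ω, ‖p (ρ x) - c‖ₑ ^ 2) +
        ((2 * (T * K) ^ 2 : NNReal) : ENNReal) * ∫⁻ x in U ∩ Ω, ‖fderiv ℝ p (ρ x)‖ₑ ^ 2 := by
  have hUΩ : MeasurableSet (U ∩ Ω) := (h.isOpen.inter hΩ).measurableSet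
  have hsupport : (fun x => ‖fderiv ℝ (reflected θ ρ p c) x‖ₑ ^ 2).support ⊆ U := by
    intro x hx
    have hts : tsupport (reflected θ ρ p c) ⊆ tsupport θ :=
      tsupport_smul_subset_left θ fun x => p (ρ x) - c
    exact hθU (hts (support_fderiv_subset ℝ fun hzero => hx (by simp [enorm_eq_nnnorm, hzero])))
  have hmeas : AEMeasurable (fun x => ‖p (ρ x) - c‖ₑ ^ 2) (volume.restrict (U ∩ Ω)) :=
    ((hp.continuous.sub continuous_const).enorm.measurable.pow_const 2).comp_aemeasurable
      ((h.lip.continuousOn.mono Set.inter_subset_left).aemeasurable hUΩ)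
  rw [← setLIntegral_eq_of_support_subset hsupport,
    Measure.restrict_restrict h.isOpen.measurableSet,
    ← lintegral_const_mul' _ _ ENNReal.coe_ne_top, ← lintegral_const_mul' _ _ ENNReal.coe_ne_top,
    ← lintegral_add_left' (hmeas.const_mul _)]
  exact setLIntegral_mono' hUΩ fun x hx => h.enorm_fderiv_reflected_sq_le hT hL hp c hx.1

theorem exists_lintegral_fderiv_reflected_le (hΩ : IsOpen Ω) :
    ∃ D : NNReal, ∀ p : R3 → ℂ, ContDiff ℝ 1 p → ∃ c : ℂ,
      ∫⁻ x in Ω, ‖fderiv ℝ (reflected θ ρ p c) x‖ₑ ^ 2 ≤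
        D * ∫⁻ x in U \ closure Ω, ‖fderiv ℝ p x‖ₑ ^ 2 := by
  refine ⟨2 * L ^ 2 * (K ^ 3 * C) + 2 * (T * K) ^ 2 * K ^ 3, fun p hp => ?_⟩
  obtain ⟨c, hc⟩ := h.poincare p hp
  have hcomp : ∀ {g : R3 → ENNReal}, Measurable g → ∫⁻ x in U ∩ Ω, g (ρ x) ≤
      (K : ENNReal) ^ 3 * ∫⁻ x in U \ closure Ω, g x := fun {g} hg => by
    simpa only [finrank_euclideanSpace_fin] using setLIntegral_comp_le_of_dist_le (μ := volume)
      (h.isOpen.inter hΩ).measurableSet (h.lip.continuousOn.mono Set.inter_subset_left)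
      h.mapsTo_exterior (fun x hx y hy => h.dist_le x hx.1 y hy.1) hg
  refine ⟨c, (h.lintegral_fderiv_reflected_le hθU hT hL hΩ hp c).trans ?_⟩
  grw [hcomp (g := fun y => ‖p y - c‖ₑ ^ 2)
      ((hp.continuous.sub continuous_const).enorm.measurable.pow_const 2), hc,
    hcomp (g := fun y => ‖fderiv ℝ p y‖ₑ ^ 2)
      ((hp.continuous_fderiv one_ne_zero).enorm.measurable.pow_const 2)]
  push_cast
  apply le_of_eq
  ring

end IsReflectionChart

end Reflected

/-! ### The Poincaré potential of a field -/

section ParametricIntegral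

variable {E F : Type*} [NormedAddCommGroup E] [NormedSpace ℝ E] [NormedAddCommGroup F]
  [NormedSpace ℝ F]

theorem continuous_fderiv_of_contDiff_uncurry {G : Type*} [NormedAddCommGroup G] [NormedSpace ℝ G]
    {f : E → G → F} (hf : ContDiff ℝ 1 (Function.uncurry f)) :
    Continuous fun z : E × G => fderiv ℝ (f · z.2) z.1 := by
  have hswap : ContDiff ℝ 1 (Function.uncurry fun (z : E × G) (x : E) => f x z.2) :=
    hf.comp (contDiff_snd.prodMk (contDiff_snd.comp contDiff_fst))
  exact (hswap.fderiv (n := 0) contDiff_fst (by simp)).continuous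

variable [ProperSpace E] {f : E → ℝ → F}

theorem hasFDerivAt_intervalIntegral (hf : ContDiff ℝ 1 (Function.uncurry f)) (a b : ℝ) (x₀ : E) :
    HasFDerivAt (fun x => ∫ s in a..b, f x s) (∫ s in a..b, fderiv ℝ (f · s) x₀) x₀ := by
  have hf' := continuous_fderiv_of_contDiff_uncurry hf
  obtain ⟨M, hM⟩ := ((isCompact_closedBall x₀ 1).prod
    (isCompact_uIcc (a := a) (b := b))).exists_bound_of_continuousOn hf'.continuousOn
  have hcont : ∀ x, Continuous (f x) := fun x => hf.continuous.comp (Continuous.prodMk_right x)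
  refine intervalIntegral.hasFDerivAt_integral_of_dominated_of_fderiv_le
    (F' := fun x s => fderiv ℝ (f · s) x) (bound := fun _ => M)
    (Metric.closedBall_mem_nhds x₀ one_pos)
    (Filter.Eventually.of_forall fun x => (hcont x).aestronglyMeasurable)
    ((hcont x₀).intervalIntegrable a b)
    (hf'.comp (Continuous.prodMk_right x₀)).aestronglyMeasurable
    (Filter.Eventually.of_forall fun s hs x hx => hM (x, s) ⟨hx, Set.uIoc_subset_uIcc hs⟩)
    intervalIntegrable_const (Filter.Eventually.of_forall fun s _ x _ => ?_)
  have hs : ContDiff ℝ 1 (f · s) := hf.comp (contDiff_id.prodMk contDiff_const)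
  exact (hs.differentiable one_ne_zero x).hasFDerivAt

theorem contDiff_one_intervalIntegral (hf : ContDiff ℝ 1 (Function.uncurry f)) (a b : ℝ) :
    ContDiff ℝ 1 fun x => ∫ s in a..b, f x s := by
  rw [contDiff_one_iff_fderiv]
  refine ⟨fun x => (hasFDerivAt_intervalIntegral hf a b x).differentiableAt, ?_⟩
  rw [funext fun x => (hasFDerivAt_intervalIntegral hf a b x).fderiv]
  exact intervalIntegral.continuous_parametric_intervalIntegral_of_continuous'
    (continuous_fderiv_of_contDiff_uncurry hf) a b

end ParametricIntegral

theorem pderiv_intervalIntegral {f : R3 → ℝ → ℂ} (hf : ContDiff ℝ 1 (Function.uncurry f))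
    (a b : ℝ) (i : Fin 3) (x : R3) :
    pderiv i (fun x => ∫ s in a..b, f x s) x = ∫ s in a..b, pderiv i (f · s) x := by
  rw [pderiv, (hasFDerivAt_intervalIntegral hf a b x).fderiv]
  exact ContinuousLinearMap.intervalIntegral_apply (((continuous_fderiv_of_contDiff_uncurry hf).comp
    (Continuous.prodMk_right x)).intervalIntegrable a b) _

theorem lintegral_comp_smul {E : Type*} [NormedAddCommGroup E] [NormedSpace ℝ E]
    [FiniteDimensional ℝ E] [MeasurableSpace E] [BorelSpace E] (μ : Measure E) [μ.IsAddHaarMeasure]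
    {h : E → ENNReal} (hh : Measurable h) {r : ℝ} (hr : r ≠ 0) :
    ∫⁻ x, h (r • x) ∂μ =
      ENNReal.ofReal |(r ^ Module.finrank ℝ E)⁻¹| * ∫⁻ x, h x ∂μ := by
  rw [← lintegral_map hh (measurable_const_smul r), Measure.map_addHaar_smul μ hr,
    lintegral_smul_measure, smul_eq_mul]

theorem enorm_sq_eq_sum (v : C3) : ‖v‖ₑ ^ 2 = ∑ i, ‖v i‖ₑ ^ 2 := by
  simp only [← ofReal_norm, ← ENNReal.ofReal_pow (norm_nonneg _)]
  rw [EuclideanSpace.norm_sq_eq, ENNReal.ofReal_sum_of_nonneg fun i _ => by positivity]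

theorem norm_pderiv_sub_le_norm_curl (u : R3 → C3) (x : R3) (i j : Fin 3) :
    ‖pderiv j (fun y => u y i) x - pderiv i (fun y => u y j) x‖ ≤ ‖curl u x‖ := by
  have h0 : ‖pderiv 1 (fun y => u y 2) x - pderiv 2 (fun y => u y 1) x‖ ≤ ‖curl u x‖ :=
    PiLp.norm_apply_le (curl u x) 0
  have h1 : ‖pderiv 2 (fun y => u y 0) x - pderiv 0 (fun y => u y 2) x‖ ≤ ‖curl u x‖ :=
    PiLp.norm_apply_le (curl u x) 1
  have h2 : ‖pderiv 0 (fun y => u y 1) x - pderiv 1 (fun y => u y 0) x‖ ≤ ‖curl u x‖ :=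
    PiLp.norm_apply_le (curl u x) 2
  fin_cases i <;> fin_cases j <;> simp only [Fin.zero_eta, Fin.mk_one, Fin.reduceFinMk] <;>
    first
    | assumption
    | (rw [norm_sub_rev]; assumption)
    | simp

theorem continuous_radial {F : Type*} [NormedAddCommGroup F] [NormedSpace ℝ F] {f : R3 → F}
    {g : Fin 3 → R3 → F} (hf : Continuous f) (hg : ∀ j, Continuous (g j)) (x : R3) :
    Continuous fun s : ℝ =>
      (2 * s) • f (s ^ 2 • x) + ∑ j, (2 * s ^ 3 * x j) • g j (s ^ 2 • x) := by
  fun_prop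

/-- The derivative of `s ↦ s² f (s² x)` integrates to `f x`. -/
theorem integral_radial_eq {f : R3 → ℂ} (hf : ContDiff ℝ ∞ f) (x : R3) :
    ∫ s in (0 : ℝ)..1, ((2 * s) • f (s ^ 2 • x) +
      ∑ j, (2 * s ^ 3 * x j) • pderiv j f (s ^ 2 • x)) = f x := by
  have hderiv : ∀ s : ℝ, HasDerivAt (fun s : ℝ => s ^ 2 • f (s ^ 2 • x))
      ((2 * s) • f (s ^ 2 • x) + ∑ j, (2 * s ^ 3 * x j) • pderiv j f (s ^ 2 • x)) s := by
    intro s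
    have hsq : HasDerivAt (fun s : ℝ => s ^ 2) (2 * s) s := by simpa using hasDerivAt_pow 2 s
    have hcomp : HasDerivAt (fun s : ℝ => f (s ^ 2 • x))
        (fderiv ℝ f (s ^ 2 • x) ((2 * s) • x)) s :=
      (hf.differentiable (by simp) _).hasFDerivAt.comp_hasDerivAt s (hsq.smul_const x)
    refine (hsq.smul hcomp).congr_deriv ?_
    rw [add_comm, map_smul, fderiv_apply_eq_sum_pderiv, smul_smul, Finset.smul_sum]
    simp only [smul_smul]
    ring_nf
  rw [intervalIntegral.integral_eq_sub_of_hasDerivAt fun s _ => hderiv s]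
  · simp
  · exact (continuous_radial hf.continuous (fun j => (contDiff_pderiv hf j).continuous)
      x).intervalIntegrable 0 1

theorem lintegral_pow_mul_comp_sq_smul_sq_le {h : R3 → ENNReal} (hh : Measurable h) (c : NNReal)
    {s : ℝ} (hs : 0 ≤ s) :
    ∫⁻ x, (ENNReal.ofReal (c * s ^ 3) * h (s ^ 2 • x)) ^ 2 ≤ c ^ 2 * ∫⁻ x, h x ^ 2 := by
  obtain rfl | hpos := hs.eq_or_lt
  · simp
  refine le_of_eq ?_
  simp only [mul_pow]
  rw [lintegral_const_mul' _ _ (by finiteness),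
    lintegral_comp_smul volume (hh.pow_const 2) (by positivity : s ^ 2 ≠ 0),
    finrank_euclideanSpace_fin, ← mul_assoc, ← ENNReal.ofReal_pow (by positivity),
    ← ENNReal.ofReal_mul (by positivity), abs_of_pos (by positivity),
    ← ENNReal.ofReal_coe_nnreal, ← ENNReal.ofReal_pow (by positivity)]
  congr 2
  field_simp

section Potential

/-- The integrand of the Poincaré potential of `u`, along the segment from the origin to `x`
parametrised by `s ↦ s² x`. With this parametrisation the factor `s³` that multiplies `curl u` in
`sub_grad_potential_apply` is exactly compensated by the dilation in `L²`. -/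
def potentialKernel (u : R3 → C3) (x : R3) (s : ℝ) : ℂ :=
  ∑ j, (2 * s * x j) • u (s ^ 2 • x) j

/-- The Poincaré potential of `u` based at the origin; its gradient is `u` if `curl u = 0`. -/
def potential (u : R3 → C3) (x : R3) : ℂ := ∫ s in (0 : ℝ)..1, potentialKernel u x s

variable {u : R3 → C3} (hu : ∀ i, ContDiff ℝ ∞ fun x => u x i)
include hu

theorem continuous_curl : Continuous (curl u) := by
  refine (PiLp.continuous_toLp 2 _).comp (continuous_pi fun i => ?_)
  have h : ∀ i j, Continuous (pderiv j fun y => u y i) := fun i j =>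
    (contDiff_pderiv (hu i) j).continuous
  fin_cases i
  · exact (h 2 1).sub (h 1 2)
  · exact (h 0 2).sub (h 2 0)
  · exact (h 1 0).sub (h 0 1)

theorem contDiff_potentialKernel : ContDiff ℝ 1 (Function.uncurry (potentialKernel u)) := by
  have hcoord : ∀ j, ContDiff ℝ 1 fun z : R3 × ℝ => 2 * z.2 * z.1 j := fun j =>
    (contDiff_const.mul contDiff_snd).mul
      ((EuclideanSpace.proj (𝕜 := ℝ) j).contDiff.comp contDiff_fst)
  have hdilate : ∀ j, ContDiff ℝ 1 fun z : R3 × ℝ => u (z.2 ^ 2 • z.1) j := fun j =>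
    ((hu j).of_le (by simp)).comp ((contDiff_snd.pow 2).smul contDiff_fst)
  have hterm : ∀ j, ContDiff ℝ 1 fun z : R3 × ℝ => (2 * z.2 * z.1 j) • u (z.2 ^ 2 • z.1) j :=
    fun j => (hcoord j).smul (hdilate j)
  exact ContDiff.sum (s := Finset.univ) fun j _ => hterm j

theorem contDiff_potential : ContDiff ℝ 1 (potential u) :=
  contDiff_one_intervalIntegral (contDiff_potentialKernel hu) 0 1

theorem pderiv_potentialKernel (i : Fin 3) (x : R3) (s : ℝ) :
    pderiv i (potentialKernel u · s) x = (2 * s) • u (s ^ 2 • x) i +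
      ∑ j, (2 * s ^ 3 * x j) • pderiv i (fun y => u y j) (s ^ 2 • x) := by
  have hcoord : ∀ j, HasFDerivAt (fun x : R3 => 2 * s * x j)
      ((2 * s) • (EuclideanSpace.proj (𝕜 := ℝ) j : R3 →L[ℝ] ℝ)) x := fun j =>
    (EuclideanSpace.proj (𝕜 := ℝ) j : R3 →L[ℝ] ℝ).hasFDerivAt.const_mul (2 * s)
  have hdilate : ∀ j, HasFDerivAt (fun x : R3 => u (s ^ 2 • x) j)
      (s ^ 2 • fderiv ℝ (fun y => u y j) (s ^ 2 • x)) x := fun j => by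
    have hdiff : Differentiable ℝ fun x : R3 => u (s ^ 2 • x) j :=
      ((hu j).differentiable (by simp)).comp (differentiable_id.const_smul (s ^ 2))
    exact (hdiff x).hasFDerivAt.congr_fderiv (fderiv_comp_smul (f := fun y => u y j) (s ^ 2))
  have hsum : HasFDerivAt (potentialKernel u · s) _ x :=
    HasFDerivAt.fun_sum fun j _ => (hcoord j).smul (hdilate j)
  rw [pderiv, hsum.fderiv]
  simp only [_root_.sum_apply, _root_.add_apply, _root_.smul_apply,
    ContinuousLinearMap.smulRight_apply, Finset.sum_add_distrib, PiLp.proj_apply,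
    PiLp.single_apply, smul_smul, pderiv]
  rw [add_comm]
  congr 1
  · simp
  · exact Finset.sum_congr rfl fun j _ => by ring_nf

theorem sub_grad_potential_apply (x : R3) (i : Fin 3) :
    (u x - grad (potential u) x) i = ∫ s in (0 : ℝ)..1, ∑ j, (2 * s ^ 3 * x j) •
      (pderiv j (fun y => u y i) (s ^ 2 • x) - pderiv i (fun y => u y j) (s ^ 2 • x)) := by
  have hp : ∀ i j, Continuous (pderiv j fun y => u y i) := fun i j =>
    (contDiff_pderiv (hu i) j).continuous
  have hpotential : pderiv i (potential u) x = ∫ s in (0 : ℝ)..1, ((2 * s) • u (s ^ 2 • x) i +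
      ∑ j, (2 * s ^ 3 * x j) • pderiv i (fun y => u y j) (s ^ 2 • x)) := by
    simp only [← pderiv_potentialKernel hu]
    exact pderiv_intervalIntegral (contDiff_potentialKernel hu) 0 1 i x
  rw [PiLp.sub_apply, grad_apply, hpotential, ← integral_radial_eq (hu i) x,
    ← intervalIntegral.integral_sub]
  · refine intervalIntegral.integral_congr fun s _ => ?_
    simp only [smul_sub, Finset.sum_sub_distrib]
    abel
  · exact (continuous_radial (hu i).continuous (fun j => hp i j) x).intervalIntegrable 0 1
  · exact (continuous_radial (hu i).continuous (fun j => hp j i) x).intervalIntegrable 0 1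

theorem enorm_sub_grad_potential_apply_le {R : NNReal} {x : R3} (hx : ‖x‖ ≤ R) (i : Fin 3) :
    ‖(u x - grad (potential u) x) i‖ₑ ≤
      ∫⁻ s in Set.Icc (0 : ℝ) 1, ENNReal.ofReal (6 * R * s ^ 3) * ‖curl u (s ^ 2 • x)‖ₑ := by
  rw [sub_grad_potential_apply hu, intervalIntegral.integral_of_le zero_le_one,
    ← integral_Icc_eq_integral_Ioc]
  refine (enorm_integral_le_lintegral_enorm _).trans
    (setLIntegral_mono' measurableSet_Icc fun s hs => ?_)
  have hs0 : 0 ≤ s := hs.1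
  rw [← ofReal_norm, ← ofReal_norm, ← ENNReal.ofReal_mul (by positivity)]
  refine ENNReal.ofReal_le_ofReal ?_
  calc ‖∑ j, (2 * s ^ 3 * x j) •
        (pderiv j (fun y => u y i) (s ^ 2 • x) - pderiv i (fun y => u y j) (s ^ 2 • x))‖
      ≤ ∑ _j : Fin 3, 2 * s ^ 3 * R * ‖curl u (s ^ 2 • x)‖ := norm_sum_le_of_le _ fun j _ => by
        rw [norm_smul, norm_mul, Real.norm_of_nonneg (by positivity : 0 ≤ 2 * s ^ 3)]
        gcongr
        · exact (PiLp.norm_apply_le x j).trans hx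
        · exact norm_pderiv_sub_le_norm_curl u _ i j
    _ = 6 * R * s ^ 3 * ‖curl u (s ^ 2 • x)‖ := by
        rw [Finset.sum_const, Finset.card_univ, Fintype.card_fin, nsmul_eq_mul]
        push_cast
        ring

theorem measurable_curl_comp_sq_smul (c : ℝ) : Measurable fun z : R3 × ℝ =>
    ENNReal.ofReal (c * z.2 ^ 3) * ‖curl u (z.2 ^ 2 • z.1)‖ₑ := by
  have hcurl : Continuous fun z : R3 × ℝ => curl u (z.2 ^ 2 • z.1) :=
    (continuous_curl hu).comp (by fun_prop)
  exact (ENNReal.measurable_ofReal.comp (by fun_prop)).mul hcurl.enorm.measurable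

theorem enorm_sub_grad_potential_sq_le {R : NNReal} {x : R3} (hx : ‖x‖ ≤ R) :
    ‖u x - grad (potential u) x‖ₑ ^ 2 ≤ 3 * ∫⁻ s in Set.Icc (0 : ℝ) 1,
      (ENNReal.ofReal (6 * R * s ^ 3) * ‖curl u (s ^ 2 • x)‖ₑ) ^ 2 := by
  have := isProbabilityMeasure_unitInterval
  calc ‖u x - grad (potential u) x‖ₑ ^ 2
      = ∑ i, ‖(u x - grad (potential u) x) i‖ₑ ^ 2 := enorm_sq_eq_sum _
    _ ≤ ∑ _i : Fin 3, (∫⁻ s in Set.Icc (0 : ℝ) 1,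
        ENNReal.ofReal (6 * R * s ^ 3) * ‖curl u (s ^ 2 • x)‖ₑ) ^ 2 :=
        Finset.sum_le_sum fun i _ => by
          gcongr
          exact enorm_sub_grad_potential_apply_le hu hx i
    _ ≤ ∑ _i : Fin 3, ∫⁻ s in Set.Icc (0 : ℝ) 1,
        (ENNReal.ofReal (6 * R * s ^ 3) * ‖curl u (s ^ 2 • x)‖ₑ) ^ 2 :=
        Finset.sum_le_sum fun _ _ => sq_lintegral_le
          ((measurable_curl_comp_sq_smul hu (6 * R)).comp measurable_prodMk_left).aemeasurable
    _ = _ := by simp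

theorem lintegral_sub_grad_potential_le (R : NNReal) :
    ∫⁻ x in Metric.closedBall 0 R, ‖u x - grad (potential u) x‖ₑ ^ 2 ≤
      ((3 * (6 * R) ^ 2 : NNReal) : ENNReal) * ∫⁻ x, ‖curl u x‖ₑ ^ 2 := by
  calc ∫⁻ x in Metric.closedBall 0 R, ‖u x - grad (potential u) x‖ₑ ^ 2
      ≤ ∫⁻ x in Metric.closedBall 0 R, 3 * ∫⁻ s in Set.Icc (0 : ℝ) 1,
          (ENNReal.ofReal (6 * R * s ^ 3) * ‖curl u (s ^ 2 • x)‖ₑ) ^ 2 :=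
        setLIntegral_mono' measurableSet_closedBall fun x hx =>
          enorm_sub_grad_potential_sq_le hu (mem_closedBall_zero_iff.1 hx)
    _ ≤ ∫⁻ x, 3 * ∫⁻ s in Set.Icc (0 : ℝ) 1,
          (ENNReal.ofReal (6 * R * s ^ 3) * ‖curl u (s ^ 2 • x)‖ₑ) ^ 2 :=
        setLIntegral_le_lintegral _ _
    _ = 3 * ∫⁻ s in Set.Icc (0 : ℝ) 1, ∫⁻ x,
          (ENNReal.ofReal (6 * R * s ^ 3) * ‖curl u (s ^ 2 • x)‖ₑ) ^ 2 := by
        rw [lintegral_const_mul' _ _ (by norm_num), lintegral_lintegral_swap]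
        exact ((measurable_curl_comp_sq_smul hu (6 * R)).pow_const 2).aemeasurable
    _ ≤ 3 * ∫⁻ _s in Set.Icc (0 : ℝ) 1, ((6 * R : NNReal) : ENNReal) ^ 2 *
          ∫⁻ x, ‖curl u x‖ₑ ^ 2 := by
        gcongr 3 * ?_
        refine setLIntegral_mono' measurableSet_Icc fun s hs => ?_
        simpa using lintegral_pow_mul_comp_sq_smul_sq_le
          (continuous_curl hu).enorm.measurable (6 * R) hs.1
    _ = _ := by
        have := isProbabilityMeasure_unitInterval
        rw [lintegral_const, measure_univ, mul_one]
        push_cast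
        ring

end Potential

/-! ### The curl estimate -/

section General

theorem grad_eq_of_eventuallyEq {f g : R3 → ℂ} {x : R3} (h : f =ᶠ[𝓝 x] g) :
    grad f x = grad g x := by
  ext i
  rw [grad_apply, grad_apply, pderiv, pderiv, h.fderiv_eq]

theorem exists_hasCompactSupport_eventuallyEq {E F : Type*} [NormedAddCommGroup E]
    [InnerProductSpace ℝ E] [FiniteDimensional ℝ E] [NormedAddCommGroup F] [NormedSpace ℝ F]
    {n : ℕ∞} {f : E → F} (hf : ContDiff ℝ n f) (R : NNReal) :
    ∃ g : E → F, ContDiff ℝ n g ∧ HasCompactSupport g ∧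
      ∀ x ∈ Metric.closedBall 0 (R : ℝ), g =ᶠ[𝓝 x] f := by
  let ζ : ContDiffBump (0 : E) := ⟨R + 1, R + 2, by positivity, by linarith⟩
  refine ⟨fun x => ζ x • f x, ζ.contDiff.smul hf, ζ.hasCompactSupport.smul_right, fun x hx => ?_⟩
  have hmem : x ∈ Metric.ball (0 : E) (R + 1) :=
    Metric.closedBall_subset_ball (lt_add_one _) hx
  filter_upwards [Metric.isOpen_ball.mem_nhds hmem] with y hy
  rw [ζ.one_of_mem_closedBall (Metric.ball_subset_closedBall hy), one_smul]

variable {X E F : Type*} [MeasurableSpace X] {μ : Measure X} [NormedAddCommGroup E]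
  [NormedAddCommGroup F]

theorem enorm_sq_eq_lintegral (a : Lp E 2 μ) : ‖a‖ₑ ^ 2 = ∫⁻ x, ‖a x‖ₑ ^ 2 ∂μ := by
  rw [Lp.enorm_def]
  simpa using eLpNorm_nnreal_pow_eq_lintegral (μ := μ) (f := a) (p := 2) two_ne_zero

theorem norm_le_of_lintegral_le {a : Lp E 2 μ} {b : Lp F 2 μ} {f : X → E} {g : X → F}
    (ha : a =ᵐ[μ] f) (hb : b =ᵐ[μ] g) {D : NNReal}
    (h : ∫⁻ x, ‖f x‖ₑ ^ 2 ∂μ ≤ D * ∫⁻ x, ‖g x‖ₑ ^ 2 ∂μ) : ‖a‖ ≤ √D * ‖b‖ := by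
  have hsq : ‖a‖ₑ ^ 2 ≤ D * ‖b‖ₑ ^ 2 := by
    rw [enorm_sq_eq_lintegral, enorm_sq_eq_lintegral,
      lintegral_congr_ae (ha.mono fun x hx => congrArg (‖·‖ₑ ^ 2) hx),
      lintegral_congr_ae (hb.mono fun x hx => congrArg (‖·‖ₑ ^ 2) hx)]
    exact h
  have hsq' : ‖a‖₊ ^ 2 ≤ D * ‖b‖₊ ^ 2 := by
    simp only [enorm_eq_nnnorm] at hsq
    exact_mod_cast hsq
  calc ‖a‖ ≤ √(D * ‖b‖ ^ 2) := Real.le_sqrt_of_sq_le (by exact_mod_cast hsq')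
    _ = √D * ‖b‖ := by rw [Real.sqrt_mul D.coe_nonneg, Real.sqrt_sq (norm_nonneg b)]

end General

theorem IsReflectionChart.exists_lintegral_grad_reflected_le {Ω U : Set R3} {ρ : R3 → R3}
    {K C : NNReal} (h : IsReflectionChart Ω U ρ K C) {θ : R3 → ℝ} (hθU : tsupport θ ⊆ U)
    {T L : NNReal} (hT : ∀ x, ‖θ x‖ ≤ T) (hL : LipschitzWith L θ) (hΩ : IsOpen Ω) :
    ∃ D : NNReal, ∀ p : R3 → ℂ, ContDiff ℝ 1 p → ∃ c : ℂ,
      ∫⁻ x in Ω, ‖grad (reflected θ ρ p c) x‖ₑ ^ 2 ≤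
        D * ∫⁻ x in U \ closure Ω, ‖grad p x‖ₑ ^ 2 := by
  obtain ⟨D, hD⟩ := h.exists_lintegral_fderiv_reflected_le hθU hT hL hΩ
  refine ⟨4 * D, fun p hp => ?_⟩
  obtain ⟨c, hc⟩ := hD p hp
  have hgrad : ∀ x, ‖grad (reflected θ ρ p c) x‖ₑ ^ 2 ≤
      4 * ‖fderiv ℝ (reflected θ ρ p c) x‖ₑ ^ 2 := fun x => by
    have hle : ‖grad (reflected θ ρ p c) x‖₊ ≤ 2 * ‖fderiv ℝ (reflected θ ρ p c) x‖₊ :=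
      norm_grad_le_two_mul_norm_fderiv _ x
    have hsq : ‖grad (reflected θ ρ p c) x‖₊ ^ 2 ≤ 4 * ‖fderiv ℝ (reflected θ ρ p c) x‖₊ ^ 2 := by
      grw [hle, mul_pow]
      norm_num
    simp only [enorm_eq_nnnorm]
    exact_mod_cast hsq
  refine ⟨c, ?_⟩
  calc ∫⁻ x in Ω, ‖grad (reflected θ ρ p c) x‖ₑ ^ 2
      ≤ ∫⁻ x in Ω, 4 * ‖fderiv ℝ (reflected θ ρ p c) x‖ₑ ^ 2 := lintegral_mono hgrad
    _ = 4 * ∫⁻ x in Ω, ‖fderiv ℝ (reflected θ ρ p c) x‖ₑ ^ 2 :=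
        lintegral_const_mul' _ _ (by norm_num)
    _ ≤ 4 * (D * ∫⁻ x in U \ closure Ω, ‖grad p x‖ₑ ^ 2) := by
        refine mul_le_mul_right (hc.trans ?_) 4
        gcongr D * ?_
        refine lintegral_mono fun x => ?_
        gcongr
        exact enorm_le_iff_norm_le.2 (norm_fderiv_le_norm_grad p x)
    _ = ((4 * D : NNReal) : ENNReal) * ∫⁻ x in U \ closure Ω, ‖grad p x‖ₑ ^ 2 := by
        push_cast
        rw [mul_assoc]

variable {Ω : Set R3}

theorem IsTest.exists_lintegral_sub_grad_le {φ : R3 → C3} (hφ : IsTest Ω φ) (R : NNReal) :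
    ∃ p : R3 → ℂ, ContDiff ℝ 1 p ∧ HasCompactSupport p ∧
      ∫⁻ x in Metric.closedBall 0 R, ‖φ x - NonlocalH.grad p x‖ₑ ^ 2 ≤
        ((3 * (6 * R) ^ 2 : NNReal) : ENNReal) * ∫⁻ x in Ω, ‖NonlocalH.curl φ x‖ₑ ^ 2 := by
  have hsmooth : ∀ i, ContDiff ℝ ∞ fun x => φ x i := fun i => (hφ.apply i).1
  obtain ⟨p, hp, hpc, hpeq⟩ := exists_hasCompactSupport_eventuallyEq
    (n := 1) (contDiff_potential hsmooth) R
  have hsupport : (fun x => ‖NonlocalH.curl φ x‖ₑ ^ 2).support ⊆ Ω := fun x hx => by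
    by_contra hxΩ
    exact hx (by simp [hφ.curl.eq_zero hxΩ])
  refine ⟨p, hp, hpc, ?_⟩
  rw [setLIntegral_eq_of_support_subset hsupport]
  refine le_of_eq_of_le ?_ (lintegral_sub_grad_potential_le hsmooth R)
  refine setLIntegral_congr_fun measurableSet_closedBall fun x hx => ?_
  simp only [grad_eq_of_eventuallyEq (hpeq x hx)]

/-- Finitely many reflection charts that cover the boundary, with a subordinate partition of
unity. -/
structure BoundaryCover (Ω : Set R3) (ι : Type*) [Fintype ι] where
  U : ι → Set R3
  ρ : ι → R3 → R3
  K : ι → NNReal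
  C : ι → NNReal
  θ : ι → R3 → ℝ
  L : ι → NNReal
  chart : ∀ k, IsReflectionChart Ω (U k) (ρ k) (K k) (C k)
  tsupport_subset : ∀ k, tsupport (θ k) ⊆ U k
  norm_le_one : ∀ k x, ‖θ k x‖ ≤ (1 : NNReal)
  contDiff : ∀ k, ContDiff ℝ ∞ (θ k)
  lip : ∀ k, LipschitzWith (L k) (θ k)
  sum_eq_one : ∀ x ∈ frontier Ω, ∑ k, θ k x = 1

theorem IsWeakLipschitz.exists_isReflectionChart (hΩ : IsWeakLipschitz Ω) {x₀ : R3}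
    (hx₀ : x₀ ∈ frontier Ω) : ∃ (U : Set R3) (ρ : R3 → R3) (K C : NNReal),
      x₀ ∈ U ∧ IsReflectionChart Ω U ρ K C := by
  obtain ⟨U, χ, χ', K, L, hmem, h⟩ := hΩ.exists_isCubeChart hx₀
  obtain ⟨C, hC⟩ := h.exists_isReflectionChart
  exact ⟨U, chartReflection χ χ', L * K, C, hmem, hC⟩

theorem IsWeakLipschitz.exists_boundaryCover (hΩ : IsWeakLipschitz Ω)
    (hb : Bornology.IsBounded Ω) : ∃ t : Finset (frontier Ω), Nonempty (BoundaryCover Ω t) := by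
  choose U ρ K C hmem hchart using fun x : frontier Ω => hΩ.exists_isReflectionChart x.2
  have hcompact : IsCompact (frontier Ω) :=
    Metric.isCompact_of_isClosed_isBounded isClosed_frontier
      (hb.closure.subset frontier_subset_closure)
  obtain ⟨t, ht⟩ := hcompact.elim_finite_subcover U (fun k => (hchart k).isOpen)
    fun x hx => Set.mem_iUnion.2 ⟨⟨x, hx⟩, hmem ⟨x, hx⟩⟩
  obtain ⟨f, hf⟩ := SmoothPartitionOfUnity.exists_isSubordinate (ι := t)
    (modelWithCornersSelf ℝ R3) (isClosed_frontier (s := Ω)) (fun k => U k)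
    (fun k => (hchart k).isOpen) (by simpa [Set.iUnion_subtype] using ht)
  have hsmooth : ∀ k, ContDiff ℝ ∞ (f k) := fun k => (f k).contMDiff.contDiff
  have hsupport : ∀ k, HasCompactSupport (f k) := fun k =>
    Metric.isCompact_of_isClosed_isBounded (isClosed_tsupport _)
      ((hchart k).isBounded.subset (hf k))
  choose L hL using fun k =>
    ContDiff.lipschitzWith_of_hasCompactSupport (hsupport k) (hsmooth k) (by simp)
  exact ⟨t, ⟨{
    U := fun k => U k
    ρ := fun k => ρ k
    K := fun k => K k
    C := fun k => C k
    θ := fun k => f k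
    L := L
    chart := fun k => hchart k
    tsupport_subset := hf
    norm_le_one := fun k x => by
      rw [Real.norm_of_nonneg (f.nonneg k x)]
      exact f.le_one k x
    contDiff := hsmooth
    lip := hL
    sum_eq_one := fun x hx => by
      rw [← finsum_eq_sum_of_fintype]
      exact f.sum_eq_one hx }⟩⟩

namespace BoundaryCover

variable {ι : Type*} [Fintype ι] (B : BoundaryCover Ω ι)

/-- The cutoff functions of the partition of unity, complex valued. -/
def cutoff (k : ι) (x : R3) : ℂ := B.θ k x

theorem contDiff_cutoff (k : ι) : ContDiff ℝ ∞ (B.cutoff k) :=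
  Complex.ofRealCLM.contDiff.comp (B.contDiff k)

theorem lipschitzWith_cutoff (k : ι) : LipschitzWith (B.L k) (B.cutoff k) := by
  have hcomp := Complex.isometry_ofReal.lipschitz.comp (B.lip k)
  rwa [one_mul] at hcomp

/-- The gradients of the cutoff functions, which span the finite-dimensional defect in the curl
estimate. -/
def cutoffGrad (hb : Bornology.IsBounded Ω) (k : ι) : L2v Ω :=
  (memLp_grad_of_lipschitz hb (B.lipschitzWith_cutoff k)).toLp

theorem coeFn_cutoffGrad (hb : Bornology.IsBounded Ω) (k : ι) :
    B.cutoffGrad hb k =ᵐ[volume.restrict Ω] grad (B.cutoff k) :=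
  MemLp.coeFn_toLp _

/-- `p - c` reflected in the `k`-th chart. -/
abbrev reflect (p : R3 → ℂ) (c : ℂ) (k : ι) : R3 → ℂ := reflected (B.θ k) (B.ρ k) p c

/-- `p` minus its reflections, which cancel it on the boundary. -/
def corrected (p : R3 → ℂ) (x : R3) : ℂ := p x - ∑ k, B.reflect p 0 k x

theorem corrected_eq_zero (p : R3 → ℂ) {x : R3} (hx : x ∈ frontier Ω) : B.corrected p x = 0 := by
  have hreflect : ∀ k, B.reflect p 0 k x = B.θ k x • p x := fun k => by
    simpa only [sub_zero] using
      (B.chart k).reflected_eq_of_mem_frontier (B.tsupport_subset k) 0 hx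
  rw [corrected, Finset.sum_congr rfl fun k _ => hreflect k, ← Finset.sum_smul,
    B.sum_eq_one x hx, one_smul, sub_self]

theorem reflect_zero_eq (p : R3 → ℂ) (c : ℂ) (k : ι) (x : R3) :
    B.reflect p 0 k x = B.reflect p c k x + c * B.cutoff k x := by
  simp only [reflected, cutoff, Complex.real_smul]
  ring

theorem exists_lipschitzWith_reflect {p : R3 → ℂ} {P : NNReal} (hp : LipschitzWith P p) (c : ℂ)
    (k : ι) : ∃ D : NNReal, LipschitzWith D (B.reflect p c k) :=
  (B.chart k).exists_lipschitzWith_reflected (B.tsupport_subset k) (B.norm_le_one k) (B.lip k) hp c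

theorem exists_lipschitzWith_corrected {p : R3 → ℂ} {P : NNReal} (hp : LipschitzWith P p) :
    ∃ D : NNReal, LipschitzWith D (B.corrected p) := by
  choose D hD using B.exists_lipschitzWith_reflect hp 0
  have hsum : ∀ s : Finset ι, LipschitzWith (∑ k ∈ s, D k) fun x => ∑ k ∈ s, B.reflect p 0 k x := by
    classical
    intro s
    induction s using Finset.induction_on with
    | empty => simp
    | insert k s hk ih =>
      simp only [Finset.sum_insert hk]
      exact (hD k).add ih
  exact ⟨_, hp.sub (hsum Finset.univ)⟩

theorem grad_corrected {p : R3 → ℂ} (c : ι → ℂ) {x : R3} (hp : DifferentiableAt ℝ p x)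
    (hr : ∀ k, DifferentiableAt ℝ (B.reflect p (c k) k) x) :
    grad (B.corrected p) x = grad p x -
      ∑ k, (grad (B.reflect p (c k) k) x + c k • grad (B.cutoff k) x) := by
  have hcutoff : ∀ k, DifferentiableAt ℝ (B.cutoff k) x := fun k =>
    (B.contDiff_cutoff k).differentiable (by simp) x
  have heq : B.corrected p =
      fun x => p x - ∑ k, (B.reflect p (c k) k x + c k * B.cutoff k x) :=
    funext fun x => congrArg (p x - ·)
      (Finset.sum_congr rfl fun k _ => B.reflect_zero_eq p (c k) k x)
  have hderiv : HasFDerivAt (B.corrected p) (fderiv ℝ p x -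
      ∑ k, (fderiv ℝ (B.reflect p (c k) k) x + c k • fderiv ℝ (B.cutoff k) x)) x := by
    rw [heq]
    exact hp.hasFDerivAt.sub (HasFDerivAt.fun_sum fun k _ =>
      (hr k).hasFDerivAt.add ((hcutoff k).hasFDerivAt.const_mul (c k)))
  ext i
  rw [grad_apply, pderiv, hderiv.fderiv, PiLp.sub_apply, WithLp.ofLp_sum, Finset.sum_apply]
  simp [pderiv]

theorem mem_gZero_sup_span_cutoffGrad (hΩ : IsOpen Ω) (hb : Bornology.IsBounded Ω)
    {p : R3 → ℂ} {P : NNReal} (hp : LipschitzWith P p) (c : ι → ℂ) {w : L2v Ω}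
    (hw : w =ᵐ[volume.restrict Ω] fun x => grad p x - ∑ k, grad (B.reflect p (c k) k) x) :
    w ∈ gZero Ω ⊔ Submodule.span ℂ (Set.range (B.cutoffGrad hb)) := by
  obtain ⟨Q, hQ⟩ := B.exists_lipschitzWith_corrected hp
  choose E hE using fun k => B.exists_lipschitzWith_reflect hp (c k) k
  have hgZero : w - ∑ k, c k • B.cutoffGrad hb k ∈ gZero Ω := by
    refine mem_gZero_of_lipschitz hΩ hb
      (lipschitzWith_indicator hQ fun x hx => B.corrected_eq_zero p hx)
      (fun x hx => Set.indicator_of_notMem hx _) ?_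
    filter_upwards [Lp.coeFn_sub w (∑ k, c k • B.cutoffGrad hb k), hw,
      Lp.coeFn_finsetSum Finset.univ fun k => c k • B.cutoffGrad hb k,
      ae_all_iff.2 fun k => Lp.coeFn_smul (c k) (B.cutoffGrad hb k),
      ae_all_iff.2 (B.coeFn_cutoffGrad hb), ae_restrict_mem hΩ.measurableSet,
      ae_restrict_of_ae hp.ae_differentiableAt,
      ae_restrict_of_ae (ae_all_iff.2 fun k => (hE k).ae_differentiableAt)]
      with x hsub hwx hsum hsmul hcutoff hx hpx hrx
    have hindicator : Ω.indicator (B.corrected p) =ᶠ[𝓝 x] B.corrected p :=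
      Filter.eventuallyEq_of_mem (hΩ.mem_nhds hx) (Set.eqOn_indicator)
    rw [grad_eq_of_eventuallyEq hindicator, B.grad_corrected c hpx hrx, hsub, Pi.sub_apply, hwx,
      hsum, Finset.sum_apply, Finset.sum_add_distrib, sub_sub]
    simp only [hsmul, Pi.smul_apply, hcutoff]
  rw [← sub_add_cancel w (∑ k, c k • B.cutoffGrad hb k)]
  exact Submodule.add_mem_sup hgZero (Submodule.sum_mem _ fun k _ =>
    Submodule.smul_mem _ _ (Submodule.subset_span ⟨k, rfl⟩))

theorem exists_subset_closedBall (hb : Bornology.IsBounded Ω) :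
    ∃ R : NNReal, Ω ⊆ Metric.closedBall 0 R ∧ ∀ k, B.U k ⊆ Metric.closedBall 0 R := by
  have hbounded : Bornology.IsBounded (Ω ∪ ⋃ k, B.U k) :=
    hb.union (Bornology.isBounded_iUnion.2 fun k => (B.chart k).isBounded)
  obtain ⟨R, hR0, hR⟩ := hbounded.subset_closedBall_lt 0 0
  exact ⟨⟨R, hR0.le⟩, Set.subset_union_left.trans hR,
    fun k => (Set.subset_iUnion B.U k).trans (Set.subset_union_right.trans hR)⟩

/-- Outside `closure Ω` the test field `φ` vanishes, so that `grad p` there is as small as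
`φ - grad p`; the reflections carry this smallness into `Ω`. -/
theorem exists_lintegral_grad_reflect_le (hΩ : IsOpen Ω) : ∃ D : ι → NNReal,
    ∀ φ, IsTest Ω φ → ∀ p : R3 → ℂ, ContDiff ℝ 1 p → ∃ c : ι → ℂ, ∀ k,
      ∫⁻ x in Ω, ‖grad (B.reflect p (c k) k) x‖ₑ ^ 2 ≤
        D k * ∫⁻ x in B.U k, ‖φ x - grad p x‖ₑ ^ 2 := by
  choose D hD using fun k => (B.chart k).exists_lintegral_grad_reflected_le
    (B.tsupport_subset k) (B.norm_le_one k) (B.lip k) hΩ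
  refine ⟨D, fun φ hφ p hp => ?_⟩
  choose c hc using fun k => hD k p hp
  refine ⟨c, fun k => (hc k).trans ?_⟩
  gcongr D k * ?_
  calc ∫⁻ x in B.U k \ closure Ω, ‖grad p x‖ₑ ^ 2
      = ∫⁻ x in B.U k \ closure Ω, ‖φ x - grad p x‖ₑ ^ 2 :=
        setLIntegral_congr_fun ((B.chart k).isOpen.sdiff isClosed_closure).measurableSet
          fun x hx => by
            simp only [hφ.eq_zero fun hxΩ => hx.2 (subset_closure hxΩ), zero_sub, enorm_neg]
    _ ≤ ∫⁻ x in B.U k, ‖φ x - grad p x‖ₑ ^ 2 := lintegral_mono_set Set.sdiff_subset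

include B in
theorem hasCurlEstimate (hΩ : IsOpen Ω) (hb : Bornology.IsBounded Ω) : HasCurlEstimate Ω := by
  obtain ⟨R, hRΩ, hRU⟩ := B.exists_subset_closedBall hb
  obtain ⟨D, hD⟩ := B.exists_lintegral_grad_reflect_le hΩ
  let A : NNReal := 3 * (6 * R) ^ 2
  refine ⟨√A + ∑ k, √(D k * A : NNReal), Submodule.span ℂ (Set.range (B.cutoffGrad hb)),
    FiniteDimensional.span_of_finite ℂ (Set.finite_range _), ?_⟩
  rintro q ⟨φ, hφ, hqφ, hqcurl⟩
  obtain ⟨p, hp, hpc, (hv : _ ≤ (A : ENNReal) * _)⟩ := hφ.exists_lintegral_sub_grad_le R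
  obtain ⟨c, hc⟩ := hD φ hφ p hp
  obtain ⟨P, hP⟩ := ContDiff.lipschitzWith_of_hasCompactSupport hpc hp one_ne_zero
  choose E hE using fun k => B.exists_lipschitzWith_reflect hP (c k) k
  have hmv : MemLp (φ - grad p) 2 (volume.restrict Ω) :=
    (hφ.memLp _).sub (memLp_grad_of_lipschitz hb hP)
  have hmr : ∀ k, MemLp (grad (B.reflect p (c k) k)) 2 (volume.restrict Ω) := fun k =>
    memLp_grad_of_lipschitz hb (hE k)
  have hmem : q.1 - (hmv.toLp + ∑ k, (hmr k).toLp) ∈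
      gZero Ω ⊔ Submodule.span ℂ (Set.range (B.cutoffGrad hb)) := by
    refine B.mem_gZero_sup_span_cutoffGrad hΩ hb hP c ?_
    filter_upwards [Lp.coeFn_sub q.1 (hmv.toLp + ∑ k, (hmr k).toLp), hqφ,
      Lp.coeFn_add hmv.toLp (∑ k, (hmr k).toLp), hmv.coeFn_toLp,
      Lp.coeFn_finsetSum Finset.univ fun k => (hmr k).toLp,
      ae_all_iff.2 fun k => (hmr k).coeFn_toLp] with x hsub hqx hadd hvx hsum hrx
    rw [hsub, Pi.sub_apply, hqx, hadd, Pi.add_apply, hvx, hsum, Finset.sum_apply, Pi.sub_apply]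
    simp only [hrx]
    abel
  refine (Metric.infDist_le_dist_of_mem hmem).trans ?_
  rw [dist_eq_norm, sub_sub_cancel, add_mul, Finset.sum_mul]
  refine norm_add_le_of_le ?_ (norm_sum_le_of_le _ fun k _ => ?_)
  · exact norm_le_of_lintegral_le hmv.coeFn_toLp hqcurl ((lintegral_mono_set hRΩ).trans hv)
  · refine norm_le_of_lintegral_le (hmr k).coeFn_toLp hqcurl ((hc k).trans ?_)
    grw [lintegral_mono_set (hRU k), hv, ENNReal.coe_mul (D k) A, mul_assoc]

end BoundaryCover

theorem IsWeakLipschitz.hasCurlEstimate (hL : IsWeakLipschitz Ω) (hΩ : IsOpen Ω)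
    (hb : Bornology.IsBounded Ω) : HasCurlEstimate Ω := by
  obtain ⟨_, ⟨B⟩⟩ := hL.exists_boundaryCover hb
  exact B.hasCurlEstimate hΩ hb

end NonlocalH

end

theorem mainTheorem11_general {Ω : Set NonlocalH.R3} (hΩ : IsOpen Ω)
    (hb : Bornology.IsBounded Ω) (hL : NonlocalH.IsWeakLipschitz Ω)
    (hD : NonlocalH.harmonicD Ω = ⊥) {α β : ℝ} (hα : 0 < α) (hβ : 0 < β)
    {B : Set (NonlocalH.L2v Ω →L[ℂ] NonlocalH.L2v Ω)} (hB : Bornology.IsBounded B) :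
    IsCompact (closure {a : NonlocalH.Coeff α β Ω | a.toCLM ∈ B}) ∧
      TopologicalSpace.MetrizableSpace
        (closure {a : NonlocalH.Coeff α β Ω | a.toCLM ∈ B}) := by
  have : CompleteSpace (NonlocalH.gZero Ω) := (NonlocalH.isClosed_gZero hΩ hb).completeSpace_coe
  have hC : NonlocalH.cRange Ω = (NonlocalH.gZero Ω)ᗮ :=
    NonlocalH.cRange_eq_orthogonal_gZero hD (hL.hasCurlEstimate hΩ hb)
  have : CompleteSpace (NonlocalH.cRange Ω) := hC ▸ inferInstance
  have : Fact ((2 : ENNReal) ≠ ⊤) := ⟨by norm_num⟩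
  have : SecondCountableTopology (NonlocalH.L2v Ω) := Lp.SecondCountableTopology
  exact NonlocalH.isCompact_closure_and_metrizableSpace hα hβ hC
    (A := NonlocalH.Coeff.toCLM) (fun a b h => by cases a; cases b; congr)
    (Set.ext fun a => ⟨fun ⟨x, hx⟩ => hx ▸ x.mem, fun h => ⟨⟨a, h⟩, rfl⟩⟩)
    (NonlocalH.isInducing_components α β Ω) hB

theorem mainTheorem11 (Ω : Set NonlocalH.R3) (hΩ : NonlocalH.IsStandardDomain Ω)
    (α β : ℝ) (hα : 0 < α) (hαβ : α < β)
    (B : Set (NonlocalH.L2v Ω →L[ℂ] NonlocalH.L2v Ω))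
    (hBM : B ⊆ NonlocalH.admissible α β Ω) (hB : Bornology.IsBounded B) :
    IsCompact (closure {a : NonlocalH.Coeff α β Ω | a.toCLM ∈ B}) ∧
      TopologicalSpace.MetrizableSpace
        (closure {a : NonlocalH.Coeff α β Ω | a.toCLM ∈ B}) :=
  mainTheorem11_general hΩ.isOpen hΩ.isBounded hΩ.weakLipschitz
    (Submodule.rank_eq_zero.1 hΩ.topologicallyTrivial.1) hα (hα.trans hαβ) hB
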